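/- **Wavelet basis.** Let $\phi=1_{[0,1]}$ and let $\psi,\tilde\phi,\tilde\psi:\mathbb R\to\mathbb R$ be compactly supported functions such that, for some $r>0$: $\tilde\phi,\tilde\psi$ belong to the Hölder space of order $r+1$; $\psi$ is piecewise constant with finitely many pieces and orthogonal to all polynomials of degree at most $r$; and the systems $(\varphi_\lambda)_{\lambda\in\Lambda}$, $(\tilde\varphi_\lambda)_{\lambda\in\Lambda}$, $\Lambda=\{(j,k):j\ge-1,\ k\in\mathbb Z\}$, with $\varphi_{-1,k}(x)=\phi(x-k)$, $\varphi_{j,k}(x)=2^{j/2}\psi(2^jx-k)$ for $j\ge0$ (and likewise $\tilde\varphi_\lambda$ from $\tilde\phi,\tilde\psi$), are biorthogonal, $\int\varphi_\lambda\tilde\varphi_{\lambda'}=1_{\lambda=\lambda'}$, and form a basis: every $f\in L^2(\mathbb R)$ equals $\sum_\lambda\beta_\lambda\tilde\varphi_\lambda$ in $L^2$ (unconditionally), where $\beta_\lambda=\int\varphi_\lambda f$. The Haar basis $\tilde\phi=\phi$, $\tilde\psi=\psi=1_{[0,1/2]}-1_{[1/2,1]}$, with $r=0$, is also allowed. **Procedure.**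 An intensity is a nonnegative $f\in L^1(\mathbb R)\cap L^2(\mathbb R)$. For each integer $n\ge1$ one observes a Poisson process $N$ on $\mathbb R$ with mean measure $nf(x)\,dx$. Put $\hat\beta_\lambda=\frac1n\int\varphi_\lambda\,dN$, $\hat V_\lambda=\frac1{n^2}\int\varphi_\lambda^2\,dN$, $$\tilde V_\lambda=\hat V_\lambda+\sqrt{2\gamma\log n\,\hat V_\lambda\frac{\|\varphi_\lambda\|_\infty^2}{n^2}}+3\gamma\log n\,\frac{\|\varphi_\lambda\|_\infty^2}{n^2},\qquad \eta_\lambda=\sqrt{2\gamma\tilde V_\lambda\log n}+\frac{\gamma\log n}{3n}\|\varphi_\lambda\|_\infty .$$ Fix $c\ge1$, $c'\in\mathbb R$ and $\gamma>c$; for $n\ge2$ let $j_0=j_0(n)\in\mathbb Z$ be the integer with $2^{j_0}\le n^c(\log n)^{c'}<2^{j_0+1}$, let $\Gamma_n=\{(j,k)\in\Lambda:j\le j_0(n)\}$, and let $$\tilde f_{n,\gamma}=\sum_{\lambda\in\Gamma_n}\hat\beta_\lambda 1_{\{|\hat\beta_\lambda|\ge\eta_\lambda\}}\tilde\varphi_\lambda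 .$$ **Spaces.** All sets below consist of intensities. For $0<s<\frac12$, $\rho_{n,s}=(\log n/n)^s$, $\sigma_\lambda^2=\int\varphi_\lambda^2f$ and $R>0$ let $$MS(R)=\Big\{f:\sup_{n\ge2}\rho_{n,s}^{-2}\,\mathbb E\|\tilde f_{n,\gamma}-f\|_2^2\le R^2\Big\},\qquad B^s_{2,\Gamma}(R)=\Big\{f:\sup_{n\ge2}\rho_{n,s}^{-2}\sum_{\lambda\notin\Gamma_n}\beta_\lambda^2\le R^2\Big\},$$ $$W_s(R)=\Big\{f:\sup_{t>0}t^{-4s}\sum_{\lambda\in\Lambda}\beta_\lambda^21_{\{|\beta_\lambda|\le\sigma_\lambda t\}}\le R^{2-4s}\Big\}.$$ For $\alpha>0$ let $\mathcal B^\alpha_{2,\infty}(R)$ be the set of $f$ in the Besov space $\mathcal B^\alpha_{2,\infty}(\mathbb R)$ (defined by the $L^2$ modulus of continuity of order $\lfloor\alpha\rfloor+1$) with $\big(\sum_k\beta_{-1,k}^2\big)^{1/2}+\sup_{j\ge0}2^{j\alpha}\big(\sum_k\beta_{j,k}^2\big)^{1/2}\le R$. For families of balls $M(R)$, $F(R)$,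 write $M:=:F$ if for every $R>0$ there is $R'>0$ such that $$M(R)\cap L^1(R)\cap L^2(R)\subset F(R')\cap L^1(R)\cap L^2(R),$$ and for every $R'>0$ there is $R>0$ such that $$F(R')\cap L^1(R')\cap L^2(R')\subset M(R)\cap L^1(R')\cap L^2(R'),$$ where $L^p(R)=\{f:\|f\|_p\le R\}$. **Theorem 2.** For all $0<s<\frac12$, $$MS:=:B^s_{2,\Gamma}\cap W_s,\qquad\text{i.e. the balls on the right are } B^s_{2,\Gamma}(R)\cap W_s(R).$$ In particular, if $c'=-c$ and $s/c<r+1$, then $MS:=:\mathcal B^{s/c}_{2,\infty}\cap W_s$. -/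

import Mathlib

open MeasureTheory ProbabilityTheory Filter
open scoped ENNReal NNReal Topology

noncomputable section

namespace PoissonMaxiset

/-! ### Poisson processes on the real line -/

/-- The random set `N` is a Poisson process on `ℝ` with mean measure `μ`, on the probability
space `(Ω, P)`: the numbers of points in measurable sets are random variables with a Poisson
distribution of parameter `μ A` (almost surely infinite when `μ A = ∞`), and they are independent
for disjoint sets. -/
structure IsPoissonProcess {Ω : Type*} [MeasurableSpace Ω] (P : Measure Ω) (N : Ω → Set ℝ)
    (μ : Measure ℝ) : Prop where
  isProbabilityMeasure : IsProbabilityMeasure P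
  countable : ∀ ω, (N ω).Countable
  measurable_count : ∀ A, MeasurableSet A → Measurable fun ω => (N ω ∩ A).encard
  law_count : ∀ A, MeasurableSet A → μ A ≠ ∞ →
    P.map (fun ω => (N ω ∩ A).encard) =
      (poissonMeasure (μ A).toNNReal).map (fun k : ℕ => (k : ℕ∞))
  law_count_top : ∀ A, MeasurableSet A → μ A = ∞ → ∀ᵐ ω ∂P, (N ω ∩ A).encard = ⊤
  indep_count : ∀ (m : ℕ) (A : Fin m → Set ℝ), (∀ i, MeasurableSet (A i)) →
    Pairwise (Function.onFun Disjoint A) → iIndepFun (fun i ω => (N ω ∩ A i).encard) P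

/-- The measure `n f(x) dx`. -/
def meanMeasure (n : ℕ) (f : ℝ → ℝ) : Measure ℝ :=
  volume.withDensity fun x => ENNReal.ofReal (n * f x)

/-- `∫ g dN`, the sum of `g` over the points of `N`. -/
def sumOver (N : Set ℝ) (g : ℝ → ℝ) : ℝ := ∑' T : N, g T

/-! ### Biorthogonal wavelet bases -/

/-- The index set `{(j, k) : j ≥ -1, k ∈ ℤ}`. -/
abbrev Idx : Type := {l : ℤ × ℤ // -1 ≤ l.1}

/-- The father wavelet for analysis, the indicator of `[0, 1]`. -/
def box : ℝ → ℝ := (Set.Icc (0 : ℝ) 1).indicator 1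

/-- The system generated by a father wavelet `φ` and a mother wavelet `ψ`: the function
`φ(x - k)` at the index `(-1, k)` and `2^{j/2} ψ(2^j x - k)` at the index `(j, k)`, `j ≥ 0`. -/
def wavelet (φ ψ : ℝ → ℝ) (l : Idx) (x : ℝ) : ℝ :=
  if l.1.1 = -1 then φ (x - l.1.2)
  else (2 : ℝ) ^ ((l.1.1 : ℝ) / 2) * ψ ((2 : ℝ) ^ l.1.1 * x - l.1.2)

/-- The parameter `r`, the mother wavelet for analysis `ψ`, and the father and mother wavelets for
reconstruction `φd` and `ψd`. The father wavelet for analysis is always `box`. -/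
structure Generators where
  r : ℝ
  ψ : ℝ → ℝ
  φd : ℝ → ℝ
  ψd : ℝ → ℝ

namespace Generators

/-- The analysis functions. -/
def ana (Φ : Generators) (l : Idx) : ℝ → ℝ := wavelet box Φ.ψ l

/-- The reconstruction functions. -/
def syn (Φ : Generators) (l : Idx) : ℝ → ℝ := wavelet Φ.φd Φ.ψd l

/-- The coefficients `β_λ` of `f`. -/
def coeff (Φ : Generators) (f : ℝ → ℝ) (l : Idx) : ℝ := ∫ x, Φ.ana l x * f x

end Generators

/-- Piecewise constant with finitely many breakpoints: constant on every compact interval that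
contains no breakpoint. -/
def IsPiecewiseConstant (g : ℝ → ℝ) : Prop :=
  ∃ B : Finset ℝ, ∀ x y, x ≤ y → (∀ b ∈ B, b ∉ Set.Icc x y) → g x = g y

/-- Hölder regularity of order `σ > 0`: with `σ = m + θ`, `m` a natural number and `0 < θ ≤ 1`,
the function is `m` times continuously differentiable and its `m`-th derivative is Hölder
continuous with exponent `θ`. -/
def HolderRegular (σ : ℝ) (g : ℝ → ℝ) : Prop :=
  ContDiff ℝ ((⌈σ⌉₊ - 1 : ℕ) : ℕ∞) g ∧
    MemHolder (σ - (⌈σ⌉₊ - 1 : ℕ)).toNNReal (iteratedDeriv (⌈σ⌉₊ - 1) g)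

/-- Biorthogonal wavelet bases of `L²(ℝ)` with piecewise constant analysis wavelets and
reconstruction wavelets of regularity `r + 1`, where `r > 0`. -/
structure IsSmoothBiorthogonalBasis (Φ : Generators) : Prop where
  r_pos : 0 < Φ.r
  compact_φd : HasCompactSupport Φ.φd
  compact_ψd : HasCompactSupport Φ.ψd
  holder_φd : HolderRegular (Φ.r + 1) Φ.φd
  holder_ψd : HolderRegular (Φ.r + 1) Φ.ψd
  compact_ψ : HasCompactSupport Φ.ψ
  piecewise_ψ : IsPiecewiseConstant Φ.ψ
  moments_ψ : ∀ m : ℕ, (m : ℝ) ≤ Φ.r → ∫ x, x ^ m * Φ.ψ x = 0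
  biorthogonal : ∀ l l' : Idx, ∫ x, Φ.ana l x * Φ.syn l' x = if l = l' then 1 else 0
  /-- The two families form a basis: every `f ∈ L²` is the sum of its wavelet expansion. -/
  expansion : ∀ f : ℝ → ℝ, MemLp f 2 volume →
    Tendsto (fun S : Finset Idx =>
      eLpNorm (fun x => f x - ∑ l ∈ S, Φ.coeff f l * Φ.syn l x) 2 volume) atTop (𝓝 0)

/-- The Haar mother wavelet. -/
def haarMother : ℝ → ℝ :=
  (Set.Icc (0 : ℝ) (1 / 2)).indicator 1 - (Set.Icc (1 / 2 : ℝ) 1).indicator 1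

/-- The Haar basis, for which `r = 0`. -/
def haar : Generators := ⟨0, haarMother, box, haarMother⟩

/-- The wavelet bases under consideration. -/
def IsWaveletBasis (Φ : Generators) : Prop := IsSmoothBiorthogonalBasis Φ ∨ Φ = haar

/-! ### The thresholding estimator -/

section Estimator

variable (Φ : Generators) (γ : ℝ) (n : ℕ) (N : Set ℝ)

/-- `‖φ_λ‖_∞`. -/
def supNorm (l : Idx) : ℝ := (eLpNorm (Φ.ana l) ∞ volume).toReal

/-- The natural estimator of the coefficient `β_λ`. -/
def coeffHat (l : Idx) : ℝ := 1 / (n : ℝ) * sumOver N (Φ.ana l)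

/-- The natural estimator of the variance of `coeffHat`. -/
def varHat (l : Idx) : ℝ := 1 / (n : ℝ) ^ 2 * sumOver N fun x => Φ.ana l x ^ 2

/-- The slightly overestimated variance. -/
def varTilde (l : Idx) : ℝ :=
  varHat Φ n N l
    + Real.sqrt (2 * γ * Real.log n * varHat Φ n N l * (supNorm Φ l ^ 2 / (n : ℝ) ^ 2))
    + 3 * γ * Real.log n * (supNorm Φ l ^ 2 / (n : ℝ) ^ 2)

/-- The random threshold `η_{λ,γ}`. -/
def threshold (l : Idx) : ℝ :=
  Real.sqrt (2 * γ * varTilde Φ γ n N l * Real.log n)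
    + γ * Real.log n / (3 * n) * supNorm Φ l

/-- The set of indices `(j, k)` with `j ≤ J`. -/
def levels (J : ℤ) : Set Idx := {l | l.1.1 ≤ J}

open Classical in
/-- The thresholded coefficients, for the indices in `levels J`. -/
def coeffTilde (J : ℤ) (l : Idx) : ℝ :=
  if threshold Φ γ n N l ≤ |coeffHat Φ n N l| ∧ l ∈ levels J then coeffHat Φ n N l else 0

/-- The estimator `f̃_{n,γ}` computed from the observed points `N`. -/
def estimator (J : ℤ) (x : ℝ) : ℝ := ∑' l : Idx, coeffTilde Φ γ n N J l * Φ.syn l x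

end Estimator

/-- `j₀(n)` is the integer with `2^{j₀} ≤ n^c (log n)^{c'} < 2^{j₀+1}`. -/
def IsCutoff (c c' : ℝ) (j₀ : ℕ → ℤ) : Prop :=
  ∀ n : ℕ, 2 ≤ n → (2 : ℝ) ^ j₀ n ≤ (n : ℝ) ^ c * Real.log n ^ c' ∧
    (n : ℝ) ^ c * Real.log n ^ c' < (2 : ℝ) ^ (j₀ n + 1)

/-- `E ‖f̃_{n,γ} - f‖₂²` when the observation is the random set `N` under `P`. -/
def risk {Ω : Type*} [MeasurableSpace Ω] (P : Measure Ω) (N : Ω → Set ℝ)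
    (Φ : Generators) (γ : ℝ) (n : ℕ) (J : ℤ) (f : ℝ → ℝ) : ℝ≥0∞ :=
  ∫⁻ ω, eLpNorm (fun x => estimator Φ γ n (N ω) J x - f x) 2 volume ^ 2 ∂P

/-! ### Function spaces and their balls -/

/-- The intensities: nonnegative functions in `L¹ ∩ L²`. -/
def intensities : Set (ℝ → ℝ) :=
  {f | (∀ᵐ x, 0 ≤ f x) ∧ MemLp f 1 volume ∧ MemLp f 2 volume}

/-- The ball of radius `R` of `L¹`. -/
def ballL1 (R : ℝ) : Set (ℝ → ℝ) :=
  {f | MemLp f 1 volume ∧ eLpNorm f 1 volume ≤ ENNReal.ofReal R}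

/-- The ball of radius `R` of `L²`. -/
def ballL2 (R : ℝ) : Set (ℝ → ℝ) :=
  {f | MemLp f 2 volume ∧ eLpNorm f 2 volume ≤ ENNReal.ofReal R}

/-- The rate `ρ_{n,s} = (log n / n)^s`. -/
def rate (s : ℝ) (n : ℕ) : ℝ := (Real.log n / n) ^ s

/-- The ball of radius `R` of the maxiset of the thresholding procedure for the rate `ρ_s`. -/
def ballMS {Ω : (ℝ → ℝ) → ℕ → Type*} [∀ f n, MeasurableSpace (Ω f n)]
    (P : ∀ f n, Measure (Ω f n)) (N : ∀ f n, Ω f n → Set ℝ)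
    (Φ : Generators) (γ : ℝ) (j₀ : ℕ → ℤ) (s R : ℝ) : Set (ℝ → ℝ) :=
  {f | f ∈ intensities ∧ ∀ n : ℕ, 2 ≤ n →
    risk (P f n) (N f n) Φ γ n (j₀ n) f ≤ ENNReal.ofReal (R ^ 2 * rate s n ^ 2)}

/-- `σ_λ`, where `σ_λ² = ∫ φ_λ² f`. -/
def sigma (Φ : Generators) (f : ℝ → ℝ) (l : Idx) : ℝ :=
  Real.sqrt (∫ x, Φ.ana l x ^ 2 * f x)

open Classical in
/-- The ball of radius `R` of the weak Besov space `W_s`. -/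
def ballW (Φ : Generators) (s R : ℝ) : Set (ℝ → ℝ) :=
  {f | f ∈ intensities ∧ ∀ t : ℝ, 0 < t →
    ∑' l : Idx, (if |Φ.coeff f l| ≤ sigma Φ f l * t then ENNReal.ofReal (Φ.coeff f l ^ 2) else 0)
      ≤ ENNReal.ofReal (R ^ (2 - 4 * s) * t ^ (4 * s))}

/-- The ball of radius `R` of the space `B^s_{2,Γ}`, where `Γ_n` consists of the indices `(j, k)`
with `j ≤ j₀(n)`. -/
def ballB (Φ : Generators) (j₀ : ℕ → ℤ) (s R : ℝ) : Set (ℝ → ℝ) :=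
  {f | f ∈ intensities ∧ ∀ n : ℕ, 2 ≤ n →
    ∑' l : ((levels (j₀ n))ᶜ : Set Idx), ENNReal.ofReal (Φ.coeff f l ^ 2)
      ≤ ENNReal.ofReal (R ^ 2 * rate s n ^ 2)}

/-- The `m`-th order modulus of continuity of `f` in `L²`. -/
def modulus (m : ℕ) (f : ℝ → ℝ) (t : ℝ) : ℝ≥0∞ :=
  ⨆ (h : ℝ) (_ : |h| ≤ t), eLpNorm ((fwdDiff h)^[m] f) 2 volume

/-- The Besov space `B^α_{2,∞}(ℝ)`, `α > 0`, defined by the modulus of continuity. -/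
def besov (α : ℝ) : Set (ℝ → ℝ) :=
  {f | MemLp f 2 volume ∧
    (⨆ (t : ℝ) (_ : 0 < t), ENNReal.ofReal (t ^ (-α)) * modulus (⌊α⌋₊ + 1) f t) < ∞}

/-- The wavelet norm `‖(α_k)_k‖_{ℓ²} + sup_{j ≥ 0} 2^{jα} ‖(β_{j,k})_k‖_{ℓ²}`. -/
def besovNorm (Φ : Generators) (α : ℝ) (f : ℝ → ℝ) : ℝ≥0∞ :=
  (∑' k : ℤ, ENNReal.ofReal (Φ.coeff f ⟨(-1, k), le_refl _⟩ ^ 2)) ^ (1 / 2 : ℝ) +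
    ⨆ j : ℕ, ENNReal.ofReal ((2 : ℝ) ^ ((j : ℝ) * α)) *
      (∑' k : ℤ, ENNReal.ofReal (Φ.coeff f ⟨((j : ℤ), k), by simp only; omega⟩ ^ 2)) ^ (1 / 2 : ℝ)

/-- The ball of radius `R` of the Besov space `B^α_{2,∞}`, with the radius measured by the wavelet
norm. -/
def ballBesov (Φ : Generators) (α R : ℝ) : Set (ℝ → ℝ) :=
  {f | f ∈ intensities ∧ f ∈ besov α ∧ besovNorm Φ α f ≤ ENNReal.ofReal R}

/-- Equality of two spaces, given by their balls, up to radii and within balls of `L¹ ∩ L²`. -/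
def EqUpToRadii (M F : ℝ → Set (ℝ → ℝ)) : Prop :=
  (∀ R : ℝ, 0 < R → ∃ R' : ℝ, 0 < R' ∧
    M R ∩ ballL1 R ∩ ballL2 R ⊆ F R' ∩ ballL1 R ∩ ballL2 R) ∧
  (∀ R' : ℝ, 0 < R' → ∃ R : ℝ, 0 < R ∧
    F R' ∩ ballL1 R' ∩ ballL2 R' ⊆ M R ∩ ballL1 R' ∩ ballL2 R')

end PoissonMaxiset

end

/-! The problem decouples into single coefficients. An unconditional biorthogonal basis whose
reconstruction functions have norms between two positive bounds is a Riesz basis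
(`exists_riesz_bounds`, `IsAdmissible.exists_norm_equiv`). Up to constants, the L² risk is therefore
the sum over λ of the mean squared errors of the thresholded coefficients (`exists_risk_equiv`). The
analysis wavelets take finitely many values, so an integral against `N` is a finite combination of
independent Poisson counts. This gives the Laplace functional
(`IsPoissonProcess.lintegral_exp_sumOver`), and from it Bernstein's inequality and the tail bounds
for the empirical variances.

Maxiset into function spaces. Above the cutoff every coefficient is estimated by 0, so its error is
β² and the risk dominates the tail defining `ballB`. If |β| is at most half of σ√(2γ log n / n),
then with probability at least 1/2 the random threshold exceeds 2|β|; whether the coefficient is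
kept or killed, the error is then at least |β| (`sq_coeff_le_lintegral`). Given a small t, an n with
log n / n comparable to t² turns the risk bound into the weak Besov bound at t; for the other t the
L² norm suffices.

Function spaces into maxiset. Each coefficient satisfies an oracle inequality
(`exists_lintegral_coeffTilde_sub_sq_le`): its risk is at most a constant times min(β², σ² log n /
n), plus remainders carrying a factor n^(-γ') with c < γ' < γ. The proof distinguishes whether σ²/n
is large or small against ‖φ_λ‖∞² log n / n². In the first case concentration gives thresholding its
usual behaviour. In the second the expected number of points in the support of φ_λ is at most of
order log n, and keeping the coefficient requires atypically many points. The sum of the minima is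
controlled by `ballW` through a dyadic layering (`tsum_min_le`). The remainders are summable because
the variances up to level j₀ add up to O(2^j₀ ‖f‖₁), that is O(n^c (log n)^c' ‖f‖₁), which n^(-γ')
absorbs.

The case c' = -c. Here 2^j₀ is comparable to (n / log n)^c, so the rate at n is comparable to 2^(-j₀
s/c), and decay of the tails at rate ρ is the same as geometric decay of the level energies. Passing
from this decay to the modulus of continuity uses only that the reconstruction generators have L²
increments of order |u|^(1/2), which holds for smooth and Haar generators alike and suffices since
s/c < 1/2. -/

noncomputable section

namespace PoissonMaxiset

/-! ### Unconditional bases of Hilbert spaces are Riesz bases -/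

section RieszBasis

variable {H : Type*} [NormedAddCommGroup H] [InnerProductSpace ℝ H]

/-- By the parallelogram law the larger of ‖w + v‖² and ‖w - v‖² is at least ‖w‖² + ‖v‖², so the
signs can be chosen greedily, one vector at a time. -/
lemma exists_signs_le_norm_sum {ι : Type*} [DecidableEq ι] (v : ι → H) (S : Finset ι) :
    ∃ ε : ι → ℝ, (∀ i, ε i = 1 ∨ ε i = -1) ∧
      ∑ i ∈ S, ‖v i‖ ^ 2 ≤ ‖∑ i ∈ S, ε i • v i‖ ^ 2 := by
  induction S using Finset.induction_on with
  | empty => exact ⟨fun _ => 1, fun _ => Or.inl rfl, by simp⟩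
  | insert a S ha ih =>
    obtain ⟨ε, h1, h2⟩ := ih
    set w := ∑ i ∈ S, ε i • v i with hw
    have key : ∀ c : ℝ, ∑ i ∈ S, Function.update ε a c i • v i = w := fun c =>
      Finset.sum_congr rfl fun i hi => by
        rw [Function.update_of_ne (ne_of_mem_of_not_mem hi ha)]
    have hpar := parallelogram_law_with_norm ℝ w (v a)
    have hu : ∀ c : ℝ, (c = 1 ∨ c = -1) → ∀ i, Function.update ε a c i = 1 ∨
        Function.update ε a c i = -1 := fun c hc i => by
      by_cases h : i = a
      · subst h; simpa using hc
      · rw [Function.update_of_ne h]; exact h1 i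
    rcases le_total (‖w - v a‖) (‖w + v a‖) with h | h
    · refine ⟨Function.update ε a 1, hu 1 (Or.inl rfl), ?_⟩
      rw [Finset.sum_insert ha, Finset.sum_insert ha, key]
      simp only [Function.update_self, one_smul]
      rw [add_comm (v a) w]
      nlinarith [norm_nonneg (w - v a), norm_nonneg (w + v a)]
    · refine ⟨Function.update ε a (-1), hu (-1) (Or.inr rfl), ?_⟩
      rw [Finset.sum_insert ha, Finset.sum_insert ha, key]
      simp only [Function.update_self, neg_smul, one_smul]
      rw [neg_add_eq_sub]
      nlinarith [norm_nonneg (w - v a), norm_nonneg (w + v a)]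

/-- The same greedy choice, now taking the smaller of the two norms. -/
lemma exists_signs_norm_sum_le {ι : Type*} [DecidableEq ι] (v : ι → H) (S : Finset ι) :
    ∃ ε : ι → ℝ, (∀ i, ε i = 1 ∨ ε i = -1) ∧
      ‖∑ i ∈ S, ε i • v i‖ ^ 2 ≤ ∑ i ∈ S, ‖v i‖ ^ 2 := by
  induction S using Finset.induction_on with
  | empty => exact ⟨fun _ => 1, fun _ => Or.inl rfl, by simp⟩
  | insert a S ha ih =>
    obtain ⟨ε, h1, h2⟩ := ih
    set w := ∑ i ∈ S, ε i • v i with hw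
    have key : ∀ c : ℝ, ∑ i ∈ S, Function.update ε a c i • v i = w := fun c =>
      Finset.sum_congr rfl fun i hi => by
        rw [Function.update_of_ne (ne_of_mem_of_not_mem hi ha)]
    have hpar := parallelogram_law_with_norm ℝ w (v a)
    have hu : ∀ c : ℝ, (c = 1 ∨ c = -1) → ∀ i, Function.update ε a c i = 1 ∨
        Function.update ε a c i = -1 := fun c hc i => by
      by_cases h : i = a
      · subst h; simpa using hc
      · rw [Function.update_of_ne h]; exact h1 i
    rcases le_total (‖w - v a‖) (‖w + v a‖) with h | h
    · refine ⟨Function.update ε a (-1), hu (-1) (Or.inr rfl), ?_⟩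
      rw [Finset.sum_insert ha, Finset.sum_insert ha, key]
      simp only [Function.update_self, neg_smul, one_smul]
      rw [neg_add_eq_sub]
      nlinarith [norm_nonneg (w - v a), norm_nonneg (w + v a)]
    · refine ⟨Function.update ε a 1, hu 1 (Or.inl rfl), ?_⟩
      rw [Finset.sum_insert ha, Finset.sum_insert ha, key]
      simp only [Function.update_self, one_smul]
      rw [add_comm (v a) w]
      nlinarith [norm_nonneg (w - v a), norm_nonneg (w + v a)]

/-- The finite partial sums of a convergent unconditional series are bounded. -/
lemma exists_bound_of_summable {E : Type*} [NormedAddCommGroup E] {ι : Type*} {u : ι → E} (hu : Summable u) :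
    ∃ K : ℝ, ∀ S : Finset ι, ‖∑ i ∈ S, u i‖ ≤ K := by
  classical
  obtain ⟨S₀, hS₀⟩ := hu.vanishing (Metric.ball_mem_nhds (0 : E) one_pos)
  refine ⟨1 + ∑ i ∈ S₀, ‖u i‖, fun S => ?_⟩
  rw [← Finset.sum_inter_add_sum_sdiff S S₀, add_comm]
  refine (norm_add_le _ _).trans (add_le_add ?_ ?_)
  · have := hS₀ (S \ S₀) Finset.sdiff_disjoint
    rw [mem_ball_zero_iff] at this
    exact this.le
  · exact (norm_sum_le _ _).trans (Finset.sum_le_sum_of_subset_of_nonneg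
      Finset.inter_subset_right fun _ _ _ => norm_nonneg _)

/-- A biorthogonal unconditional basis whose members have comparable norms is a Riesz basis. -/
theorem exists_riesz_bounds [CompleteSpace H] {ι : Type*} [DecidableEq ι] {a s : ι → H}
    (hbi : ∀ i j, inner ℝ (a i) (s j) = if i = j then (1 : ℝ) else 0)
    (hexp : ∀ x : H, HasSum (fun i => inner ℝ (a i) x • s i) x)
    {m M : ℝ} (hm : 0 < m) (hsm : ∀ i, m ≤ ‖s i‖) (hsM : ∀ i, ‖s i‖ ≤ M) :
    ∃ C : ℝ, 0 < C ∧
      (∀ (x : H) (S : Finset ι), ∑ i ∈ S, (inner ℝ (a i) x : ℝ) ^ 2 ≤ C * ‖x‖ ^ 2) ∧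
      ∀ (c : ι → ℝ) (S : Finset ι), ‖∑ i ∈ S, c i • s i‖ ^ 2 ≤ C * ∑ i ∈ S, c i ^ 2 := by
  let T : Finset ι → H →L[ℝ] H := fun S =>
    ∑ i ∈ S, (innerSL ℝ (a i)).smulRight (s i)
  have hT : ∀ S x, T S x = ∑ i ∈ S, inner ℝ (a i) x • s i := fun S x => by
    simp [T]
  -- Unconditional convergence bounds the partial sums at each x; uniform boundedness makes the
  -- bound uniform in x.
  obtain ⟨K, hK⟩ : ∃ K, ∀ S, ‖T S‖ ≤ K := banach_steinhaus fun x => by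
    obtain ⟨K, hK⟩ := exists_bound_of_summable (hexp x).summable
    exact ⟨K, fun S => by rw [hT]; exact hK S⟩
  have hK0 : 0 ≤ K := (norm_nonneg _).trans (hK ∅)
  have hsign : ∀ (x : H) (S : Finset ι) (ε : ι → ℝ), (∀ i, ε i = 1 ∨ ε i = -1) →
      ‖∑ i ∈ S, ε i • (inner ℝ (a i) x • s i)‖ ≤ 2 * K * ‖x‖ := fun x S ε hε => by
    -- A signed partial sum is a difference of two partial sums over subsets, hence the factor 2.
    have : ∑ i ∈ S, ε i • (inner ℝ (a i) x • s i) =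
        T (S.filter fun i => ε i = 1) x - T (S.filter fun i => ¬ ε i = 1) x := by
      rw [hT, hT, ← Finset.sum_filter_add_sum_filter_not S (fun i => ε i = 1), sub_eq_add_neg,
        ← Finset.sum_neg_distrib]
      congr 1
      · refine Finset.sum_congr rfl fun i hi => ?_
        rw [(Finset.mem_filter.1 hi).2, one_smul]
      · refine Finset.sum_congr rfl fun i hi => ?_
        rw [(hε i).resolve_left (Finset.mem_filter.1 hi).2, neg_smul, one_smul]
    rw [this]
    have h := fun S' => (T S').le_of_opNorm_le (hK S') x
    calc _ ≤ _ := norm_sub_le _ _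
      _ ≤ K * ‖x‖ + K * ‖x‖ := add_le_add (h _) (h _)
      _ = _ := by ring
  refine ⟨(2 * K) ^ 2 / m ^ 2 + (2 * K) ^ 2 * M ^ 2 + 1, by positivity, fun x S => ?_,
    fun c S => ?_⟩
  · obtain ⟨ε, hε, h⟩ := exists_signs_le_norm_sum (fun i => inner ℝ (a i) x • s i) S
    have h1 : m ^ 2 * ∑ i ∈ S, (inner ℝ (a i) x : ℝ) ^ 2 ≤ (2 * K * ‖x‖) ^ 2 := by
      rw [Finset.mul_sum]
      calc _ ≤ ∑ i ∈ S, ‖(inner ℝ (a i) x : ℝ) • s i‖ ^ 2 := by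
            refine Finset.sum_le_sum fun i _ => ?_
            rw [norm_smul, mul_pow, Real.norm_eq_abs, sq_abs, mul_comm]
            gcongr
            exact hsm i
        _ ≤ _ := h
        _ ≤ _ := by gcongr; exact hsign x S ε hε
    have h2 : ∑ i ∈ S, (inner ℝ (a i) x : ℝ) ^ 2 ≤ (2 * K) ^ 2 / m ^ 2 * ‖x‖ ^ 2 := by
      rw [div_mul_eq_mul_div, le_div_iff₀ (by positivity)]
      linarith
    refine h2.trans ?_
    gcongr
    nlinarith [sq_nonneg (2 * K * M)]
  · obtain ⟨ε, hε, h⟩ := exists_signs_norm_sum_le (fun i => c i • s i) S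
    -- The signs make `y` short. By biorthogonality its coefficients are ε c, so applying the signs
    -- once more recovers ∑ c s as a signed expansion of `y`, of norm at most 2K‖y‖.
    set y := ∑ i ∈ S, ε i • c i • s i
    have hε2 : ∀ i, ε i * ε i = 1 := fun i => by rcases hε i with h | h <;> rw [h] <;> norm_num
    have hco : ∀ i ∈ S, inner ℝ (a i) y = ε i * c i := fun i hi => by
      simp only [y, inner_sum, inner_smul_right, hbi]
      simp [hi]
    have h3 := hsign y S ε hε
    have h4 : ∑ i ∈ S, ε i • (inner ℝ (a i) y • s i) = ∑ i ∈ S, c i • s i :=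
      Finset.sum_congr rfl fun i hi => by
        rw [hco i hi, smul_smul, ← mul_assoc, hε2, one_mul]
    rw [h4] at h3
    have h5 : ∑ i ∈ S, ‖c i • s i‖ ^ 2 ≤ M ^ 2 * ∑ i ∈ S, c i ^ 2 := by
      rw [Finset.mul_sum]
      refine Finset.sum_le_sum fun i _ => ?_
      rw [norm_smul, mul_pow, Real.norm_eq_abs, sq_abs, mul_comm]
      gcongr
      exact hsM i
    have h6 : (0 : ℝ) ≤ ∑ i ∈ S, c i ^ 2 := Finset.sum_nonneg fun i _ => sq_nonneg _
    calc _ ≤ (2 * K * ‖y‖) ^ 2 := by gcongr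
      _ = (2 * K) ^ 2 * ‖y‖ ^ 2 := by ring
      _ ≤ (2 * K) ^ 2 * (M ^ 2 * ∑ i ∈ S, c i ^ 2) := by gcongr; exact h.trans h5
      _ = (2 * K) ^ 2 * M ^ 2 * ∑ i ∈ S, c i ^ 2 := by ring
      _ ≤ _ := by
        gcongr
        have : 0 ≤ (2 * K) ^ 2 / m ^ 2 := by positivity
        linarith

end RieszBasis

/-! ### Exponential moments of integrals against a Poisson process -/

section Poisson

lemma lintegral_poissonMeasure (r : ℝ≥0) (F : ℕ → ℝ≥0∞) :
    ∫⁻ k, F k ∂poissonMeasure r =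
      ∑' k, ENNReal.ofReal (Real.exp (-r) * r ^ k / k.factorial) * F k := by
  rw [poissonMeasure, lintegral_sum_measure]
  simp [lintegral_smul_measure]

lemma lintegral_exp_mul_poissonMeasure (r : ℝ≥0) (a : ℝ) :
    ∫⁻ k, ENNReal.ofReal (Real.exp (a * (k : ℕ))) ∂poissonMeasure r =
      ENNReal.ofReal (Real.exp (r * (Real.exp a - 1))) := by
  rw [lintegral_poissonMeasure]
  have h := (NormedSpace.expSeries_div_hasSum_exp ((r : ℝ) * Real.exp a)).mul_left
    (Real.exp (-r))
  rw [← Real.exp_eq_exp_ℝ, ← Real.exp_add] at h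
  have e : ∀ k : ℕ, ENNReal.ofReal (Real.exp (-r) * r ^ k / k.factorial) *
      ENNReal.ofReal (Real.exp (a * k)) =
      ENNReal.ofReal (Real.exp (-r) * ((r * Real.exp a) ^ k / k.factorial)) := fun k => by
    rw [← ENNReal.ofReal_mul (by positivity), mul_comm a, Real.exp_nat_mul]
    congr 1; ring
  simp_rw [e]
  rw [← ENNReal.ofReal_tsum_of_nonneg (fun k => by positivity) h.summable, h.tsum_eq]
  congr 2; ring

variable {Ω : Type*} [MeasurableSpace Ω] {P : Measure Ω} {N : Ω → Set ℝ} {ν : Measure ℝ}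

/-- The number of points of `N` in `A`. -/
def count (N : Ω → Set ℝ) (A : Set ℝ) (ω : Ω) : ℕ := (N ω ∩ A).encard.toNat

namespace IsPoissonProcess

variable (h : IsPoissonProcess P N ν)
include h

lemma measurable_count' {A : Set ℝ} (hA : MeasurableSet A) : Measurable (count N A) :=
  (Measurable.of_discrete (f := ENat.toNat)).comp (h.measurable_count A hA)

lemma lintegral_count {A : Set ℝ} (hA : MeasurableSet A) (hν : ν A ≠ ∞) (F : ℕ∞ → ℝ≥0∞) :
    ∫⁻ ω, F (N ω ∩ A).encard ∂P = ∫⁻ k : ℕ, F k ∂poissonMeasure (ν A).toNNReal := by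
  have h1 := lintegral_map (μ := P) (f := F) Measurable.of_discrete (h.measurable_count A hA)
  rw [← h1, h.law_count A hA hν, lintegral_map Measurable.of_discrete Measurable.of_discrete]

lemma ae_finite_inter {A : Set ℝ} (hA : MeasurableSet A) (hν : ν A ≠ ∞) :
    ∀ᵐ ω ∂P, (N ω ∩ A).Finite := by
  classical
  have h1 := h.lintegral_count hA hν (fun x => if x = ⊤ then 1 else 0)
  simp only [ENat.natCast_ne_top, if_false, lintegral_zero] at h1
  replace h1 := (lintegral_eq_zero_iff (Measurable.of_discrete.comp (h.measurable_count A hA) :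
    Measurable ((fun x : ℕ∞ => if x = ⊤ then (1 : ℝ≥0∞) else 0) ∘ _))).1 h1
  filter_upwards [h1] with ω hω
  rw [← Set.encard_ne_top_iff]
  intro hc
  simp [hc] at hω

lemma ae_finite (hν : ν Set.univ ≠ ∞) : ∀ᵐ ω ∂P, (N ω).Finite := by
  simpa using h.ae_finite_inter MeasurableSet.univ hν

lemma ae_inter_eq_empty {A : Set ℝ} (hA : MeasurableSet A) (hν : ν A = 0) :
    ∀ᵐ ω ∂P, N ω ∩ A = ∅ := by
  classical
  have h1 := h.lintegral_count hA (by simp [hν]) (fun x => if x = 0 then 0 else 1)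
  rw [hν, lintegral_poissonMeasure, ENNReal.tsum_eq_zero.2 ?_] at h1
  · replace h1 := (lintegral_eq_zero_iff (Measurable.of_discrete.comp (h.measurable_count A hA) :
      Measurable ((fun x : ℕ∞ => if x = 0 then (0 : ℝ≥0∞) else 1) ∘ _))).1 h1
    filter_upwards [h1] with ω hω
    by_contra hc
    have : (N ω ∩ A).encard ≠ 0 := by simpa [Set.encard_eq_zero] using hc
    simp [this] at hω
  · intro k
    rcases Nat.eq_zero_or_pos k with rfl | hk
    · simp
    · simp [hk.ne']

/-- A null set almost surely contains no point of the process. This lets an essential supremum bound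
be used at every observed point. -/
lemma ae_forall_mem {p : ℝ → Prop} (hp : MeasurableSet {x | p x}) (hν : ∀ᵐ x ∂ν, p x) :
    ∀ᵐ ω ∂P, ∀ x ∈ N ω, p x := by
  filter_upwards [h.ae_inter_eq_empty hp.compl hν] with ω hω x hx
  by_contra hc
  exact (hω ▸ (⟨hx, hc⟩ : x ∈ N ω ∩ {x | p x}ᶜ) : x ∈ (∅ : Set ℝ))

lemma lintegral_exp_mul_count {A : Set ℝ} (hA : MeasurableSet A) (hν : ν A ≠ ∞) (a : ℝ) :
    ∫⁻ ω, ENNReal.ofReal (Real.exp (a * count N A ω)) ∂P =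
      ENNReal.ofReal (Real.exp ((Real.exp a - 1) * ν.real A)) := by
  have := h.lintegral_count hA hν (fun x => ENNReal.ofReal (Real.exp (a * (x.toNat : ℕ))))
  simp only [ENat.toNat_natCast] at this
  rw [lintegral_exp_mul_poissonMeasure] at this
  simp only [count]
  rw [this, mul_comm, measureReal_def]
  rfl

end IsPoissonProcess

lemma sumOver_eq_finset_sum {N : Set ℝ} (hN : N.Finite) (g : ℝ → ℝ) :
    sumOver N g = ∑ x ∈ hN.toFinset, g x := by
  rw [sumOver, ← Finset.tsum_subtype hN.toFinset g]
  have : (N : Set ℝ) = (hN.toFinset : Set ℝ) := by simp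
  conv_lhs => rw [this]
  rfl

/-- For a function with finite range, `∫ g dN` is a combination of counts. -/
lemma sumOver_eq_sum_count {N : Set ℝ} (hN : N.Finite) {g : ℝ → ℝ} {R : Finset ℝ}
    (hR : ∀ x, g x ∈ R) :
    sumOver N g = ∑ v ∈ R, v * ((N ∩ g ⁻¹' {v}).encard.toNat : ℝ) := by
  classical
  rw [sumOver_eq_finset_sum hN, ← Finset.sum_fiberwise_of_maps_to (t := R) (g := g) (fun x _ => hR x)]
  refine Finset.sum_congr rfl fun v _ => ?_
  rw [Finset.sum_congr rfl (g := fun _ => v) (fun x hx => (Finset.mem_filter.1 hx).2)]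
  rw [Finset.sum_const, nsmul_eq_mul, mul_comm]
  congr 2
  have : N ∩ g ⁻¹' {v} = ((hN.toFinset.filter fun x => g x = v : Finset ℝ) : Set ℝ) := by
    ext x; simp
  rw [this, Set.encard_coe_eq_coe_finsetCard, ENat.toNat_natCast]

namespace IsPoissonProcess
variable (h : IsPoissonProcess P N ν)
include h

lemma aemeasurable_sumOver (hν : ν Set.univ ≠ ∞) {g : ℝ → ℝ} (hg : Measurable g)
    (hfin : (Set.range g).Finite) : AEMeasurable (fun ω => sumOver (N ω) g) P := by
  refine ⟨fun ω => ∑ v ∈ hfin.toFinset, v * (count N (g ⁻¹' {v}) ω : ℝ), ?_, ?_⟩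
  · refine Finset.measurable_sum _ fun v _ => Measurable.const_mul ?_ _
    exact (Measurable.of_discrete (f := fun k : ℕ => (k : ℝ))).comp
      (h.measurable_count' (hg (measurableSet_singleton v)))
  · filter_upwards [h.ae_finite hν] with ω hω
    exact sumOver_eq_sum_count hω (fun x => by simp)

/-- The Laplace functional of a Poisson process. -/
theorem lintegral_exp_sumOver [IsFiniteMeasure ν] {g : ℝ → ℝ} (hg : Measurable g)
    (hfin : (Set.range g).Finite) :
    ∫⁻ ω, ENNReal.ofReal (Real.exp (sumOver (N ω) g)) ∂P =
      ENNReal.ofReal (Real.exp (∫ x, (Real.exp (g x) - 1) ∂ν)) := by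
  classical
  set R := hfin.toFinset with hR
  have hν : ν Set.univ ≠ ∞ := measure_ne_top _ _
  let e := R.equivFin
  -- The level sets of `g` are disjoint, so their counts are independent and the exponential of the
  -- integral is a product of independent factors.
  have hind := h.indep_count R.card (fun i => g ⁻¹' {((e.symm i : R) : ℝ)})
    (fun i => hg (measurableSet_singleton _)) (by
      intro i j hij
      refine Disjoint.preimage _ (Set.disjoint_singleton.2 ?_)
      exact fun hc => hij (e.symm.injective (Subtype.ext hc)))
  have hind2 := hind.comp (fun i (k : ℕ∞) =>
    ENNReal.ofReal (Real.exp (((e.symm i : R) : ℝ) * (k.toNat : ℝ))))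
    (fun i => Measurable.of_discrete)
  have hprod := lintegral_prod_eq_prod_lintegral_of_indepFun Finset.univ _ hind2
    (fun i => Measurable.of_discrete.comp (h.measurable_count _ (hg (measurableSet_singleton _))))
  have hint : ∫ x, (Real.exp (g x) - 1) ∂ν =
      ∑ v ∈ R, (Real.exp v - 1) * ν.real (g ⁻¹' {v}) := by
    let G : SimpleFunc ℝ ℝ := ⟨g, fun x => hg (measurableSet_singleton x), hfin⟩
    have hGi : Integrable G ν := SimpleFunc.integrable_of_isFiniteMeasure G
    have := SimpleFunc.map_integral G (fun y => Real.exp y - 1) hGi (by simp)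
    rw [SimpleFunc.integral_eq_integral _
      (SimpleFunc.integrable_of_isFiniteMeasure _)] at this
    refine this.trans ?_
    refine Finset.sum_congr rfl fun v _ => ?_
    rw [smul_eq_mul, mul_comm]; rfl
  have hL : ∫⁻ ω, ENNReal.ofReal (Real.exp (sumOver (N ω) g)) ∂P =
      ∫⁻ ω, ∏ i : Fin R.card, ENNReal.ofReal (Real.exp (((e.symm i : R) : ℝ) *
        ((N ω ∩ g ⁻¹' {((e.symm i : R) : ℝ)}).encard.toNat : ℝ))) ∂P := by
    refine lintegral_congr_ae ?_
    filter_upwards [h.ae_finite hν] with ω hω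
    rw [sumOver_eq_sum_count hω (R := R) (fun x => by simp [hR]), Real.exp_sum,
      ENNReal.ofReal_prod_of_nonneg (fun _ _ => (Real.exp_pos _).le), ← Finset.prod_coe_sort,
      ← Equiv.prod_comp e.symm]
  rw [hL]
  refine hprod.trans ?_
  rw [hint, Real.exp_sum, ENNReal.ofReal_prod_of_nonneg (fun _ _ => (Real.exp_pos _).le),
    ← Finset.prod_coe_sort R (fun v => ENNReal.ofReal (Real.exp ((Real.exp v - 1) *
      ν.real (g ⁻¹' {v})))), ← Equiv.prod_comp e.symm]
  refine Finset.prod_congr rfl fun i _ => ?_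
  exact h.lintegral_exp_mul_count (hg (measurableSet_singleton _)) (measure_ne_top _ _) _

end IsPoissonProcess

end Poisson

/-! ### Deviation inequalities for integrals against a Poisson process -/

section Deviation

/-- Compare the exponential series with a geometric one, using (k + 2)! ≥ 2 · 3^k. This is the
source of the 1/3 in Bernstein's inequality. -/
lemma exp_sub_one_sub_le {y b : ℝ} (hb : b < 3) (hy : |y| ≤ b) :
    Real.exp y - 1 - y ≤ y ^ 2 / (2 * (1 - b / 3)) := by
  have hb0 : 0 ≤ b := (abs_nonneg y).trans hy
  have hs := NormedSpace.expSeries_div_hasSum_exp y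
  rw [← Real.exp_eq_exp_ℝ] at hs
  have h2 := (hasSum_nat_add_iff' 2).2 hs
  have hg := (hasSum_geometric_of_lt_one (r := b / 3) (by positivity) (by linarith)).mul_left
    (y ^ 2 / 2)
  have hle := hasSum_le (fun k => ?_) h2 hg
  · simp [Finset.sum_range_succ] at hle
    have e : y ^ 2 / (2 * (1 - b / 3)) = y ^ 2 / 2 * (1 - b / 3)⁻¹ := by
      rw [div_mul_eq_div_div, div_eq_mul_inv (y ^ 2 / 2)]
    linarith
  · have hf : (2 : ℝ) * 3 ^ k ≤ (k + 2).factorial := by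
      have := Nat.factorial_mul_pow_le_factorial (m := 2) (n := k)
      rw [add_comm 2 k] at this
      exact_mod_cast this
    calc y ^ (k + 2) / ((k + 2).factorial : ℝ) ≤ |y| ^ (k + 2) / ((k + 2).factorial : ℝ) := by
          refine div_le_div_of_nonneg_right ?_ (by positivity)
          rw [← abs_pow]; exact le_abs_self _
      _ ≤ |y| ^ (k + 2) / (2 * 3 ^ k) := by gcongr
      _ = y ^ 2 / 2 * (|y| / 3) ^ k := by
          rw [pow_add, sq_abs, div_pow]; field_simp
      _ ≤ y ^ 2 / 2 * (b / 3) ^ k := by gcongr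

lemma sumOver_const_mul (N : Set ℝ) (s : ℝ) (g : ℝ → ℝ) :
    sumOver N (fun x => s * g x) = s * sumOver N g := tsum_mul_left

variable {Ω : Type*} [MeasurableSpace Ω] {P : Measure Ω} {N : Ω → Set ℝ} {ν : Measure ℝ}

/-- Chernoff's bound. -/
lemma measure_ge_le_of_lintegral_exp_le {X : Ω → ℝ} (hX : AEMeasurable X P) {A B : ℝ}
    (hE : ∫⁻ ω, ENNReal.ofReal (Real.exp (X ω)) ∂P ≤ ENNReal.ofReal (Real.exp A)) :
    P {ω | B ≤ X ω} ≤ ENNReal.ofReal (Real.exp (A - B)) := by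
  have h1 := meas_ge_le_lintegral_div (μ := P) (f := fun ω => ENNReal.ofReal (Real.exp (X ω)))
    (Real.measurable_exp.comp_aemeasurable hX).ennreal_ofReal
    (ε := ENNReal.ofReal (Real.exp B)) (by simp [Real.exp_pos]) (by simp)
  have h2 : {ω | B ≤ X ω} ⊆
      {ω | ENNReal.ofReal (Real.exp B) ≤ ENNReal.ofReal (Real.exp (X ω))} := fun ω hω =>
    ENNReal.ofReal_le_ofReal (Real.exp_le_exp.2 hω)
  refine (measure_mono h2).trans (h1.trans ?_)
  rw [Real.exp_sub, ENNReal.ofReal_div_of_pos (Real.exp_pos _)]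
  gcongr

lemma integrable_of_finite_range [IsFiniteMeasure ν] {g : ℝ → ℝ} (hg : Measurable g)
    (hfin : (Set.range g).Finite) : Integrable g ν :=
  SimpleFunc.integrable_of_isFiniteMeasure
    (⟨g, fun _ => hg (measurableSet_singleton _), hfin⟩ : SimpleFunc ℝ ℝ)

lemma finite_range_comp {g : ℝ → ℝ} (hfin : (Set.range g).Finite) (F : ℝ → ℝ) :
    (Set.range fun x => F (g x)).Finite := by
  have : (Set.range fun x => F (g x)) = F '' Set.range g := by
    rw [← Set.range_comp]; rfl
  rw [this]; exact hfin.image _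

namespace IsPoissonProcess

variable (h : IsPoissonProcess P N ν) [IsFiniteMeasure ν]
include h

/-- Common input for all the tail bounds: a pointwise majorant of exp(F) - 1 gives, through the
Laplace functional, an exponential moment. -/
lemma lintegral_exp_sumOver_comp_le {g : ℝ → ℝ} (hg : Measurable g)
    (hfin : (Set.range g).Finite) {F G : ℝ → ℝ} (hF : Measurable F) (hG : Measurable G)
    (hFG : ∀ᵐ x ∂ν, Real.exp (F (g x)) - 1 ≤ G (g x)) {A : ℝ} (hA : ∫ x, G (g x) ∂ν ≤ A) :
    ∫⁻ ω, ENNReal.ofReal (Real.exp (sumOver (N ω) fun x => F (g x))) ∂P ≤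
      ENNReal.ofReal (Real.exp A) := by
  rw [h.lintegral_exp_sumOver (g := fun x => F (g x)) (hF.comp hg) (finite_range_comp hfin F)]
  refine ENNReal.ofReal_le_ofReal (Real.exp_le_exp.2 (le_trans ?_ hA))
  refine integral_mono_ae ?_ ?_ hFG
  · exact integrable_of_finite_range (((Real.measurable_exp.comp hF).sub_const 1).comp hg)
      (finite_range_comp hfin fun y => Real.exp (F y) - 1)
  · exact integrable_of_finite_range (hG.comp hg) (finite_range_comp hfin G)

variable {g : ℝ → ℝ} (hg : Measurable g) (hfin : (Set.range g).Finite)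
  {M : ℝ} (hM : ∀ᵐ x ∂ν, |g x| ≤ M)
include hg hfin hM

lemma lintegral_exp_mul_sumOver_le {s : ℝ} (hs : |s| * M < 3) :
    ∫⁻ ω, ENNReal.ofReal (Real.exp (s * sumOver (N ω) g)) ∂P ≤
      ENNReal.ofReal (Real.exp (s * ∫ x, g x ∂ν +
        s ^ 2 * (∫ x, g x ^ 2 ∂ν) / (2 * (1 - |s| * M / 3)))) := by
  simp_rw [← sumOver_const_mul]
  refine h.lintegral_exp_sumOver_comp_le hg hfin (F := fun y => s * y)
    (G := fun y => s * y + s ^ 2 / (2 * (1 - |s| * M / 3)) * y ^ 2) (by fun_prop) (by fun_prop)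
    ?_ ?_
  · filter_upwards [hM] with x hx
    have := exp_sub_one_sub_le (y := s * g x) hs (by rw [abs_mul]; gcongr)
    have e : (s * g x) ^ 2 / (2 * (1 - |s| * M / 3)) =
      s ^ 2 / (2 * (1 - |s| * M / 3)) * g x ^ 2 := by ring
    linarith
  · rw [integral_add, integral_const_mul, integral_const_mul]
    · exact le_of_eq (by ring)
    · exact (integrable_of_finite_range hg hfin).const_mul _
    · exact (integrable_of_finite_range (hg.pow_const 2)
        (finite_range_comp hfin fun y => y ^ 2)).const_mul _

omit hM in
lemma aemeasurable_sumOver' : AEMeasurable (fun ω => sumOver (N ω) g) P :=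
  h.aemeasurable_sumOver (measure_ne_top _ _) hg hfin

/-- Bernstein's inequality, upper tail. -/
lemma measure_sumOver_sub_ge_le (hM0 : 0 < M) {u : ℝ} (hu : 0 ≤ u)
    (hv : 0 < ∫ x, g x ^ 2 ∂ν) :
    P {ω | Real.sqrt (2 * u * ∫ x, g x ^ 2 ∂ν) + u * M / 3 ≤ sumOver (N ω) g - ∫ x, g x ∂ν} ≤
      ENNReal.ofReal (Real.exp (-u)) := by
  set v := ∫ x, g x ^ 2 ∂ν
  set m := ∫ x, g x ∂ν
  rcases hu.eq_or_lt with rfl | hu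
  · have := h.isProbabilityMeasure
    simpa using prob_le_one
  set w := Real.sqrt (2 * u / v) with hw
  have hw0 : 0 < w := Real.sqrt_pos.2 (by positivity)
  have hw2 : w ^ 2 * v = 2 * u := by
    rw [hw, Real.sq_sqrt (by positivity)]; field_simp
  have hvw : Real.sqrt (2 * u * v) = v * w := by
    rw [show 2 * u * v = (v * w) ^ 2 by rw [← hw2]; ring, Real.sqrt_sq (by positivity)]
  -- With this parameter 1 - sM/3 = 1/(1 + Mw/3), and Chernoff's exponent at the stated deviation is
  -- exactly -u.
  set s := w / (1 + M / 3 * w) with hs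
  have hD : 0 < 1 + M / 3 * w := by positivity
  have hs0 : 0 < s := by positivity
  have hsM : |s| * M / 3 = 1 - 1 / (1 + M / 3 * w) := by
    rw [abs_of_pos hs0, hs]; field_simp; ring
  have h3 : |s| * M < 3 := by
    have : 0 < 1 / (1 + M / 3 * w) := by positivity
    linarith
  have hE := h.lintegral_exp_mul_sumOver_le hg hfin hM h3
  have hX : AEMeasurable (fun ω => s * sumOver (N ω) g) P :=
    (h.aemeasurable_sumOver' hg hfin).const_mul s
  have hC := measure_ge_le_of_lintegral_exp_le hX hE
    (B := s * (m + (Real.sqrt (2 * u * v) + u * M / 3)))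
  refine (measure_mono fun ω hω => ?_).trans (hC.trans (le_of_eq ?_))
  · simp only [Set.mem_ofPred_eq] at hω ⊢
    gcongr
    linarith
  · congr 2
    rw [hsM, hvw, hs]
    field_simp
    have : u = w ^ 2 * v / 2 := by linarith
    rw [this]; ring

/-- Bernstein's inequality. -/
lemma measure_abs_sumOver_sub_ge_le (hM0 : 0 < M) {u : ℝ} (hu : 0 ≤ u)
    (hv : 0 < ∫ x, g x ^ 2 ∂ν) :
    P {ω | Real.sqrt (2 * u * ∫ x, g x ^ 2 ∂ν) + u * M / 3 ≤ |sumOver (N ω) g - ∫ x, g x ∂ν|} ≤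
      2 * ENNReal.ofReal (Real.exp (-u)) := by
  have h1 := h.measure_sumOver_sub_ge_le hg hfin hM hM0 hu hv
  have h2 := h.measure_sumOver_sub_ge_le hg.neg (finite_range_comp hfin fun y => -y)
    (M := M) (by simpa using hM) hM0 hu (by simpa using hv)
  simp only [Pi.neg_apply, neg_sq] at h2
  rw [two_mul (ENNReal.ofReal _)]
  refine le_trans (measure_mono ?_) ((measure_union_le _ _).trans (add_le_add h1 h2))
  intro ω hω
  simp only [Set.mem_ofPred_eq, Set.mem_union] at hω ⊢
  rcases le_abs.1 hω with hh | hh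
  · exact Or.inl hh
  · right
    have e : sumOver (N ω) (fun x => -g x) = - sumOver (N ω) g := by
      simpa using sumOver_const_mul (N ω) (-1) g
    have e2 : sumOver (N ω) (-g) = - sumOver (N ω) g := e
    rw [e2, integral_neg]
    linarith

/-- Bound exp(s|X|) by exp(sX) + exp(-sX). The result serves to control second moments on unlikely
events. -/
lemma lintegral_exp_mul_abs_le {s : ℝ} (hs0 : 0 ≤ s) (hs : s * M < 3) :
    ∫⁻ ω, ENNReal.ofReal (Real.exp (s * |sumOver (N ω) g - ∫ x, g x ∂ν|)) ∂P ≤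
      2 * ENNReal.ofReal (Real.exp (s ^ 2 * (∫ x, g x ^ 2 ∂ν) / (2 * (1 - s * M / 3)))) := by
  set m := ∫ x, g x ∂ν
  have key : ∀ t : ℝ, |t| = s →
      ∫⁻ ω, ENNReal.ofReal (Real.exp (t * (sumOver (N ω) g - m))) ∂P ≤
      ENNReal.ofReal (Real.exp (s ^ 2 * (∫ x, g x ^ 2 ∂ν) / (2 * (1 - s * M / 3)))) := by
    intro t ht
    have h1 := h.lintegral_exp_mul_sumOver_le hg hfin hM (s := t) (by rwa [ht])
    have e : ∀ ω, ENNReal.ofReal (Real.exp (t * (sumOver (N ω) g - m))) =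
        ENNReal.ofReal (Real.exp (-(t * m))) *
          ENNReal.ofReal (Real.exp (t * sumOver (N ω) g)) := fun ω => by
      rw [← ENNReal.ofReal_mul (Real.exp_pos _).le, ← Real.exp_add]; congr 2; ring
    simp_rw [e]
    rw [lintegral_const_mul' _ _ ENNReal.ofReal_ne_top]
    refine (mul_le_mul_right h1 _).trans (le_of_eq ?_)
    rw [← ENNReal.ofReal_mul (Real.exp_pos _).le, ← Real.exp_add, ht, ← sq_abs t, ht]
    congr 2; ring
  have hm : AEMeasurable (fun ω => ENNReal.ofReal (Real.exp (s * (sumOver (N ω) g - m)))) P :=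
    (Real.measurable_exp.comp_aemeasurable
      (((h.aemeasurable_sumOver' hg hfin).sub_const m).const_mul s)).ennreal_ofReal
  calc _ ≤ ∫⁻ ω, (ENNReal.ofReal (Real.exp (s * (sumOver (N ω) g - m))) +
        ENNReal.ofReal (Real.exp (-s * (sumOver (N ω) g - m)))) ∂P := by
        refine lintegral_mono fun ω => ?_
        rcases abs_choice (sumOver (N ω) g - m) with hh | hh
        · rw [hh]; exact le_self_add
        · rw [hh, mul_neg, ← neg_mul]; exact le_add_self
    _ = _ := lintegral_add_left' hm _
    _ ≤ _ := by
      rw [two_mul]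
      exact add_le_add (key s (abs_of_nonneg hs0)) (key (-s) (by rw [abs_neg, abs_of_nonneg hs0]))

/-- Lower tail of the integral of a square. -/
lemma measure_sumOver_sq_le_le (hM0 : 0 < M) {u : ℝ} (hu : 0 ≤ u)
    (hv : 0 < ∫ x, g x ^ 2 ∂ν) :
    P {ω | sumOver (N ω) (fun x => g x ^ 2) ≤
        (∫ x, g x ^ 2 ∂ν) - Real.sqrt (2 * u * M ^ 2 * ∫ x, g x ^ 2 ∂ν)} ≤
      ENNReal.ofReal (Real.exp (-u)) := by
  set v := ∫ x, g x ^ 2 ∂ν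
  -- Makes the quadratic term s²M²v/2 equal to u and the deviation equal to sM²v, so that Chernoff's
  -- exponent is u - 2u = -u.
  set s := Real.sqrt (2 * u / (M ^ 2 * v)) with hs
  have hs0 : 0 ≤ s := Real.sqrt_nonneg _
  have hs2 : s ^ 2 * (M ^ 2 * v) = 2 * u := by
    rw [hs, Real.sq_sqrt (by positivity)]; field_simp
  have hx : Real.sqrt (2 * u * M ^ 2 * v) = s * (M ^ 2 * v) := by
    rw [show 2 * u * M ^ 2 * v = (s * (M ^ 2 * v)) ^ 2 by
      rw [mul_pow, sq (M ^ 2 * v), ← mul_assoc, hs2]; ring, Real.sqrt_sq (by positivity)]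
  have hE : ∫⁻ ω, ENNReal.ofReal (Real.exp (-s * sumOver (N ω) fun x => g x ^ 2)) ∂P ≤
      ENNReal.ofReal (Real.exp (-s * v + u)) := by
    simp_rw [← sumOver_const_mul]
    refine h.lintegral_exp_sumOver_comp_le hg hfin (F := fun y => -s * y ^ 2)
      (G := fun y => (-s + s ^ 2 * M ^ 2 / 2) * y ^ 2) (by fun_prop) (by fun_prop) ?_ ?_
    · filter_upwards [hM] with x hx
      have hx2 : g x ^ 2 ≤ M ^ 2 := sq_le_sq' (abs_le.1 hx).1 (abs_le.1 hx).2
      -- For y ≥ 0, (1 - y + y²/2)(1 + y + y²/2) = 1 + y⁴/4 ≥ 1, and the second factor is at most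
      -- exp(y).
      have hq : Real.exp (-(s * g x ^ 2)) ≤ 1 - s * g x ^ 2 + (s * g x ^ 2) ^ 2 / 2 := by
        have := Real.quadratic_le_exp_of_nonneg (x := s * g x ^ 2) (by positivity)
        set y := s * g x ^ 2
        have hy : 0 ≤ y := by positivity
        rw [Real.exp_neg, inv_le_comm₀ (Real.exp_pos _) (by nlinarith [sq_nonneg (y - 1)])]
        refine le_trans ?_ this
        rw [inv_le_iff_one_le_mul₀ (by nlinarith [sq_nonneg (y - 1)])]
        nlinarith [sq_nonneg (y ^ 2)]
      have h4 : (s * g x ^ 2) ^ 2 ≤ s ^ 2 * M ^ 2 * g x ^ 2 := by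
        rw [mul_pow, mul_assoc, sq (g x ^ 2)]
        gcongr
      rw [neg_mul]
      linarith
    · rw [integral_const_mul]
      refine le_of_eq ?_
      change (-s + s ^ 2 * M ^ 2 / 2) * v = _
      linarith
  have hX : AEMeasurable (fun ω => -s * sumOver (N ω) fun x => g x ^ 2) P :=
    (h.aemeasurable_sumOver' (hg.pow_const 2) (finite_range_comp hfin fun y => y ^ 2)).const_mul _
  have hC := measure_ge_le_of_lintegral_exp_le hX hE
    (B := -s * (v - Real.sqrt (2 * u * M ^ 2 * v)))
  refine (measure_mono fun ω hω => ?_).trans (hC.trans (le_of_eq ?_))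
  · simp only [Set.mem_ofPred_eq] at hω ⊢
    nlinarith
  · congr 2
    rw [hx]; linarith

/-- Upper tail of the integral of a square. -/
lemma measure_sumOver_sq_ge_le (hM0 : 0 < M) {u : ℝ} :
    P {ω | 2 * (∫ x, g x ^ 2 ∂ν) + u * M ^ 2 ≤ sumOver (N ω) (fun x => g x ^ 2)} ≤
      ENNReal.ofReal (Real.exp (-u)) := by
  set v := ∫ x, g x ^ 2 ∂ν
  have hE : ∫⁻ ω, ENNReal.ofReal (Real.exp (1 / M ^ 2 * sumOver (N ω) fun x => g x ^ 2)) ∂P ≤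
      ENNReal.ofReal (Real.exp (2 * v / M ^ 2)) := by
    simp_rw [← sumOver_const_mul]
    -- The exponential parameter is fixed at 1/M²: the exponents then lie in [0, 1], where exp(y) -
    -- 1 ≤ 2y.
    refine h.lintegral_exp_sumOver_comp_le hg hfin (F := fun y => 1 / M ^ 2 * y ^ 2)
      (G := fun y => 2 / M ^ 2 * y ^ 2) (by fun_prop) (by fun_prop) ?_ ?_
    · filter_upwards [hM] with x hx
      have hx2 : g x ^ 2 ≤ M ^ 2 := sq_le_sq' (abs_le.1 hx).1 (abs_le.1 hx).2
      have hy1 : 1 / M ^ 2 * g x ^ 2 ≤ 1 := by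
        rw [one_div, inv_mul_le_iff₀ (by positivity)]; linarith
      have hy0 : 0 ≤ 1 / M ^ 2 * g x ^ 2 := by positivity
      rw [show 2 / M ^ 2 * g x ^ 2 = 2 * (1 / M ^ 2 * g x ^ 2) by ring]
      set y := 1 / M ^ 2 * g x ^ 2
      have := Real.abs_exp_sub_one_le (x := y) (by rwa [abs_of_nonneg hy0])
      rw [abs_of_nonneg hy0] at this
      exact (le_abs_self _).trans this
    · rw [integral_const_mul]
      exact le_of_eq (by change 2 / M ^ 2 * v = _; ring)
  have hX : AEMeasurable (fun ω => 1 / M ^ 2 * sumOver (N ω) fun x => g x ^ 2) P :=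
    (h.aemeasurable_sumOver' (hg.pow_const 2) (finite_range_comp hfin fun y => y ^ 2)).const_mul _
  have hC := measure_ge_le_of_lintegral_exp_le hX hE (B := 1 / M ^ 2 * (2 * v + u * M ^ 2))
  refine (measure_mono fun ω hω => ?_).trans (hC.trans (le_of_eq ?_))
  · simp only [Set.mem_ofPred_eq] at hω ⊢
    gcongr
  · congr 2
    field_simp; ring

end IsPoissonProcess

end Deviation

/-! ### Wavelet systems -/

section Wavelets

lemma eLpNorm_two_sq (g : ℝ → ℝ) (μ : Measure ℝ) :
    eLpNorm g 2 μ ^ 2 = ∫⁻ x, ENNReal.ofReal (g x ^ 2) ∂μ := by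
  have h := eLpNorm_nnreal_pow_eq_lintegral (f := g) (μ := μ) (p := 2) two_ne_zero
  norm_num at h
  rw [← h.trans (lintegral_congr fun x => ?_)]
  rw [Real.enorm_eq_ofReal_abs, ← ENNReal.ofReal_pow (abs_nonneg _), sq_abs]

lemma lintegral_comp_mul_left_real {a : ℝ} (ha : 0 < a) (F : ℝ → ℝ≥0∞) :
    ∫⁻ x, F (a * x) = ENNReal.ofReal a⁻¹ * ∫⁻ x, F x := by
  have h1 := (Homeomorph.mulLeft₀ a ha.ne').measurableEmbedding.lintegral_map
    (μ := volume) F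
  have h2 : (Measure.map (⇑(Homeomorph.mulLeft₀ a ha.ne')) volume : Measure ℝ) =
      ENNReal.ofReal a⁻¹ • volume := by
    have := Real.map_volume_mul_left ha.ne'
    rwa [abs_of_pos (inv_pos.2 ha)] at this
  rw [h2, lintegral_smul_measure] at h1
  simpa using h1.symm

lemma inner_toLp_eq_integral {f g : ℝ → ℝ} (hf : MemLp f 2 volume) (hg : MemLp g 2 volume) :
    (inner ℝ hf.toLp hg.toLp : ℝ) = ∫ x, f x * g x := by
  rw [L2.inner_def]
  refine integral_congr_ae ?_
  filter_upwards [hf.coeFn_toLp, hg.coeFn_toLp] with x h1 h2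
  simp only [h1, h2, RCLike.inner_apply, conj_trivial]
  rw [mul_comm]

/-- Translates between expansions of functions, as in the definition of a basis, and unconditional
series in the Hilbert space L². -/
lemma hasSum_toLp_iff {ι : Type*} {s : ι → ℝ → ℝ} (hs : ∀ i, MemLp (s i) 2 volume) (c : ι → ℝ)
    {g : ℝ → ℝ} (hg : MemLp g 2 volume) :
    HasSum (fun i => c i • (hs i).toLp) hg.toLp ↔
      Tendsto (fun S : Finset ι => eLpNorm (fun x => g x - ∑ i ∈ S, c i * s i x) 2 volume)
        atTop (𝓝 0) := by
  classical
  have hm : ∀ S : Finset ι, MemLp (fun x => ∑ i ∈ S, c i * s i x) 2 volume := fun S =>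
    memLp_finsetSum S fun i _ => (hs i).const_mul (c i)
  have hsum : ∀ S : Finset ι, ∑ i ∈ S, c i • (hs i).toLp = (hm S).toLp := fun S => by
    induction S using Finset.induction_on with
    | empty =>
      refine (Lp.ext ?_)
      filter_upwards [Lp.coeFn_zero ℝ 2 volume, (hm ∅).coeFn_toLp] with x h1 h2
      rw [Finset.sum_empty, h1, h2]; simp
    | insert l S hl ih =>
      rw [Finset.sum_insert hl, ih]
      refine (Lp.ext ?_)
      filter_upwards [Lp.coeFn_add (c l • (hs l).toLp) (hm S).toLp,
        Lp.coeFn_smul (c l) (hs l).toLp, (hs l).coeFn_toLp, (hm S).coeFn_toLp,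
        (hm (insert l S)).coeFn_toLp] with x h1 h2 h3 h4 h5
      rw [h1, h5, Pi.add_apply, h2, h4, Pi.smul_apply, h3, Finset.sum_insert hl, smul_eq_mul]
  rw [HasSum, tendsto_iff_edist_tendsto_0]
  refine tendsto_congr fun S => ?_
  rw [hsum, edist_comm, Lp.edist_toLp_toLp]
  rfl

/-- The level of an index; the father wavelets are put on level `0`. -/
def lev (l : Idx) : ℕ := l.1.1.toNat

/-- The unscaled generator of the wavelet of index `l`. -/
def gen (φ ψ : ℝ → ℝ) (l : Idx) : ℝ → ℝ := if l.1.1 = -1 then φ else ψ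

lemma wavelet_eq (φ ψ : ℝ → ℝ) (l : Idx) (x : ℝ) :
    wavelet φ ψ l x = Real.sqrt (2 ^ lev l) * gen φ ψ l (2 ^ lev l * x - l.1.2) := by
  unfold wavelet gen lev
  split_ifs with hl
  · simp [hl]
  · have h0 : 0 ≤ l.1.1 := by have := l.2; omega
    obtain ⟨j, hj⟩ := Int.eq_ofNat_of_zero_le h0
    rw [hj]
    simp only [Int.cast_natCast, zpow_natCast, Int.toNat_natCast]
    congr 1
    rw [Real.sqrt_eq_rpow, ← Real.rpow_natCast, ← Real.rpow_mul two_pos.le]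
    congr 1; ring

lemma lintegral_wavelet_sq (φ ψ : ℝ → ℝ) (l : Idx) :
    ∫⁻ x, ENNReal.ofReal (wavelet φ ψ l x ^ 2) = ∫⁻ x, ENNReal.ofReal (gen φ ψ l x ^ 2) := by
  have h2 : (0 : ℝ) < 2 ^ lev l := by positivity
  have e : ∀ x, ENNReal.ofReal (wavelet φ ψ l x ^ 2) = ENNReal.ofReal (2 ^ lev l) *
      ENNReal.ofReal (gen φ ψ l (2 ^ lev l * x - l.1.2) ^ 2) := fun x => by
    rw [wavelet_eq, mul_pow, Real.sq_sqrt h2.le, ENNReal.ofReal_mul h2.le]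
  simp_rw [e]
  rw [lintegral_const_mul' _ _ ENNReal.ofReal_ne_top,
    lintegral_comp_mul_left_real h2
      (fun y => ENNReal.ofReal (gen φ ψ l (y - l.1.2) ^ 2)),
    lintegral_sub_right_eq_self (fun y => ENNReal.ofReal (gen φ ψ l y ^ 2)), ← mul_assoc,
    ← ENNReal.ofReal_mul h2.le, mul_inv_cancel₀ h2.ne', ENNReal.ofReal_one, one_mul]

lemma measurable_box : Measurable box :=
  measurable_one.indicator measurableSet_Icc

lemma finite_range_box : (Set.range box).Finite := by
  refine (Set.toFinite {0, 1}).subset ?_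
  rintro _ ⟨x, rfl⟩
  by_cases hx : x ∈ Set.Icc (0 : ℝ) 1
  · right; simp only [box]; rw [Set.indicator_of_mem hx]; rfl
  · left; simp only [box]; rw [Set.indicator_of_notMem hx]

lemma box_eq_zero {x : ℝ} (hx : 1 < |x|) : box x = 0 := by
  refine Set.indicator_of_notMem (fun h => ?_) _
  rw [abs_of_nonneg h.1] at hx
  linarith [h.2]

lemma quasiMeasurePreserving_affine {a : ℝ} (ha : a ≠ 0) (b : ℝ) :
    Measure.QuasiMeasurePreserving (fun x : ℝ => a * x - b) := by
  refine (measurePreserving_sub_right volume b).quasiMeasurePreserving.comp ⟨by fun_prop, ?_⟩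
  rw [Real.map_volume_mul_left ha]
  exact Measure.smul_absolutelyContinuous

/-- The properties of the generators that are used below, common to the smooth biorthogonal bases
and the Haar basis. -/
structure IsAdmissible (Φ : Generators) : Prop where
  measurable_ψ : Measurable Φ.ψ
  finite_range_ψ : (Set.range Φ.ψ).Finite
  exists_support : ∃ A : ℝ, 1 ≤ A ∧ ∀ x, A < |x| → Φ.ψ x = 0 ∧ Φ.φd x = 0 ∧ Φ.ψd x = 0
  memLp_φd : MemLp Φ.φd 2 volume
  memLp_ψd : MemLp Φ.ψd 2 volume
  modulus_φd : ∃ C : ℝ, 0 ≤ C ∧ ∀ u : ℝ,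
    ∫⁻ x, ENNReal.ofReal ((Φ.φd (x + u) - Φ.φd x) ^ 2) ≤ ENNReal.ofReal (C * |u|)
  modulus_ψd : ∃ C : ℝ, 0 ≤ C ∧ ∀ u : ℝ,
    ∫⁻ x, ENNReal.ofReal ((Φ.ψd (x + u) - Φ.ψd x) ^ 2) ≤ ENNReal.ofReal (C * |u|)
  biorthogonal : ∀ l l' : Idx, ∫ x, Φ.ana l x * Φ.syn l' x = if l = l' then 1 else 0
  expansion : ∀ f : ℝ → ℝ, MemLp f 2 volume →
    Tendsto (fun S : Finset Idx =>
      eLpNorm (fun x => f x - ∑ l ∈ S, Φ.coeff f l * Φ.syn l x) 2 volume) atTop (𝓝 0)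

namespace IsAdmissible

variable {Φ : Generators} (hΦ : IsAdmissible Φ)
include hΦ

lemma measurable_gen (l : Idx) : Measurable (gen box Φ.ψ l) := by
  unfold gen; split_ifs
  exacts [measurable_box, hΦ.measurable_ψ]

lemma measurable_ana (l : Idx) : Measurable (Φ.ana l) := by
  have : Φ.ana l = fun x => Real.sqrt (2 ^ lev l) *
      gen box Φ.ψ l (2 ^ lev l * x - l.1.2) := funext fun x => wavelet_eq _ _ _ _
  rw [this]
  exact ((hΦ.measurable_gen l).comp (by fun_prop)).const_mul _

lemma finite_range_ana (l : Idx) : (Set.range (Φ.ana l)).Finite := by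
  have hg : (Set.range (gen box Φ.ψ l)).Finite := by
    unfold gen; split_ifs
    exacts [finite_range_box, hΦ.finite_range_ψ]
  refine (hg.image fun y => Real.sqrt (2 ^ lev l) * y).subset ?_
  rintro _ ⟨x, rfl⟩
  exact ⟨_, ⟨_, rfl⟩, (wavelet_eq box Φ.ψ l x).symm⟩

/-- The nonzero values of the generators lie between two positive bounds. -/
lemma exists_bounds : ∃ b B : ℝ, 0 < b ∧ b ≤ B ∧ ∀ (l : Idx) (x : ℝ),
    |gen box Φ.ψ l x| ≤ B ∧ (gen box Φ.ψ l x ≠ 0 → b ≤ |gen box Φ.ψ l x|) := by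
  have hR := finite_range_box.union hΦ.finite_range_ψ
  obtain ⟨B, hB⟩ := (hR.image abs).bddAbove
  obtain ⟨b, hb0, hb⟩ : ∃ b : ℝ, 0 < b ∧
      ∀ y ∈ Set.range box ∪ Set.range Φ.ψ, y ≠ 0 → b ≤ |y| := by
    have hR' := hR.inter_of_left {y | y ≠ 0}
    have h0 : (0 : ℝ) ∉ abs '' ((Set.range box ∪ Set.range Φ.ψ) ∩ {y | y ≠ 0}) := by
      rintro ⟨y, hy, hy0⟩
      exact hy.2 (abs_eq_zero.1 hy0)
    have hop := (hR'.image abs).isClosed.isOpen_compl.mem_nhds h0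
    obtain ⟨ε, hε, hball⟩ := Metric.mem_nhds_iff.1 hop
    refine ⟨ε, hε, fun y hy hy0 => ?_⟩
    by_contra hc
    push Not at hc
    exact hball (by simpa using hc : |y| ∈ Metric.ball (0 : ℝ) ε) ⟨y, ⟨hy, hy0⟩, rfl⟩
  have hmem : ∀ l x, gen box Φ.ψ l x ∈ Set.range box ∪ Set.range Φ.ψ := fun l x => by
    unfold gen; split_ifs
    · exact Or.inl ⟨x, rfl⟩
    · exact Or.inr ⟨x, rfl⟩
  have hbB : b ≤ B := by
    have h1 : box 0 = 1 := by simp [box]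
    have h2 : box 0 ∈ Set.range box ∪ Set.range Φ.ψ := Or.inl ⟨0, rfl⟩
    have := hb _ h2 (by rw [h1]; exact one_ne_zero)
    exact this.trans (hB ⟨_, h2, rfl⟩)
  exact ⟨b, B, hb0, hbB, fun l x => ⟨hB ⟨_, hmem l x, rfl⟩, hb _ (hmem l x)⟩⟩

lemma abs_ana_ae_le (l : Idx) : ∀ᵐ x, |Φ.ana l x| ≤ supNorm Φ l := by
  obtain ⟨b, B, hb, hbB, hB⟩ := hΦ.exists_bounds
  have hfin : eLpNorm (Φ.ana l) ∞ volume ≠ ∞ := by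
    refine (eLpNorm_exponent_top (f := Φ.ana l) ▸ (eLpNormEssSup_lt_top_of_ae_bound
      (C := Real.sqrt (2 ^ lev l) * B) (Eventually.of_forall fun x => ?_))).ne
    simp only [Generators.ana]
    rw [wavelet_eq, norm_mul, Real.norm_of_nonneg (Real.sqrt_nonneg _)]
    gcongr
    exact (hB l _).1
  have := ae_le_eLpNormEssSup (f := Φ.ana l) (μ := volume)
  filter_upwards [this] with x hx
  rw [supNorm, ← Real.norm_eq_abs, ← toReal_enorm]
  rw [eLpNorm_exponent_top] at hfin ⊢
  exact ENNReal.toReal_mono hfin hx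

omit hΦ in
lemma supNorm_le {B : ℝ} (hB : ∀ (l : Idx) (x : ℝ), |gen box Φ.ψ l x| ≤ B) (l : Idx) :
    supNorm Φ l ≤ Real.sqrt (2 ^ lev l) * B := by
  have hB0 : 0 ≤ B := (abs_nonneg _).trans (hB l 0)
  refine ENNReal.toReal_le_of_le_ofReal (by positivity) ?_
  rw [eLpNorm_exponent_top]
  refine eLpNormEssSup_le_of_ae_bound (Eventually.of_forall fun x => ?_)
  simp only [Generators.ana]
  rw [wavelet_eq, norm_mul, Real.norm_of_nonneg (Real.sqrt_nonneg _)]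
  gcongr
  exact hB l _

/-- An analysis function vanishing almost everywhere could not pair to 1 with its dual. -/
lemma supNorm_pos (l : Idx) : 0 < supNorm Φ l := by
  refine lt_of_le_of_ne ENNReal.toReal_nonneg fun h0 => ?_
  have h1 := hΦ.abs_ana_ae_le l
  rw [← h0] at h1
  have h2 := hΦ.biorthogonal l l
  rw [if_pos rfl, integral_eq_zero_of_ae] at h2
  · exact zero_ne_one h2
  · filter_upwards [h1] with x hx
    simp [abs_nonpos_iff.1 hx]

/-- The nonzero values of an analysis wavelet are comparable to its supremum norm. -/
lemma exists_lower_bound : ∃ q : ℝ, 0 < q ∧ ∀ (l : Idx) (x : ℝ), Φ.ana l x ≠ 0 →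
    q * supNorm Φ l ≤ |Φ.ana l x| := by
  obtain ⟨b, B, hb, hbB, hB⟩ := hΦ.exists_bounds
  have hB0 : 0 < B := hb.trans_le hbB
  refine ⟨b / B, by positivity, fun l x hx => ?_⟩
  have h1 := supNorm_le (fun l x => (hB l x).1) l
  simp only [Generators.ana] at hx ⊢
  rw [wavelet_eq] at hx ⊢
  rw [abs_mul, abs_of_nonneg (Real.sqrt_nonneg _)]
  calc b / B * supNorm Φ l ≤ b / B * (Real.sqrt (2 ^ lev l) * B) := by gcongr
    _ = Real.sqrt (2 ^ lev l) * b := by field_simp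
    _ ≤ _ := by
      gcongr
      exact (hB l _).2 (right_ne_zero_of_mul hx)

lemma ana_support : ∃ A : ℝ, 1 ≤ A ∧ ∀ (l : Idx) (x : ℝ), A < |2 ^ lev l * x - l.1.2| →
    Φ.ana l x = 0 ∧ Φ.syn l x = 0 := by
  obtain ⟨A, hA, h⟩ := hΦ.exists_support
  refine ⟨A, hA, fun l x hx => ?_⟩
  simp only [Generators.ana, Generators.syn]
  rw [wavelet_eq, wavelet_eq]
  have := h _ hx
  have hb := box_eq_zero (hA.trans_lt hx)
  unfold gen
  constructor <;> split_ifs <;> simp [this, hb]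

lemma memLp_ana (l : Idx) : MemLp (Φ.ana l) 2 volume := by
  obtain ⟨A, hA, h⟩ := hΦ.ana_support
  have h1 : MemLp ((Set.Icc ((l.1.2 - A) / 2 ^ lev l) ((l.1.2 + A) / 2 ^ lev l)).indicator
      fun _ => supNorm Φ l) 2 volume :=
    memLp_indicator_const 2 measurableSet_Icc _ (Or.inr (by simp))
  refine h1.of_le (hΦ.measurable_ana l).aestronglyMeasurable ?_
  filter_upwards [hΦ.abs_ana_ae_le l] with x hx
  by_cases hxA : A < |2 ^ lev l * x - l.1.2|
  · rw [(h l x hxA).1, norm_zero]; positivity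
  · push Not at hxA
    have hp : (0 : ℝ) < 2 ^ lev l := by positivity
    rw [abs_le] at hxA
    rw [Set.indicator_of_mem]
    · rw [Real.norm_eq_abs, Real.norm_eq_abs]
      exact hx.trans (le_abs_self _)
    · constructor
      · rw [div_le_iff₀ hp]; linarith
      · rw [le_div_iff₀ hp]; linarith

lemma memLp_syn (l : Idx) : MemLp (Φ.syn l) 2 volume := by
  have hg : MemLp (gen Φ.φd Φ.ψd l) 2 volume := by
    unfold gen; split_ifs
    exacts [hΦ.memLp_φd, hΦ.memLp_ψd]
  have hp : (2 : ℝ) ^ lev l ≠ 0 := by positivity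
  have he : Φ.syn l = fun x => Real.sqrt (2 ^ lev l) *
      gen Φ.φd Φ.ψd l (2 ^ lev l * x - l.1.2) := funext fun x => wavelet_eq _ _ _ _
  refine ⟨?_, ?_⟩
  · rw [he]
    exact (hg.1.comp_quasiMeasurePreserving (quasiMeasurePreserving_affine hp _)).const_mul _
  · have h2 := hg.2
    have e : eLpNorm (Φ.syn l) 2 volume ^ 2 = eLpNorm (gen Φ.φd Φ.ψd l) 2 volume ^ 2 := by
      rw [eLpNorm_two_sq, eLpNorm_two_sq]
      exact lintegral_wavelet_sq _ _ _
    rwa [(ENNReal.pow_right_strictMono two_ne_zero).injective e]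

omit hΦ in
lemma eLpNorm_syn (l : Idx) :
    eLpNorm (Φ.syn l) 2 volume = eLpNorm (gen Φ.φd Φ.ψd l) 2 volume := by
  refine (ENNReal.pow_right_strictMono two_ne_zero).injective ?_
  rw [eLpNorm_two_sq, eLpNorm_two_sq]
  exact lintegral_wavelet_sq _ _ _

lemma eLpNorm_syn_ne_zero (l : Idx) : eLpNorm (Φ.syn l) 2 volume ≠ 0 := by
  intro h0
  rw [eLpNorm_eq_zero_iff (hΦ.memLp_syn l).1 two_ne_zero] at h0
  have h2 := hΦ.biorthogonal l l
  rw [if_pos rfl, integral_eq_zero_of_ae] at h2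
  · exact zero_ne_one h2
  · filter_upwards [h0] with x hx
    simp [hx]

lemma integrable_ana_mul (l : Idx) {g : ℝ → ℝ} (hg : MemLp g 2 volume) :
    Integrable (fun x => Φ.ana l x * g x) volume :=
  (hΦ.memLp_ana l).integrable_mul hg

lemma coeff_sub {f g : ℝ → ℝ} (hf : MemLp f 2 volume) (hg : MemLp g 2 volume) (l : Idx) :
    Φ.coeff (fun x => f x - g x) l = Φ.coeff f l - Φ.coeff g l := by
  simp only [Generators.coeff, mul_sub]
  exact integral_sub (hΦ.integrable_ana_mul l hf) (hΦ.integrable_ana_mul l hg)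

lemma memLp_sum_syn (S : Finset Idx) (a : Idx → ℝ) :
    MemLp (fun x => ∑ l ∈ S, a l * Φ.syn l x) 2 volume :=
  memLp_finsetSum S fun l _ => (hΦ.memLp_syn l).const_mul (a l)

lemma coeff_sum_syn (S : Finset Idx) (a : Idx → ℝ) (l : Idx) [Decidable (l ∈ S)] :
    Φ.coeff (fun x => ∑ l' ∈ S, a l' * Φ.syn l' x) l = if l ∈ S then a l else 0 := by
  classical
  simp only [Generators.coeff, Finset.mul_sum]
  rw [integral_finsetSum]
  · have : ∀ l', ∫ x, Φ.ana l x * (a l' * Φ.syn l' x) = if l = l' then a l' else 0 := fun l' => by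
      have e : ∀ x, Φ.ana l x * (a l' * Φ.syn l' x) = a l' * (Φ.ana l x * Φ.syn l' x) :=
        fun x => by ring
      simp_rw [e]
      rw [integral_const_mul, hΦ.biorthogonal]; simp
    simp_rw [this]
    simp
  · intro l' _
    exact hΦ.integrable_ana_mul l ((hΦ.memLp_syn l').const_mul (a l'))

/-- The wavelet coefficients give an equivalent norm on `L²`. -/
theorem exists_norm_equiv : ∃ C : ℝ, 0 < C ∧ ∀ g : ℝ → ℝ, MemLp g 2 volume →
    (∑' l : Idx, ENNReal.ofReal (Φ.coeff g l ^ 2)) ≤ ENNReal.ofReal C * eLpNorm g 2 volume ^ 2 ∧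
    eLpNorm g 2 volume ^ 2 ≤ ENNReal.ofReal C * ∑' l : Idx, ENNReal.ofReal (Φ.coeff g l ^ 2) := by
  classical
  let a : Idx → Lp ℝ 2 (volume : Measure ℝ) := fun l => (hΦ.memLp_ana l).toLp
  let s : Idx → Lp ℝ 2 (volume : Measure ℝ) := fun l => (hΦ.memLp_syn l).toLp
  have hinner : ∀ (l : Idx) {g : ℝ → ℝ} (hg : MemLp g 2 volume),
      (inner ℝ (a l) hg.toLp : ℝ) = Φ.coeff g l := fun l g hg => inner_toLp_eq_integral _ hg
  have hbi : ∀ i j, (inner ℝ (a i) (s j) : ℝ) = if i = j then (1 : ℝ) else 0 := fun i j => by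
    rw [hinner i (hΦ.memLp_syn j)]; exact hΦ.biorthogonal i j
  have hexp' : ∀ {g : ℝ → ℝ} (hg : MemLp g 2 volume),
      HasSum (fun l => (inner ℝ (a l) hg.toLp : ℝ) • s l) hg.toLp := fun {g} hg => by
    simp_rw [hinner _ hg]
    exact (hasSum_toLp_iff hΦ.memLp_syn _ hg).2 (hΦ.expansion g hg)
  have hexp : ∀ x : Lp ℝ 2 (volume : Measure ℝ),
      HasSum (fun l => (inner ℝ (a l) x : ℝ) • s l) x := fun x => by
    have := hexp' (Lp.memLp x)
    simpa [Lp.toLp_coeFn] using this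
  have hnorm : ∀ l, ‖s l‖ = (eLpNorm (gen Φ.φd Φ.ψd l) 2 volume).toReal := fun l => by
    rw [Lp.norm_toLp, eLpNorm_syn]
  let l₁ : Idx := ⟨(-1, 0), le_rfl⟩
  let l₂ : Idx := ⟨(0, 0), by norm_num⟩
  -- The L² norm is invariant under the dyadic rescaling, so only the norms of the father and of the
  -- mother wavelet occur.
  have hcase : ∀ l, ‖s l‖ = ‖s l₁‖ ∨ ‖s l‖ = ‖s l₂‖ := fun l => by
    simp only [hnorm, gen]
    by_cases h : l.1.1 = -1
    · left; simp [h, l₁]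
    · right; simp [h, l₂]
  have hpos : ∀ l, 0 < ‖s l‖ := fun l => by
    rw [Lp.norm_toLp]
    exact ENNReal.toReal_pos (hΦ.eLpNorm_syn_ne_zero l) (hΦ.memLp_syn l).2.ne
  obtain ⟨C, hC, hC1, hC2⟩ := exists_riesz_bounds hbi hexp
    (lt_min (hpos l₁) (hpos l₂))
    (fun l => by rcases hcase l with h | h <;> rw [h] <;> simp)
    (M := max ‖s l₁‖ ‖s l₂‖) (fun l => by rcases hcase l with h | h <;> rw [h] <;> simp)
  refine ⟨C, hC, fun g hg => ?_⟩
  have hng : eLpNorm g 2 volume ^ 2 = ENNReal.ofReal (‖hg.toLp‖ ^ 2) := by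
    rw [Lp.norm_toLp, ENNReal.ofReal_pow ENNReal.toReal_nonneg, ENNReal.ofReal_toReal hg.2.ne]
  have hfin : ∀ S : Finset Idx, ∑ l ∈ S, ENNReal.ofReal (Φ.coeff g l ^ 2) =
      ENNReal.ofReal (∑ l ∈ S, Φ.coeff g l ^ 2) := fun S =>
    (ENNReal.ofReal_sum_of_nonneg fun _ _ => sq_nonneg _).symm
  constructor
  · rw [hng, ← ENNReal.ofReal_mul hC.le, ENNReal.tsum_eq_iSup_sum]
    refine iSup_le fun S => ?_
    rw [hfin]
    refine ENNReal.ofReal_le_ofReal ?_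
    have := hC1 hg.toLp S
    simpa only [hinner _ hg] using this
  · rw [hng]
    have hlim : Tendsto (fun S : Finset Idx =>
        ENNReal.ofReal (‖∑ l ∈ S, (inner ℝ (a l) hg.toLp : ℝ) • s l‖ ^ 2)) atTop
        (𝓝 (ENNReal.ofReal (‖hg.toLp‖ ^ 2))) :=
      ENNReal.tendsto_ofReal (((hexp' hg : Tendsto _ _ _).norm).pow 2)
    refine le_of_tendsto hlim (Eventually.of_forall fun S => ?_)
    refine (ENNReal.ofReal_le_ofReal (hC2 _ S)).trans ?_
    rw [ENNReal.ofReal_mul hC.le]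
    gcongr
    simp_rw [hinner _ hg]
    rw [← hfin]
    exact ENNReal.sum_le_tsum S

end IsAdmissible

end Wavelets

/-! ### Smooth biorthogonal bases are admissible -/

section Smooth

/-- Off the breakpoints, g(x) depends only on how many breakpoints lie to the left of x. This count
is monotone, hence measurable, and bounded, which yields both measurability and finiteness of the
range. -/
lemma IsPiecewiseConstant.exists_factor {g : ℝ → ℝ} (hg : IsPiecewiseConstant g) :
    ∃ (B : Finset ℝ) (F : ℝ → ℕ) (G : ℕ → ℝ), Measurable F ∧ (∀ x, F x ≤ B.card) ∧
      ∀ x, x ∉ B → g x = G (F x) := by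
  classical
  obtain ⟨B, hB⟩ := hg
  let F : ℝ → ℕ := fun x => (B.filter (· < x)).card
  have hmono : Monotone F := fun x y hxy =>
    Finset.card_le_card fun b hb => by
      simp only [Finset.mem_filter] at hb ⊢
      exact ⟨hb.1, hb.2.trans_le hxy⟩
  have key : ∀ x y, x ≤ y → x ∉ B → y ∉ B → F x = F y → g x = g y := by
    intro x y hxy hx hy hF
    refine hB x y hxy fun b hb hbm => ?_
    have hlt : F x < F y := by
      refine Finset.card_lt_card ⟨fun c hc => ?_, fun hc => ?_⟩
      · simp only [Finset.mem_filter] at hc ⊢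
        exact ⟨hc.1, hc.2.trans_le hxy⟩
      · have hby : b < y := lt_of_le_of_ne hbm.2 fun h => hy (h ▸ hb)
        have := hc (Finset.mem_filter.2 ⟨hb, hby⟩)
        exact absurd (Finset.mem_filter.1 this).2 (not_lt.2 hbm.1)
    exact hlt.ne hF
  refine ⟨B, F, fun k => if h : ∃ y, y ∉ B ∧ F y = k then g h.choose else 0,
    hmono.measurable, fun x => Finset.card_filter_le _ _, fun x hx => ?_⟩
  have hex : ∃ y, y ∉ B ∧ F y = F x := ⟨x, hx, rfl⟩
  simp only [dif_pos hex]
  obtain ⟨h1, h2⟩ := hex.choose_spec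
  rcases le_total x hex.choose with h | h
  · exact key _ _ h hx h1 h2.symm
  · exact (key _ _ h h1 hx h2).symm

lemma IsPiecewiseConstant.measurable {g : ℝ → ℝ} (hg : IsPiecewiseConstant g) :
    Measurable g := by
  obtain ⟨B, F, G, hF, -, h⟩ := hg.exists_factor
  refine (Measurable.of_discrete.comp hF : Measurable (G ∘ F)).measurable_of_countable_ne ?_
  refine B.countable_toSet.mono fun x hx => ?_
  by_contra hc
  exact hx (h x hc).symm

lemma IsPiecewiseConstant.finite_range {g : ℝ → ℝ} (hg : IsPiecewiseConstant g) :
    (Set.range g).Finite := by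
  classical
  obtain ⟨B, F, G, -, hF, h⟩ := hg.exists_factor
  refine ((B.image g ∪ (Finset.range (B.card + 1)).image G).finite_toSet).subset ?_
  rintro _ ⟨x, rfl⟩
  simp only [Finset.coe_union, Finset.coe_image, Set.mem_union, Set.mem_image]
  by_cases hx : x ∈ B
  · exact Or.inl ⟨x, hx, rfl⟩
  · refine Or.inr ⟨F x, ?_, (h x hx).symm⟩
    simpa using Nat.lt_succ_of_le (hF x)

/-- A bound for the `L²` modulus of continuity for small shifts extends to all shifts. -/
lemma exists_modulus_of_small {g : ℝ → ℝ} (hg : MemLp g 2 volume) {C : ℝ} (hC : 0 ≤ C)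
    (h : ∀ u : ℝ, |u| ≤ 1 →
      ∫⁻ x, ENNReal.ofReal ((g (x + u) - g x) ^ 2) ≤ ENNReal.ofReal (C * |u|)) :
    ∃ C : ℝ, 0 ≤ C ∧ ∀ u : ℝ,
      ∫⁻ x, ENNReal.ofReal ((g (x + u) - g x) ^ 2) ≤ ENNReal.ofReal (C * |u|) := by
  set D := (∫⁻ x, ENNReal.ofReal (g x ^ 2)).toReal
  have hD : ∫⁻ x, ENNReal.ofReal (g x ^ 2) = ENNReal.ofReal D := by
    refine (ENNReal.ofReal_toReal ?_).symm
    rw [← eLpNorm_two_sq]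
    exact ENNReal.pow_ne_top hg.2.ne
  have hD0 : 0 ≤ D := ENNReal.toReal_nonneg
  refine ⟨C + 4 * D, by positivity, fun u => ?_⟩
  rcases le_total |u| 1 with hu | hu
  · refine (h u hu).trans (ENNReal.ofReal_le_ofReal ?_)
    nlinarith [abs_nonneg u]
  · calc ∫⁻ x, ENNReal.ofReal ((g (x + u) - g x) ^ 2)
        ≤ ∫⁻ x, (ENNReal.ofReal 2 * ENNReal.ofReal (g (x + u) ^ 2) +
          ENNReal.ofReal 2 * ENNReal.ofReal (g x ^ 2)) := by
          refine lintegral_mono fun x => ?_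
          rw [← ENNReal.ofReal_mul two_pos.le, ← ENNReal.ofReal_mul two_pos.le,
            ← ENNReal.ofReal_add (by positivity) (by positivity)]
          exact ENNReal.ofReal_le_ofReal (by nlinarith [sq_nonneg (g (x + u) + g x)])
      _ = ENNReal.ofReal (4 * D) := by
          have hgm : AEMeasurable (fun x => ENNReal.ofReal 2 * ENNReal.ofReal (g x ^ 2)) volume :=
            (hg.1.aemeasurable.pow_const 2).ennreal_ofReal.const_mul _
          rw [lintegral_add_right' _ hgm, lintegral_const_mul' _ _ ENNReal.ofReal_ne_top,
            lintegral_const_mul' _ _ ENNReal.ofReal_ne_top,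
            lintegral_add_right_eq_self (fun x => ENNReal.ofReal (g x ^ 2)) u, hD,
            ← ENNReal.ofReal_mul two_pos.le, ← ENNReal.ofReal_add (by positivity) (by positivity)]
          congr 1; ring
      _ ≤ _ := ENNReal.ofReal_le_ofReal (by nlinarith)

lemma HasCompactSupport.exists_abs_bound {g : ℝ → ℝ} (hg : HasCompactSupport g) :
    ∃ A : ℝ, ∀ x, A < |x| → g x = 0 := by
  obtain ⟨A, hA⟩ := hg.isCompact.isBounded.exists_norm_le
  refine ⟨A, fun x hx => ?_⟩
  by_contra hc
  exact absurd (hA x (subset_tsupport g hc)) (not_le.2 hx)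

/-- A Lipschitz function of compact support has squared increments of order |u|²; for |u| ≤ 1 this
is weakened to |u|, the order that indicator functions also achieve. -/
lemma exists_modulus_of_contDiff {g : ℝ → ℝ} (hg : ContDiff ℝ 1 g) (hc : HasCompactSupport g) :
    ∃ C : ℝ, 0 ≤ C ∧ ∀ u : ℝ,
      ∫⁻ x, ENNReal.ofReal ((g (x + u) - g x) ^ 2) ≤ ENNReal.ofReal (C * |u|) := by
  obtain ⟨A, hA⟩ := HasCompactSupport.exists_abs_bound hc
  obtain ⟨K, hK⟩ := ContDiff.lipschitzWith_of_hasCompactSupport hc hg one_ne_zero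
  -- The margin 1 covers shifts with |u| ≤ 1; the maximum guards against a negative `A`.
  set D := max A 0 + 1
  have hD : 0 < D := by positivity
  refine exists_modulus_of_small (hg.continuous.memLp_of_hasCompactSupport hc)
    (C := K ^ 2 * (2 * D)) (by positivity) fun u hu => ?_
  calc ∫⁻ x, ENNReal.ofReal ((g (x + u) - g x) ^ 2)
      ≤ ∫⁻ x, (Set.Icc (-D) D).indicator (fun _ => ENNReal.ofReal ((K * |u|) ^ 2)) x := by
        refine lintegral_mono fun x => ?_
        by_cases hx : x ∈ Set.Icc (-D) D
        · rw [Set.indicator_of_mem hx]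
          refine ENNReal.ofReal_le_ofReal ?_
          rw [← sq_abs]
          gcongr
          have := hK.dist_le_mul (x + u) x
          simpa [Real.dist_eq] using this
        · have hx' : D < |x| := by
            by_contra hcon
            exact hx (abs_le.1 (not_lt.1 hcon))
          have h1 : A < |x| := by
            have := le_max_left A 0
            linarith
          have h2 : A < |x + u| := by
            have := le_max_left A 0
            have h3 : |x| ≤ |x + u| + |u| := by
              have := abs_sub (x + u) u
              simpa using this
            linarith
          rw [hA _ h1, hA _ h2]; simp
    _ = ENNReal.ofReal ((K * |u|) ^ 2) * ENNReal.ofReal (2 * D) := by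
        rw [lintegral_indicator_const measurableSet_Icc, Real.volume_Icc]
        congr 2; ring
    _ ≤ _ := by
        rw [← ENNReal.ofReal_mul (by positivity)]
        refine ENNReal.ofReal_le_ofReal ?_
        have : |u| ^ 2 ≤ |u| := by nlinarith [abs_nonneg u]
        calc (K * |u|) ^ 2 * (2 * D) = K ^ 2 * (2 * D) * |u| ^ 2 := by ring
          _ ≤ _ := by gcongr

lemma HolderRegular.contDiff_one {r : ℝ} (hr : 0 < r) {g : ℝ → ℝ}
    (hg : HolderRegular (r + 1) g) : ContDiff ℝ 1 g := by
  refine hg.1.of_le ?_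
  have h1 : 1 < ⌈r + 1⌉₊ := by
    rw [Nat.lt_ceil]; simpa using hr
  have : 1 ≤ ⌈r + 1⌉₊ - 1 := by omega
  exact_mod_cast this

theorem IsSmoothBiorthogonalBasis.isAdmissible {Φ : Generators}
    (h : IsSmoothBiorthogonalBasis Φ) : IsAdmissible Φ where
  measurable_ψ := h.piecewise_ψ.measurable
  finite_range_ψ := h.piecewise_ψ.finite_range
  exists_support := by
    obtain ⟨A, hA⟩ := HasCompactSupport.exists_abs_bound h.compact_ψ
    obtain ⟨A', hA'⟩ := HasCompactSupport.exists_abs_bound h.compact_φd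
    obtain ⟨A'', hA''⟩ := HasCompactSupport.exists_abs_bound h.compact_ψd
    refine ⟨max 1 (max A (max A' A'')), le_max_left _ _, fun x hx => ?_⟩
    simp only [max_lt_iff] at hx
    exact ⟨hA x hx.2.1, hA' x hx.2.2.1, hA'' x hx.2.2.2⟩
  memLp_φd := (h.holder_φd.contDiff_one h.r_pos).continuous.memLp_of_hasCompactSupport h.compact_φd
  memLp_ψd := (h.holder_ψd.contDiff_one h.r_pos).continuous.memLp_of_hasCompactSupport h.compact_ψd
  modulus_φd := exists_modulus_of_contDiff (h.holder_φd.contDiff_one h.r_pos) h.compact_φd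
  modulus_ψd := exists_modulus_of_contDiff (h.holder_ψd.contDiff_one h.r_pos) h.compact_ψd
  biorthogonal := h.biorthogonal
  expansion := h.expansion

end Smooth

/-! ### The Haar basis is admissible -/

section Haar

lemma intervalIntegral_eq_of_const {F : ℝ → ℝ} {a b c : ℝ} (hab : a ≤ b)
    (h : ∀ x ∈ Set.Ioo a b, F x = c) : ∫ x in a..b, F x = c * (b - a) := by
  rw [intervalIntegral.integral_of_le hab, integral_Ioc_eq_integral_Ioo,
    setIntegral_congr_fun measurableSet_Ioo h, setIntegral_const]
  simp [measureReal_def, Real.volume_Ioo, hab, mul_comm]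

lemma integral_indicator_Icc_mul {f : ℝ → ℝ} {a b : ℝ} (hab : a ≤ b) :
    ∫ x, (Set.Icc a b).indicator (1 : ℝ → ℝ) x * f x = ∫ x in a..b, f x := by
  have : (fun x => (Set.Icc a b).indicator (1 : ℝ → ℝ) x * f x) =
      (Set.Icc a b).indicator f := by
    ext x
    by_cases hx : x ∈ Set.Icc a b <;> simp [hx]
  rw [this, integral_indicator measurableSet_Icc, integral_Icc_eq_integral_Ioc,
    intervalIntegral.integral_of_le hab]

lemma indicator_Icc_affine {c : ℝ} (hc : 0 < c) (p q k x : ℝ) :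
    (Set.Icc p q).indicator (1 : ℝ → ℝ) (c * x - k) =
      (Set.Icc ((k + p) / c) ((k + q) / c)).indicator (1 : ℝ → ℝ) x := by
  have : c * x - k ∈ Set.Icc p q ↔ x ∈ Set.Icc ((k + p) / c) ((k + q) / c) := by
    rw [Set.mem_Icc, Set.mem_Icc, div_le_iff₀ hc, le_div_iff₀ hc]
    constructor <;> rintro ⟨h1, h2⟩ <;> constructor <;> linarith
  by_cases h : c * x - k ∈ Set.Icc p q
  · rw [Set.indicator_of_mem h, Set.indicator_of_mem (this.1 h)]; rfl
  · rw [Set.indicator_of_notMem h, Set.indicator_of_notMem (fun h' => h (this.2 h'))]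

lemma coeff_haar_father (f : ℝ → ℝ) {l : Idx} (hl : l.1.1 = -1) :
    haar.coeff f l = ∫ x in (l.1.2 : ℝ)..(l.1.2 + 1), f x := by
  rw [← integral_indicator_Icc_mul (by linarith)]
  refine integral_congr_ae (Eventually.of_forall fun x => ?_)
  have h := indicator_Icc_affine one_pos 0 1 (l.1.2 : ℝ) x
  simp only [div_one, add_zero, one_mul] at h
  simp only [Generators.ana, wavelet, hl, if_true, box, h]

lemma ana_haar_eq {l : Idx} (hl : l.1.1 ≠ -1) (x : ℝ) :
    haar.ana l x = Real.sqrt (2 ^ lev l) * haarMother (2 ^ lev l * x - l.1.2) := by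
  simp only [Generators.ana]
  rw [wavelet_eq, gen, if_neg hl]; rfl

lemma haarMother_affine (l : Idx) (x : ℝ) :
    haarMother (2 ^ lev l * x - l.1.2) =
      (Set.Icc ((l.1.2 : ℝ) / 2 ^ lev l) ((l.1.2 + 1 / 2) / 2 ^ lev l)).indicator (1 : ℝ → ℝ) x -
      (Set.Icc (((l.1.2 : ℝ) + 1 / 2) / 2 ^ lev l) ((l.1.2 + 1) / 2 ^ lev l)).indicator
        (1 : ℝ → ℝ) x := by
  have h2 : (0 : ℝ) < 2 ^ lev l := by positivity
  rw [haarMother, Pi.sub_apply, indicator_Icc_affine h2, indicator_Icc_affine h2, add_zero]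

lemma coeff_haar_mother {f : ℝ → ℝ} (hf : LocallyIntegrable f volume) {l : Idx}
    (hl : l.1.1 ≠ -1) :
    haar.coeff f l = Real.sqrt (2 ^ lev l) *
      ((∫ x in (l.1.2 : ℝ) / 2 ^ lev l..(l.1.2 + 1 / 2) / 2 ^ lev l, f x) -
        ∫ x in ((l.1.2 : ℝ) + 1 / 2) / 2 ^ lev l..(l.1.2 + 1) / 2 ^ lev l, f x) := by
  have h2 : (0 : ℝ) < 2 ^ lev l := by positivity
  have hi : ∀ a b : ℝ, Integrable (fun x => (Set.Icc a b).indicator (1 : ℝ → ℝ) x * f x)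
      volume := fun a b => by
    have : (fun x => (Set.Icc a b).indicator (1 : ℝ → ℝ) x * f x) =
        (Set.Icc a b).indicator f := by
      ext x
      by_cases hx : x ∈ Set.Icc a b <;> simp [hx]
    rw [this, integrable_indicator_iff measurableSet_Icc]
    exact hf.integrableOn_isCompact isCompact_Icc
  rw [← integral_indicator_Icc_mul (by gcongr; linarith),
    ← integral_indicator_Icc_mul (by gcongr; norm_num), ← integral_sub (hi _ _) (hi _ _),
    ← integral_const_mul]
  refine integral_congr_ae (Eventually.of_forall fun x => ?_)
  simp only [ana_haar_eq hl, haarMother_affine]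
  ring

/-- An indicator with dyadic endpoints is constant on finer dyadic intervals. -/
lemma exists_const_indicator_dyadic (d : ℕ) (k k' p q : ℤ) :
    ∃ c : ℝ, ∀ y ∈ Set.Ioo (k : ℝ) (k + 1),
      (Set.Icc ((p : ℝ) / 2 ^ d) (q / 2 ^ d)).indicator (1 : ℝ → ℝ) (y / 2 ^ d - k') = c := by
  classical
  have hp : (0 : ℝ) < 2 ^ d := by positivity
  refine ⟨if p + k' * 2 ^ d ≤ k ∧ k + 1 ≤ q + k' * 2 ^ d then 1 else 0, fun y hy => ?_⟩
  have hlow : ∀ m : ℤ, (m : ℝ) ≤ y ↔ m ≤ k := fun m => by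
    constructor
    · intro h
      have : (m : ℝ) < k + 1 := h.trans_lt hy.2
      have : m < k + 1 := by exact_mod_cast this
      omega
    · intro h
      have : (m : ℝ) ≤ k := by exact_mod_cast h
      exact this.trans hy.1.le
  have hup : ∀ m : ℤ, y ≤ (m : ℝ) ↔ k + 1 ≤ m := fun m => by
    constructor
    · intro h
      have : (k : ℝ) < m := hy.1.trans_le h
      have : k < m := by exact_mod_cast this
      omega
    · intro h
      have : ((k + 1 : ℤ) : ℝ) ≤ m := by exact_mod_cast h
      push_cast at this
      exact hy.2.le.trans this
  have hmem : y / 2 ^ d - k' ∈ Set.Icc ((p : ℝ) / 2 ^ d) (q / 2 ^ d) ↔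
      p + k' * 2 ^ d ≤ k ∧ k + 1 ≤ q + k' * 2 ^ d := by
    rw [← hlow, ← hup, Set.mem_Icc, le_sub_iff_add_le, sub_le_iff_le_add, div_add' _ _ _ hp.ne',
      div_add' _ _ _ hp.ne', div_le_div_iff_of_pos_right hp, div_le_div_iff_of_pos_right hp]
    push_cast
    rfl
  by_cases h : p + k' * 2 ^ d ≤ k ∧ k + 1 ≤ q + k' * 2 ^ d
  · rw [if_pos h, Set.indicator_of_mem (hmem.2 h)]; rfl
  · rw [if_neg h, Set.indicator_of_notMem (fun h' => h (hmem.1 h'))]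

/-- A Haar function is constant on the dyadic intervals of a finer level. -/
lemma exists_const_ana_haar {l l' : Idx} (h : l'.1.1 < l.1.1) :
    ∃ c : ℝ, ∀ x ∈ Set.Ioo ((l.1.2 : ℝ) / 2 ^ lev l) ((l.1.2 + 1) / 2 ^ lev l),
      haar.ana l' x = c := by
  have hpl : (0 : ℝ) < 2 ^ lev l := by positivity
  have hlev : lev l' ≤ lev l := by unfold lev; omega
  obtain ⟨d, hd⟩ := Nat.exists_eq_add_of_le hlev
  have hy : ∀ x ∈ Set.Ioo ((l.1.2 : ℝ) / 2 ^ lev l) ((l.1.2 + 1) / 2 ^ lev l),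
      2 ^ lev l * x ∈ Set.Ioo (l.1.2 : ℝ) (l.1.2 + 1) := fun x hx => by
    have h1 := hx.1
    have h2 := hx.2
    rw [div_lt_iff₀ hpl] at h1
    rw [lt_div_iff₀ hpl] at h2
    constructor <;> linarith
  have hx' : ∀ x : ℝ, 2 ^ lev l' * x - l'.1.2 = 2 ^ lev l * x / 2 ^ d - l'.1.2 := fun x => by
    rw [hd, pow_add]; field_simp
  by_cases hl' : l'.1.1 = -1
  · obtain ⟨c, hc⟩ := exists_const_indicator_dyadic d l.1.2 l'.1.2 0 (2 ^ d)
    refine ⟨Real.sqrt (2 ^ lev l') * c, fun x hx => ?_⟩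
    simp only [Generators.ana]
    rw [wavelet_eq, gen, if_pos hl', hx', ← hc _ (hy x hx), box]
    simp
  -- A mother wavelet also jumps at the midpoint of its support, so its pieces have denominator 2^(e
  -- + 1) in the finer scale, and at least one level of refinement is needed.
  · have hlt : lev l' < lev l := by
      have := l'.2
      unfold lev; omega
    obtain ⟨e, rfl⟩ : ∃ e, d = e + 1 := ⟨d - 1, by omega⟩
    obtain ⟨c, hc⟩ := exists_const_indicator_dyadic (e + 1) l.1.2 l'.1.2 0 (2 ^ e)
    obtain ⟨c', hc'⟩ := exists_const_indicator_dyadic (e + 1) l.1.2 l'.1.2 (2 ^ e) (2 ^ (e + 1))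
    refine ⟨Real.sqrt (2 ^ lev l') * (c - c'), fun x hx => ?_⟩
    rw [ana_haar_eq hl', hx', ← hc _ (hy x hx), ← hc' _ (hy x hx), haarMother]
    have e1 : ((2 : ℝ) ^ e) / 2 ^ (e + 1) = 1 / 2 := by rw [pow_succ]; field_simp
    simp [e1]

lemma memLp_box : MemLp box 2 volume :=
  memLp_indicator_const 2 measurableSet_Icc (1 : ℝ) (Or.inr (by simp))

lemma memLp_haarMother : MemLp haarMother 2 volume :=
  (memLp_indicator_const 2 measurableSet_Icc (1 : ℝ) (Or.inr (by simp))).sub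
    (memLp_indicator_const 2 measurableSet_Icc (1 : ℝ) (Or.inr (by simp)))

lemma measurable_haarMother : Measurable haarMother :=
  (measurable_one.indicator measurableSet_Icc).sub (measurable_one.indicator measurableSet_Icc)

lemma locallyIntegrable_of_memLp_two {f : ℝ → ℝ} (hf : MemLp f 2 volume) :
    LocallyIntegrable f volume := hf.locallyIntegrable (by norm_num)

lemma memLp_ana_haar (l : Idx) : MemLp (haar.ana l) 2 volume := by
  have hg : MemLp (gen box haarMother l) 2 volume := by
    unfold gen; split_ifs
    exacts [memLp_box, memLp_haarMother]
  have hp : (2 : ℝ) ^ lev l ≠ 0 := by positivity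
  have he : haar.ana l = fun x => Real.sqrt (2 ^ lev l) *
      gen box haarMother l (2 ^ lev l * x - l.1.2) := funext fun x => wavelet_eq _ _ _ _
  refine ⟨?_, ?_⟩
  · rw [he]
    exact (hg.1.comp_quasiMeasurePreserving (quasiMeasurePreserving_affine hp _)).const_mul _
  · have h2 := hg.2
    have e : eLpNorm (haar.ana l) 2 volume ^ 2 = eLpNorm (gen box haarMother l) 2 volume ^ 2 := by
      rw [eLpNorm_two_sq, eLpNorm_two_sq]
      exact lintegral_wavelet_sq _ _ _
    rwa [(ENNReal.pow_right_strictMono two_ne_zero).injective e]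

/-- A strictly coarser Haar function is constant on the support of the finer one, whose integral
vanishes. At equal levels the interiors of the supports either coincide or are disjoint. -/
lemma integral_ana_haar_mul_of_le {l l' : Idx} (hll : l'.1.1 ≤ l.1.1) :
    ∫ x, haar.ana l x * haar.ana l' x = if l = l' then 1 else 0 := by
  change haar.coeff (haar.ana l') l = _
  by_cases hl : l.1.1 = -1
  · have hl' : l'.1.1 = -1 := le_antisymm (hll.trans hl.le) l'.2
    rw [coeff_haar_father _ hl,
      intervalIntegral_eq_of_const (c := if l = l' then 1 else 0) (by linarith)]
    · ring
    · intro x hx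
      simp only [Generators.ana, wavelet, hl', if_true, box]
      split_ifs with h
      · subst h
        rw [Set.indicator_of_mem]; rfl
        constructor <;> linarith [hx.1, hx.2]
      · refine Set.indicator_of_notMem (fun hm => h ?_) _
        have h1 : (l'.1.2 : ℝ) < l.1.2 + 1 := by linarith [hm.1, hx.2]
        have h2 : (l.1.2 : ℝ) < l'.1.2 + 1 := by linarith [hm.2, hx.1]
        have h1' : l'.1.2 < l.1.2 + 1 := by exact_mod_cast h1
        have h2' : l.1.2 < l'.1.2 + 1 := by exact_mod_cast h2
        exact Subtype.ext (Prod.ext (hl.trans hl'.symm) (by omega))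
  · have hp : (0 : ℝ) < 2 ^ lev l := by positivity
    rw [coeff_haar_mother (locallyIntegrable_of_memLp_two (memLp_ana_haar l')) hl]
    have ham : (l.1.2 : ℝ) / 2 ^ lev l ≤ (l.1.2 + 1 / 2) / 2 ^ lev l := by gcongr; linarith
    have hmb : ((l.1.2 : ℝ) + 1 / 2) / 2 ^ lev l ≤ (l.1.2 + 1) / 2 ^ lev l := by
      gcongr; norm_num
    have hscale : ∀ {u v x : ℝ}, x ∈ Set.Ioo (u / 2 ^ lev l) (v / 2 ^ lev l) →
        u < 2 ^ lev l * x ∧ 2 ^ lev l * x < v := fun {u v x} hx => by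
      have h1 := hx.1
      have h2 := hx.2
      rw [div_lt_iff₀ hp] at h1
      rw [lt_div_iff₀ hp] at h2
      constructor <;> linarith
    rcases hll.lt_or_eq with hlt | heq
    · obtain ⟨c, hc⟩ := exists_const_ana_haar hlt
      rw [intervalIntegral_eq_of_const ham fun x hx => hc x ⟨hx.1, hx.2.trans_le hmb⟩,
        intervalIntegral_eq_of_const hmb fun x hx => hc x ⟨ham.trans_lt hx.1, hx.2⟩,
        if_neg (fun h => hlt.ne (by rw [h]))]
      field_simp; ring
    · have hl' : l'.1.1 ≠ -1 := by rwa [heq]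
      have hlev : lev l' = lev l := by unfold lev; rw [heq]
      by_cases hk : l.1.2 = l'.1.2
      · have hlleq : l = l' := Subtype.ext (Prod.ext heq.symm hk)
        subst hlleq
        rw [intervalIntegral_eq_of_const (c := Real.sqrt (2 ^ lev l)) ham,
          intervalIntegral_eq_of_const (c := -Real.sqrt (2 ^ lev l)) hmb, if_pos rfl]
        · have hs := Real.mul_self_sqrt hp.le
          calc _ = (Real.sqrt (2 ^ lev l) * Real.sqrt (2 ^ lev l)) *
                ((l.1.2 + 1) / 2 ^ lev l - (l.1.2 : ℝ) / 2 ^ lev l) := by ring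
            _ = 1 := by rw [hs]; field_simp; ring
        · intro x hx
          obtain ⟨h1, h2⟩ := hscale hx
          rw [ana_haar_eq hl, haarMother, Pi.sub_apply, Set.indicator_of_notMem,
            Set.indicator_of_mem]
          · simp
          · constructor <;> linarith
          · intro hm; linarith [hm.2]
        · intro x hx
          obtain ⟨h1, h2⟩ := hscale hx
          rw [ana_haar_eq hl, haarMother, Pi.sub_apply, Set.indicator_of_mem,
            Set.indicator_of_notMem]
          · simp
          · intro hm; linarith [hm.1]
          · constructor <;> linarith
      · have hzero : ∀ x ∈ Set.Ioo ((l.1.2 : ℝ) / 2 ^ lev l) ((l.1.2 + 1) / 2 ^ lev l),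
            haar.ana l' x = 0 := fun x hx => by
          obtain ⟨h1, h2⟩ := hscale hx
          have hnot : 2 ^ lev l * x - l'.1.2 ∉ Set.Icc (0 : ℝ) 1 := fun hm => by
            have h3 : (l'.1.2 : ℝ) < l.1.2 + 1 := by linarith [hm.1]
            have h4 : (l.1.2 : ℝ) < l'.1.2 + 1 := by linarith [hm.2]
            have h3' : l'.1.2 < l.1.2 + 1 := by exact_mod_cast h3
            have h4' : l.1.2 < l'.1.2 + 1 := by exact_mod_cast h4
            omega
          rw [ana_haar_eq hl', hlev, haarMother, Pi.sub_apply, Set.indicator_of_notMem,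
            Set.indicator_of_notMem]
          · simp
          · exact fun hm => hnot ⟨by linarith [hm.1], hm.2⟩
          · exact fun hm => hnot ⟨hm.1, by linarith [hm.2]⟩
        rw [intervalIntegral_eq_of_const ham fun x hx => hzero x ⟨hx.1, hx.2.trans_le hmb⟩,
          intervalIntegral_eq_of_const hmb fun x hx => hzero x ⟨ham.trans_lt hx.1, hx.2⟩,
          if_neg (fun h => hk (by rw [h]))]
        ring

lemma integral_ana_haar_mul (l l' : Idx) :
    ∫ x, haar.ana l x * haar.ana l' x = if l = l' then 1 else 0 := by
  rcases le_total l'.1.1 l.1.1 with h | h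
  · exact integral_ana_haar_mul_of_le h
  · simp_rw [mul_comm (haar.ana l _)]
    rw [integral_ana_haar_mul_of_le h]
    simp [eq_comm]

/-- A square integrable function all of whose Haar coefficients vanish is zero. -/
lemma ae_eq_zero_of_coeff_haar {f : ℝ → ℝ} (hf : MemLp f 2 volume)
    (h0 : ∀ l, haar.coeff f l = 0) : f =ᵐ[volume] 0 := by
  have hloc := locallyIntegrable_of_memLp_two hf
  have hint : ∀ a b : ℝ, IntervalIntegrable f volume a b := fun a b =>
    intervalIntegrable_iff.mpr <|
      (hloc.integrableOn_isCompact isCompact_uIcc).mono_set Set.uIoc_subset_uIcc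
  -- Induction on the level: a vanishing mother coefficient makes the integrals over the two halves
  -- equal, and their sum is zero by the previous level.
  have hdy : ∀ (j : ℕ) (k : ℤ), ∫ x in (k : ℝ) / 2 ^ j..(k + 1) / 2 ^ j, f x = 0 := by
    intro j
    induction j with
    | zero =>
      intro k
      have := h0 ⟨(-1, k), le_rfl⟩
      rw [coeff_haar_father f rfl] at this
      simpa using this
    | succ j ih =>
      intro k
      have hp : (0 : ℝ) < 2 ^ j := by positivity
      have key : ∀ m : ℤ, ∫ x in (m : ℝ) / 2 ^ j..(m + 1 / 2) / 2 ^ j, f x = 0 ∧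
          ∫ x in ((m : ℝ) + 1 / 2) / 2 ^ j..(m + 1) / 2 ^ j, f x = 0 := fun m => by
        have h1 := h0 ⟨((j : ℤ), m), by simp only; omega⟩
        rw [coeff_haar_mother hloc (by simp only; omega)] at h1
        simp only [lev, Int.toNat_natCast] at h1
        have h2 := intervalIntegral.integral_add_adjacent_intervals
          (hint ((m : ℝ) / 2 ^ j) ((m + 1 / 2) / 2 ^ j))
          (hint (((m : ℝ) + 1 / 2) / 2 ^ j) ((m + 1) / 2 ^ j))
        rw [ih m] at h2
        have h3 := (mul_eq_zero.1 h1).resolve_left (by positivity)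
        constructor <;> linarith
      rcases Int.even_or_odd' k with ⟨m, rfl | rfl⟩
      · convert (key m).1 using 2 <;> push_cast <;> rw [pow_succ] <;> field_simp
      · convert (key m).2 using 2 <;> push_cast <;> rw [pow_succ] <;> field_simp
        ring
  have hG : Continuous fun x => ∫ t in (0 : ℝ)..x, f t :=
    intervalIntegral.continuous_primitive hint 0
  have hdy0 : ∀ (j : ℕ) (k : ℤ), ∫ t in (0 : ℝ)..(k : ℝ) / 2 ^ j, f t = 0 := by
    intro j k
    induction k using Int.induction_on with
    | zero => simp
    | succ k ih =>
      have h2 := intervalIntegral.integral_add_adjacent_intervals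
        (hint 0 (((k : ℤ) : ℝ) / 2 ^ j)) (hint (((k : ℤ) : ℝ) / 2 ^ j) (((k : ℤ) + 1) / 2 ^ j))
      rw [ih, hdy] at h2
      push_cast at h2 ⊢
      linarith
    | pred k ih =>
      have h2 := intervalIntegral.integral_add_adjacent_intervals
        (hint 0 (((-(k : ℤ) - 1 : ℤ) : ℝ) / 2 ^ j))
        (hint (((-(k : ℤ) - 1 : ℤ) : ℝ) / 2 ^ j) ((((-(k : ℤ) - 1 : ℤ) : ℝ) + 1) / 2 ^ j))
      rw [hdy] at h2
      have e : (((-(k : ℤ) - 1 : ℤ) : ℝ) + 1) = ((-(k : ℤ) : ℤ) : ℝ) := by push_cast; ring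
      rw [e, ih] at h2
      linarith
  -- The primitive is continuous and vanishes at the dyadic rationals; Lebesgue differentiation then
  -- concludes.
  have hzero : ∀ x, ∫ t in (0 : ℝ)..x, f t = 0 := fun x => by
    have hlim : Tendsto (fun j : ℕ => ((⌊x * 2 ^ j⌋ : ℤ) : ℝ) / 2 ^ j) atTop (𝓝 x) := by
      have h1 : Tendsto (fun j : ℕ => x - (1 / 2 : ℝ) ^ j) atTop (𝓝 x) := by
        simpa using tendsto_const_nhds.sub (tendsto_pow_atTop_nhds_zero_of_lt_one
          (by norm_num : (0 : ℝ) ≤ 1 / 2) (by norm_num))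
      refine tendsto_of_tendsto_of_tendsto_of_le_of_le h1 tendsto_const_nhds
        (fun j => ?_) (fun j => ?_)
      · change x - (1 / 2 : ℝ) ^ j ≤ _
        have hp : (0 : ℝ) < 2 ^ j := by positivity
        rw [le_div_iff₀ hp, sub_mul, ← mul_pow]
        norm_num
        exact (Int.lt_floor_add_one (x * 2 ^ j)).le
      · have hp : (0 : ℝ) < 2 ^ j := by positivity
        change _ / _ ≤ x
        rw [div_le_iff₀ hp]
        exact Int.floor_le _
    have h1 := (hG.tendsto x).comp hlim
    refine tendsto_nhds_unique h1 ?_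
    simp only [Function.comp_def, hdy0]
    exact tendsto_const_nhds
  filter_upwards [_root_.LocallyIntegrable.ae_hasDerivAt_integral hloc] with x hx
  have := hx 0
  simp_rw [hzero] at this
  exact this.unique (hasDerivAt_const x 0)

/-- The orthonormal Haar family has trivial orthogonal complement, so it is a Hilbert basis. -/
lemma expansion_haar {f : ℝ → ℝ} (hf : MemLp f 2 volume) :
    Tendsto (fun S : Finset Idx =>
      eLpNorm (fun x => f x - ∑ l ∈ S, haar.coeff f l * haar.ana l x) 2 volume) atTop (𝓝 0) := by
  let a : Idx → Lp ℝ 2 (volume : Measure ℝ) := fun l => (memLp_ana_haar l).toLp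
  have hinner : ∀ (l : Idx) {g : ℝ → ℝ} (hg : MemLp g 2 volume),
      (inner ℝ (a l) hg.toLp : ℝ) = haar.coeff g l := fun l g hg => inner_toLp_eq_integral _ hg
  have hon : Orthonormal ℝ a := by
    classical
    rw [orthonormal_iff_ite]
    intro i j
    rw [hinner i (memLp_ana_haar j)]
    exact integral_ana_haar_mul i j
  have hbot : (Submodule.span ℝ (Set.range a))ᗮ = ⊥ := by
    rw [Submodule.eq_bot_iff]
    intro x hx
    have h1 : ∀ l, haar.coeff x l = 0 := fun l => by
      rw [← hinner l (Lp.memLp x), Lp.toLp_coeFn]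
      exact (Submodule.mem_orthogonal _ _).1 hx _ (Submodule.subset_span ⟨l, rfl⟩)
    exact (Lp.eq_zero_iff_ae_eq_zero).2 (ae_eq_zero_of_coeff_haar (Lp.memLp x) h1)
  have h2 := (HilbertBasis.mkOfOrthogonalEqBot hon hbot).hasSum_repr hf.toLp
  simp only [HilbertBasis.repr_apply_apply, HilbertBasis.coe_mkOfOrthogonalEqBot,
    hinner _ hf] at h2
  exact (hasSum_toLp_iff memLp_ana_haar _ hf).1 h2

/-- The shifted and the original indicator can differ only within |u| of one of the two endpoints.
-/
lemma lintegral_indicator_Icc_sub_sq_le (a b u : ℝ) :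
    ∫⁻ x, ENNReal.ofReal (((Set.Icc a b).indicator (1 : ℝ → ℝ) (x + u) -
      (Set.Icc a b).indicator (1 : ℝ → ℝ) x) ^ 2) ≤ ENNReal.ofReal (4 * |u|) := by
  have hu := neg_abs_le u
  have hu' := le_abs_self u
  calc _ ≤ ∫⁻ x, ((Set.Icc (a - |u|) (a + |u|)).indicator (fun _ => (1 : ℝ≥0∞)) x +
        (Set.Icc (b - |u|) (b + |u|)).indicator (fun _ => (1 : ℝ≥0∞)) x) := by
        refine lintegral_mono fun x => ?_
        by_cases h : x ∈ Set.Icc (a - |u|) (a + |u|) ∨ x ∈ Set.Icc (b - |u|) (b + |u|)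
        · have h1 : ENNReal.ofReal (((Set.Icc a b).indicator (1 : ℝ → ℝ) (x + u) -
              (Set.Icc a b).indicator (1 : ℝ → ℝ) x) ^ 2) ≤ 1 := by
            rw [ENNReal.ofReal_le_one]
            by_cases h1 : x + u ∈ Set.Icc a b <;> by_cases h2 : x ∈ Set.Icc a b <;>
              simp [h1, h2]
          refine h1.trans ?_
          rcases h with h | h
          · rw [Set.indicator_of_mem h]; exact le_self_add
          · rw [Set.indicator_of_mem h]; exact le_add_self
        · have : x + u ∈ Set.Icc a b ↔ x ∈ Set.Icc a b := by
            simp only [Set.mem_Icc, not_or, not_and_or, not_le] at h ⊢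
            constructor
            · rintro ⟨h1, h2⟩
              constructor
              · rcases h.1 with h3 | h3 <;> linarith
              · rcases h.2 with h3 | h3 <;> linarith
            · rintro ⟨h1, h2⟩
              constructor
              · rcases h.1 with h3 | h3 <;> linarith
              · rcases h.2 with h3 | h3 <;> linarith
          by_cases h2 : x ∈ Set.Icc a b
          · simp [h2, this.2 h2]
          · simp [h2, mt this.1 h2]
    _ = ENNReal.ofReal (2 * |u|) + ENNReal.ofReal (2 * |u|) := by
        rw [lintegral_add_left (measurable_const.indicator measurableSet_Icc),
          lintegral_indicator_const measurableSet_Icc, lintegral_indicator_const measurableSet_Icc,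
          Real.volume_Icc, Real.volume_Icc, one_mul, one_mul]
        congr 2 <;> ring
    _ = _ := by
        rw [← ENNReal.ofReal_add (by positivity) (by positivity)]
        congr 1; ring

lemma lintegral_haarMother_sub_sq_le (u : ℝ) :
    ∫⁻ x, ENNReal.ofReal ((haarMother (x + u) - haarMother x) ^ 2) ≤
      ENNReal.ofReal (16 * |u|) := by
  let g₁ : ℝ → ℝ := (Set.Icc (0 : ℝ) (1 / 2)).indicator 1
  let g₂ : ℝ → ℝ := (Set.Icc (1 / 2 : ℝ) 1).indicator 1
  have hm : Measurable fun x => ENNReal.ofReal 2 * ENNReal.ofReal ((g₁ (x + u) - g₁ x) ^ 2) := by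
    have : Measurable g₁ := measurable_one.indicator measurableSet_Icc
    fun_prop
  calc _ ≤ ∫⁻ x, (ENNReal.ofReal 2 * ENNReal.ofReal ((g₁ (x + u) - g₁ x) ^ 2) +
        ENNReal.ofReal 2 * ENNReal.ofReal ((g₂ (x + u) - g₂ x) ^ 2)) := by
        refine lintegral_mono fun x => ?_
        rw [← ENNReal.ofReal_mul two_pos.le, ← ENNReal.ofReal_mul two_pos.le,
          ← ENNReal.ofReal_add (by positivity) (by positivity)]
        refine ENNReal.ofReal_le_ofReal ?_
        change (g₁ (x + u) - g₂ (x + u) - (g₁ x - g₂ x)) ^ 2 ≤ _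
        nlinarith [sq_nonneg ((g₁ (x + u) - g₁ x) + (g₂ (x + u) - g₂ x))]
    _ ≤ ENNReal.ofReal 2 * ENNReal.ofReal (4 * |u|) +
        ENNReal.ofReal 2 * ENNReal.ofReal (4 * |u|) := by
        rw [lintegral_add_left hm, lintegral_const_mul' _ _ ENNReal.ofReal_ne_top,
          lintegral_const_mul' _ _ ENNReal.ofReal_ne_top]
        gcongr
        · exact lintegral_indicator_Icc_sub_sq_le _ _ u
        · exact lintegral_indicator_Icc_sub_sq_le _ _ u
    _ = _ := by
        rw [← ENNReal.ofReal_mul two_pos.le, ← ENNReal.ofReal_add (by positivity) (by positivity)]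
        congr 1; ring

theorem isAdmissible_haar : IsAdmissible haar where
  measurable_ψ := measurable_haarMother
  finite_range_ψ := by
    refine (Set.toFinite {0, 1, -1}).subset ?_
    rintro _ ⟨x, rfl⟩
    simp only [haar, haarMother, Pi.sub_apply]
    by_cases h1 : x ∈ Set.Icc (0 : ℝ) (1 / 2) <;> by_cases h2 : x ∈ Set.Icc (1 / 2 : ℝ) 1 <;>
      simp only [Set.indicator_of_mem, Set.indicator_of_notMem, h1, h2, not_false_eq_true] <;> simp
  exists_support := by
    refine ⟨1, le_rfl, fun x hx => ?_⟩
    have h1 : haarMother x = 0 := by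
      rw [haarMother, Pi.sub_apply, Set.indicator_of_notMem, Set.indicator_of_notMem, sub_zero]
      · intro h
        rw [abs_of_nonneg (by linarith [h.1])] at hx
        linarith [h.2]
      · intro h
        rw [abs_of_nonneg h.1] at hx
        linarith [h.2]
    exact ⟨h1, box_eq_zero hx, h1⟩
  memLp_φd := memLp_box
  memLp_ψd := memLp_haarMother
  modulus_φd := ⟨4, by norm_num, lintegral_indicator_Icc_sub_sq_le 0 1⟩
  modulus_ψd := ⟨16, by norm_num, lintegral_haarMother_sub_sq_le⟩
  biorthogonal := integral_ana_haar_mul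
  expansion := fun _ hf => expansion_haar hf

theorem IsWaveletBasis.isAdmissible {Φ : Generators} (h : IsWaveletBasis Φ) : IsAdmissible Φ := by
  rcases h with h | rfl
  · exact h.isAdmissible
  · exact isAdmissible_haar

end Haar

/-! ### Large values of integrals against a Poisson process -/

section LargeValues

variable {Ω : Type*} [MeasurableSpace Ω] {P : Measure Ω} {N : Ω → Set ℝ} {ν : Measure ℝ}

lemma sq_le_two_mul_exp {x : ℝ} (hx : 0 ≤ x) : x ^ 2 ≤ 2 * Real.exp x := by
  have := Real.quadratic_le_exp_of_nonneg hx
  nlinarith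

/-- Truncated second moment of a variable with an exponential moment. -/
lemma setLIntegral_sq_le {X : Ω → ℝ} {s y B : ℝ} (hs : 0 < s)
    (hB : ∫⁻ ω, ENNReal.ofReal (Real.exp (s * |X ω|)) ∂P ≤ ENNReal.ofReal B) (A : Set Ω) :
    ∫⁻ ω in A, ENNReal.ofReal (X ω ^ 2) ∂P ≤
      ENNReal.ofReal (y ^ 2) * P A +
        ENNReal.ofReal (8 / s ^ 2 * Real.exp (-(s * y / 2)) * B) := by
  have hpt : ∀ ω, ENNReal.ofReal (X ω ^ 2) ≤ ENNReal.ofReal (y ^ 2) +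
      ENNReal.ofReal (8 / s ^ 2 * Real.exp (-(s * y / 2))) *
        ENNReal.ofReal (Real.exp (s * |X ω|)) := fun ω => by
    rw [← ENNReal.ofReal_mul (by positivity), ← ENNReal.ofReal_add (by positivity) (by positivity)]
    refine ENNReal.ofReal_le_ofReal ?_
    rcases le_total |X ω| y with h | h
    · have h1 : X ω ^ 2 ≤ y ^ 2 := by rw [← sq_abs]; gcongr
      have : 0 ≤ 8 / s ^ 2 * Real.exp (-(s * y / 2)) * Real.exp (s * |X ω|) := by positivity
      linarith
    -- Beyond `y`, half of the exponential moment absorbs the square and the other half pays the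
    -- factor exp(-sy/2).
    · have h1 := sq_le_two_mul_exp (x := s * |X ω| / 2) (by positivity)
      have h2 : X ω ^ 2 ≤ 8 / s ^ 2 * Real.exp (s * |X ω| / 2) := by
        rw [← sq_abs, div_mul_eq_mul_div, le_div_iff₀ (by positivity)]
        nlinarith
      have h3 : Real.exp (s * |X ω| / 2) ≤ Real.exp (-(s * y / 2)) * Real.exp (s * |X ω|) := by
        rw [← Real.exp_add]
        refine Real.exp_le_exp.2 ?_
        nlinarith
      calc X ω ^ 2 ≤ 8 / s ^ 2 * Real.exp (s * |X ω| / 2) := h2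
        _ ≤ 8 / s ^ 2 * (Real.exp (-(s * y / 2)) * Real.exp (s * |X ω|)) := by gcongr
        _ ≤ _ := by rw [← mul_assoc]; exact le_add_of_nonneg_left (sq_nonneg y)
  calc _ ≤ ∫⁻ ω in A, (ENNReal.ofReal (y ^ 2) +
        ENNReal.ofReal (8 / s ^ 2 * Real.exp (-(s * y / 2))) *
          ENNReal.ofReal (Real.exp (s * |X ω|))) ∂P := lintegral_mono hpt
    _ = ENNReal.ofReal (y ^ 2) * P A + ENNReal.ofReal (8 / s ^ 2 * Real.exp (-(s * y / 2))) *
        ∫⁻ ω in A, ENNReal.ofReal (Real.exp (s * |X ω|)) ∂P := by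
      rw [lintegral_add_left measurable_const, setLIntegral_const,
        lintegral_const_mul' _ _ ENNReal.ofReal_ne_top]
    _ ≤ _ := by
      gcongr
      rw [ENNReal.ofReal_mul (q := B) (by positivity)]
      gcongr
      exact (setLIntegral_le_lintegral _ _).trans hB

/-- Follows from x² + 1 ≤ exp(x). The summand 1 is what later subtracts 1 from the exponential
moment. -/
lemma sq_mul_exp_add_one_le {x : ℝ} (hx : 0 ≤ x) :
    x ^ 2 * Real.exp (2 * x) + 1 ≤ Real.exp (3 * x) := by
  have h1 : x ^ 2 + 1 ≤ Real.exp x := by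
    have := Real.sum_le_exp_of_nonneg hx 4
    norm_num [Finset.sum_range_succ, Nat.factorial] at this
    nlinarith [mul_nonneg hx (sq_nonneg (x - 3 / 2))]
  have h2 : 1 ≤ Real.exp (2 * x) := Real.one_le_exp (by positivity)
  have h3 : Real.exp (3 * x) = Real.exp (2 * x) * Real.exp x := by
    rw [← Real.exp_add]; congr 1; ring
  rw [h3]
  nlinarith

namespace IsPoissonProcess

variable (h : IsPoissonProcess P N ν) [IsFiniteMeasure ν]
include h

/-- An empty `A` contributes nothing to the left side, and the term -1 records this: the bound is
linear in the expected count when that is small. Without it the remainders could not be summed over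
infinitely many wavelets. -/
lemma lintegral_sq_mul_exp_sumOver_indicator_le {A : Set ℝ} (hA : MeasurableSet A) :
    ∫⁻ ω, ENNReal.ofReal (sumOver (N ω) (A.indicator 1) ^ 2 *
        Real.exp (2 * sumOver (N ω) (A.indicator 1))) ∂P ≤
      ENNReal.ofReal (Real.exp ((Real.exp 3 - 1) * ν.real A) - 1) := by
  classical
  have hP := h.isProbabilityMeasure
  have hfin : (Set.range (A.indicator (1 : ℝ → ℝ))).Finite := by
    refine (Set.toFinite {0, 1}).subset ?_
    rintro _ ⟨x, rfl⟩
    by_cases hx : x ∈ A <;> simp [hx]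
  have hm : Measurable (A.indicator (1 : ℝ → ℝ)) := measurable_one.indicator hA
  have hE : ∫⁻ ω, ENNReal.ofReal (Real.exp (3 * sumOver (N ω) (A.indicator 1))) ∂P ≤
      ENNReal.ofReal (Real.exp ((Real.exp 3 - 1) * ν.real A)) := by
    simp_rw [← sumOver_const_mul]
    refine h.lintegral_exp_sumOver_comp_le hm hfin (F := fun y => 3 * y)
      (G := fun y => (Real.exp 3 - 1) * y) (by fun_prop) (by fun_prop) ?_ ?_
    · refine Eventually.of_forall fun x => ?_
      by_cases hx : x ∈ A <;> simp [hx]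
    · rw [integral_const_mul, integral_indicator_one hA]
  have hpt : ∀ ω, ENNReal.ofReal (sumOver (N ω) (A.indicator 1) ^ 2 *
        Real.exp (2 * sumOver (N ω) (A.indicator 1))) + 1 ≤
      ENNReal.ofReal (Real.exp (3 * sumOver (N ω) (A.indicator 1))) := fun ω => by
    rw [← ENNReal.ofReal_one, ← ENNReal.ofReal_add (by positivity) one_pos.le]
    refine ENNReal.ofReal_le_ofReal (sq_mul_exp_add_one_le (tsum_nonneg fun x => ?_))
    exact Set.indicator_nonneg (fun _ _ => zero_le_one) _
  have h2 := (lintegral_mono hpt).trans hE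
  rw [lintegral_add_right _ measurable_const, lintegral_const, measure_univ, one_mul] at h2
  rw [ENNReal.ofReal_sub _ one_pos.le, ENNReal.ofReal_one]
  exact ENNReal.le_sub_of_add_le_right ENNReal.one_ne_top h2

end IsPoissonProcess

end LargeValues

/-! ### The mean measure of the observed process -/

section MeanMeasure

variable {f : ℝ → ℝ} (hf : f ∈ intensities)
include hf

lemma integrable_of_mem_intensities : Integrable f volume := memLp_one_iff_integrable.1 hf.2.1

lemma isFiniteMeasure_meanMeasure (n : ℕ) : IsFiniteMeasure (meanMeasure n f) :=
  isFiniteMeasure_withDensity_ofReal ((integrable_of_mem_intensities hf).const_mul (n : ℝ)).2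

omit hf in
lemma meanMeasure_absolutelyContinuous (n : ℕ) (f : ℝ → ℝ) : meanMeasure n f ≪ volume :=
  withDensity_absolutelyContinuous _ _

lemma integral_meanMeasure (n : ℕ) (g : ℝ → ℝ) :
    ∫ x, g x ∂meanMeasure n f = n * ∫ x, g x * f x := by
  have hm : AEMeasurable (fun x => ENNReal.ofReal (n * f x)) volume :=
    ((integrable_of_mem_intensities hf).1.aemeasurable.const_mul (n : ℝ)).ennreal_ofReal
  rw [meanMeasure, integral_withDensity_eq_integral_toReal_smul₀ hm
    (Eventually.of_forall fun x => ENNReal.ofReal_lt_top), ← integral_const_mul]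
  refine integral_congr_ae ?_
  filter_upwards [hf.1] with x hx
  rw [ENNReal.toReal_ofReal (by positivity), smul_eq_mul]
  ring

end MeanMeasure

/-! ### Moments of the analysis functions -/

section Moments

variable {Φ : Generators} {f : ℝ → ℝ}

lemma sigma_sq (hf : f ∈ intensities) (l : Idx) :
    sigma Φ f l ^ 2 = ∫ x, Φ.ana l x ^ 2 * f x := by
  refine Real.sq_sqrt (integral_nonneg_of_ae ?_)
  filter_upwards [hf.1] with x hx
  exact mul_nonneg (sq_nonneg _) hx

lemma sigma_nonneg (l : Idx) : 0 ≤ sigma Φ f l := Real.sqrt_nonneg _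

lemma integral_ana_meanMeasure (hf : f ∈ intensities) (n : ℕ) (l : Idx) :
    ∫ x, Φ.ana l x ∂meanMeasure n f = n * Φ.coeff f l := integral_meanMeasure hf n _

lemma integral_ana_sq_meanMeasure (hf : f ∈ intensities) (n : ℕ) (l : Idx) :
    ∫ x, Φ.ana l x ^ 2 ∂meanMeasure n f = n * sigma Φ f l ^ 2 := by
  rw [sigma_sq hf, integral_meanMeasure hf n (fun x => Φ.ana l x ^ 2)]

namespace IsAdmissible

variable (hΦ : IsAdmissible Φ)
include hΦ

lemma abs_ana_ae_le_meanMeasure (n : ℕ) (f : ℝ → ℝ) (l : Idx) :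
    ∀ᵐ x ∂meanMeasure n f, |Φ.ana l x| ≤ supNorm Φ l :=
  (meanMeasure_absolutelyContinuous n f).ae_le (hΦ.abs_ana_ae_le l)

lemma measurableSet_support (l : Idx) : MeasurableSet {x | Φ.ana l x ≠ 0} :=
  (hΦ.measurable_ana l) (measurableSet_singleton (0 : ℝ)).compl

/-- The expected number of points in the support of a wavelet controls its coefficient. -/
lemma abs_coeff_le (hf : f ∈ intensities) (n : ℕ) (l : Idx) :
    n * |Φ.coeff f l| ≤ supNorm Φ l * (meanMeasure n f).real {x | Φ.ana l x ≠ 0} := by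
  have := isFiniteMeasure_meanMeasure hf n
  rw [← abs_of_nonneg (Nat.cast_nonneg (α := ℝ) n), ← abs_mul, ← integral_ana_meanMeasure hf]
  refine (abs_integral_le_integral_abs).trans ?_
  rw [mul_comm, ← smul_eq_mul, ← integral_indicator_const _ (hΦ.measurableSet_support l)]
  refine integral_mono_ae ?_ ?_ ?_
  · exact (integrable_of_finite_range (hΦ.measurable_ana l) (hΦ.finite_range_ana l)).abs
  · exact (integrable_const _).indicator (hΦ.measurableSet_support l)
  · filter_upwards [hΦ.abs_ana_ae_le_meanMeasure n f l] with x hx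
    by_cases h0 : Φ.ana l x = 0
    · simp [h0]
    · rw [Set.indicator_of_mem (by exact h0)]; exact hx

/-- Because the nonzero values of φ_λ are comparable to its supremum norm, the variance bounds the
expected number of points in the support. -/
lemma measure_support_le (hf : f ∈ intensities) (n : ℕ) (l : Idx) {q : ℝ} (hq : 0 < q)
    (hlow : ∀ x, Φ.ana l x ≠ 0 → q * supNorm Φ l ≤ |Φ.ana l x|) :
    (q * supNorm Φ l) ^ 2 * (meanMeasure n f).real {x | Φ.ana l x ≠ 0} ≤
      n * sigma Φ f l ^ 2 := by
  have := isFiniteMeasure_meanMeasure hf n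
  rw [← integral_ana_sq_meanMeasure hf, mul_comm, ← smul_eq_mul,
    ← integral_indicator_const _ (hΦ.measurableSet_support l)]
  refine integral_mono_ae ?_ ?_ ?_
  · exact (integrable_const _).indicator (hΦ.measurableSet_support l)
  · exact integrable_of_finite_range ((hΦ.measurable_ana l).pow_const 2)
      (finite_range_comp (hΦ.finite_range_ana l) fun y => y ^ 2)
  · refine Eventually.of_forall fun x => ?_
    by_cases h0 : Φ.ana l x = 0
    · simp [h0]
    · change Set.indicator _ _ _ ≤ Φ.ana l x ^ 2
      rw [Set.indicator_of_mem (by exact h0), ← sq_abs (Φ.ana l x)]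
      have := hΦ.supNorm_pos l
      gcongr
      exact hlow x h0

end IsAdmissible

end Moments

/-! ### The risk of a single thresholded coefficient -/

section SingleCoefficient

/-- Solving the quadratic inequality in √V gives √V ≤ √W + √(2d). This inversion of the lower tail
bound accounts for the shape of `varTilde`. -/
lemma le_add_sqrt_add_of_sub_sqrt_lt {V W d : ℝ} (hV : 0 ≤ V) (hW : 0 ≤ W) (hd : 0 ≤ d)
    (h : V - Real.sqrt (2 * d * V) < W) : V ≤ W + Real.sqrt (2 * d * W) + 3 * d := by
  rw [Real.sqrt_mul (by positivity)] at h ⊢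
  set e := Real.sqrt (2 * d) with he
  have he2 : e ^ 2 = 2 * d := Real.sq_sqrt (by positivity)
  have he0 : 0 ≤ e := Real.sqrt_nonneg _
  set x := Real.sqrt V with hx
  have hx2 : x ^ 2 = V := Real.sq_sqrt hV
  have hx0 : 0 ≤ x := Real.sqrt_nonneg _
  set y := Real.sqrt W with hy
  have hy2 : y ^ 2 = W := Real.sq_sqrt hW
  have hy0 : 0 ≤ y := Real.sqrt_nonneg _
  have h1 : x ≤ y + e := by
    by_contra hc
    push Not at hc
    nlinarith
  nlinarith

/-- If the coefficient is kept, then |b| ≥ (1 - κ)η; if it is killed, then |b| ≤ 2η. In both cases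
the error is controlled by |b| and by η. The strict inequality κ < 1 is where γ' < γ is spent. -/
lemma sq_threshold_sub_le {b bh η κ : ℝ} (hκ : κ < 1) (hη : 0 ≤ η)
    (hZ : |bh - b| ≤ κ * η) [Decidable (η ≤ |bh|)] :
    ((if η ≤ |bh| then bh else 0) - b) ^ 2 ≤ (4 + 1 / (1 - κ) ^ 2) * min (b ^ 2) (η ^ 2) := by
  have hκ1 : 0 < 1 - κ := by linarith
  have hZ1 : |bh - b| ≤ η := by nlinarith
  have htri : |bh| ≤ |b| + |bh - b| := by
    have := abs_add_le b (bh - b); simpa using this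
  have htri2 : |b| ≤ |bh| + |bh - b| := by
    have := abs_sub bh (bh - b); simpa using this
  rw [mul_min_of_nonneg _ _ (by positivity)]
  have hinv : 0 ≤ 1 / (1 - κ) ^ 2 := by positivity
  split_ifs with hk
  · have h1 : (1 - κ) * η ≤ |b| := by linarith
    have h2 : (bh - b) ^ 2 ≤ η ^ 2 := by rw [← sq_abs]; gcongr
    refine le_min (h2.trans ?_) (h2.trans (by nlinarith [sq_nonneg η]))
    have h3 : ((1 - κ) * η) ^ 2 ≤ b ^ 2 := by rw [← sq_abs b]; gcongr
    have h4 : η ^ 2 ≤ 1 / (1 - κ) ^ 2 * b ^ 2 := by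
      rw [div_mul_eq_mul_div, le_div_iff₀ (by positivity)]; nlinarith
    nlinarith [sq_nonneg b]
  · push Not at hk
    have h1 : |b| ≤ 2 * η := by linarith
    have h2 : b ^ 2 ≤ (2 * η) ^ 2 := by rw [← sq_abs]; gcongr
    rw [zero_sub, neg_sq]
    refine le_min (by nlinarith [sq_nonneg b]) (by nlinarith [sq_nonneg η])

variable {Φ : Generators} {γ : ℝ} {n : ℕ}

lemma varHat_nonneg (N : Set ℝ) (l : Idx) : 0 ≤ varHat Φ n N l :=
  mul_nonneg (by positivity) (tsum_nonneg fun _ => sq_nonneg _)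

lemma varTilde_nonneg (hγ : 0 ≤ γ) (N : Set ℝ) (l : Idx) : 0 ≤ varTilde Φ γ n N l := by
  have h1 := varHat_nonneg (Φ := Φ) (n := n) N l
  have h2 : 0 ≤ Real.log n := Real.log_natCast_nonneg n
  unfold varTilde
  positivity

/-- The deterministic part of the variance estimate; it keeps the threshold away from 0 even when
few points are observed. -/
lemma three_mul_le_varTilde (N : Set ℝ) (l : Idx) :
    3 * γ * Real.log n * (supNorm Φ l ^ 2 / (n : ℝ) ^ 2) ≤ varTilde Φ γ n N l := by
  have h1 := varHat_nonneg (Φ := Φ) (n := n) N l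
  unfold varTilde
  have := Real.sqrt_nonneg (2 * γ * Real.log n * varHat Φ n N l * (supNorm Φ l ^ 2 / (n : ℝ) ^ 2))
  linarith

lemma supNorm_nonneg (l : Idx) : 0 ≤ supNorm Φ l := ENNReal.toReal_nonneg

lemma threshold_nonneg (hγ : 0 ≤ γ) (N : Set ℝ) (l : Idx) : 0 ≤ threshold Φ γ n N l := by
  have h2 : 0 ≤ Real.log n := Real.log_natCast_nonneg n
  have h3 := supNorm_nonneg (Φ := Φ) l
  unfold threshold
  positivity

lemma coeffTilde_eq_of_mem {J : ℤ} {l : Idx} (hl : l ∈ levels J) (N : Set ℝ)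
    [Decidable (threshold Φ γ n N l ≤ |coeffHat Φ n N l|)] :
    coeffTilde Φ γ n N J l =
      if threshold Φ γ n N l ≤ |coeffHat Φ n N l| then coeffHat Φ n N l else 0 := by
  unfold coeffTilde
  by_cases h : threshold Φ γ n N l ≤ |coeffHat Φ n N l| <;> simp [h, hl]

variable {Ω : Type*} [MeasurableSpace Ω] {P : Measure Ω} {N : Ω → Set ℝ}
  (hΦ : IsAdmissible Φ) {f : ℝ → ℝ} (hf : f ∈ intensities)
  (h : IsPoissonProcess P N (meanMeasure n f))
include hΦ hf h

lemma aemeasurable_sumOver_ana (l : Idx) : AEMeasurable (fun ω => sumOver (N ω) (Φ.ana l)) P :=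
  have := isFiniteMeasure_meanMeasure hf n
  h.aemeasurable_sumOver (measure_ne_top _ _) (hΦ.measurable_ana l) (hΦ.finite_range_ana l)

lemma aemeasurable_sumOver_ana_sq (l : Idx) :
    AEMeasurable (fun ω => sumOver (N ω) fun x => Φ.ana l x ^ 2) P :=
  have := isFiniteMeasure_meanMeasure hf n
  h.aemeasurable_sumOver (measure_ne_top _ _) ((hΦ.measurable_ana l).pow_const 2)
    (finite_range_comp (hΦ.finite_range_ana l) fun y => y ^ 2)

lemma aemeasurable_coeffHat (l : Idx) : AEMeasurable (fun ω => coeffHat Φ n (N ω) l) P :=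
  (aemeasurable_sumOver_ana hΦ hf h l).const_mul _

lemma aemeasurable_varHat (l : Idx) : AEMeasurable (fun ω => varHat Φ n (N ω) l) P :=
  (aemeasurable_sumOver_ana_sq hΦ hf h l).const_mul _

lemma aemeasurable_threshold (l : Idx) : AEMeasurable (fun ω => threshold Φ γ n (N ω) l) P := by
  have hv := aemeasurable_varHat hΦ hf h l
  let F : ℝ → ℝ := fun y => Real.sqrt (2 * γ * (y
    + Real.sqrt (2 * γ * Real.log n * y * (supNorm Φ l ^ 2 / (n : ℝ) ^ 2))
    + 3 * γ * Real.log n * (supNorm Φ l ^ 2 / (n : ℝ) ^ 2)) * Real.log n)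
    + γ * Real.log n / (3 * n) * supNorm Φ l
  have hF : Measurable F := by fun_prop
  exact hF.comp_aemeasurable hv

lemma aemeasurable_coeffTilde (J : ℤ) (l : Idx) :
    AEMeasurable (fun ω => coeffTilde Φ γ n (N ω) J l) P := by
  classical
  by_cases hl : l ∈ levels J
  · have hη := aemeasurable_threshold (γ := γ) hΦ hf h l
    have hb := aemeasurable_coeffHat hΦ hf h l
    let F : ℝ × ℝ → ℝ := fun p => if p.1 ≤ |p.2| then p.2 else 0
    have hF : Measurable F :=
      Measurable.ite (measurableSet_le measurable_fst (by fun_prop)) measurable_snd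
        measurable_const
    refine (hF.comp_aemeasurable (hη.prodMk hb)).congr (Eventually.of_forall fun ω => ?_)
    simp only [F, Function.comp]
    rw [coeffTilde_eq_of_mem hl]
  · have : (fun ω => coeffTilde Φ γ n (N ω) J l) = fun _ => 0 := by
      funext ω; simp [coeffTilde, hl]
    rw [this]; exact aemeasurable_const

lemma aemeasurable_coeffTilde_sub_sq (J : ℤ) (l : Idx) (b : ℝ) :
    AEMeasurable (fun ω => ENNReal.ofReal ((coeffTilde Φ γ n (N ω) J l - b) ^ 2)) P :=
  (((aemeasurable_coeffTilde hΦ hf h J l).sub_const b).pow_const 2).ennreal_ofReal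

/-- The overestimated variance is larger than the variance with high probability. -/
lemma measure_varTilde_lt_le (hn : 2 ≤ n) (hγ : 0 ≤ γ) (l : Idx) :
    P {ω | varTilde Φ γ n (N ω) l < sigma Φ f l ^ 2 / n} ≤
      ENNReal.ofReal (Real.exp (-(γ * Real.log n))) := by
  have := isFiniteMeasure_meanMeasure hf n
  have hn0 : (0 : ℝ) < n := by positivity
  have hlog : 0 ≤ Real.log n := Real.log_natCast_nonneg n
  have hu : 0 ≤ γ * Real.log n := by positivity
  have hM := hΦ.supNorm_pos l
  rcases (sq_nonneg (sigma Φ f l)).eq_or_lt with h0 | hpos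
  · rw [← h0, zero_div]
    have : {ω | varTilde Φ γ n (N ω) l < 0} = ∅ := by
      ext ω; simp [varTilde_nonneg hγ (N ω) l]
    rw [this]; simp
  · have hv : ∫ x, Φ.ana l x ^ 2 ∂meanMeasure n f = n * sigma Φ f l ^ 2 :=
      integral_ana_sq_meanMeasure hf n l
    have hT := h.measure_sumOver_sq_le_le (hΦ.measurable_ana l) (hΦ.finite_range_ana l)
      (hΦ.abs_ana_ae_le_meanMeasure n f l) hM hu (by rw [hv]; positivity)
    refine (measure_mono fun ω hω => ?_).trans hT
    simp only [Set.mem_ofPred_eq] at hω ⊢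
    rw [hv]
    by_contra hc
    push Not at hc
    refine absurd hω (not_lt.2 ?_)
    have hd : 0 ≤ γ * Real.log n * (supNorm Φ l ^ 2 / (n : ℝ) ^ 2) := by positivity
    have key := le_add_sqrt_add_of_sub_sqrt_lt (V := sigma Φ f l ^ 2 / n)
      (W := varHat Φ n (N ω) l) (d := γ * Real.log n * (supNorm Φ l ^ 2 / (n : ℝ) ^ 2))
      (by positivity) (varHat_nonneg _ _) hd ?_
    · unfold varTilde
      refine key.trans (le_of_eq ?_)
      congr 1
      · congr 2; ring
      · ring
    · have e1 : 2 * (γ * Real.log n * (supNorm Φ l ^ 2 / (n : ℝ) ^ 2)) *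
          (sigma Φ f l ^ 2 / n) =
          2 * (γ * Real.log n) * supNorm Φ l ^ 2 * (n * sigma Φ f l ^ 2) / ((n : ℝ) ^ 2) ^ 2 := by
        field_simp
      rw [e1, Real.sqrt_div' _ (by positivity), Real.sqrt_sq (by positivity), varHat,
        div_sub' hn0.ne']
      have e2 : 1 / (n : ℝ) ^ 2 * sumOver (N ω) (fun x => Φ.ana l x ^ 2) =
        sumOver (N ω) (fun x => Φ.ana l x ^ 2) / n ^ 2 := by ring
      rw [e2, div_lt_div_iff₀ hn0 (by positivity)]
      have e3 : (n : ℝ) * (√(2 * (γ * Real.log n) * supNorm Φ l ^ 2 * (n * sigma Φ f l ^ 2)) /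
          n ^ 2) = √(2 * (γ * Real.log n) * supNorm Φ l ^ 2 * (n * sigma Φ f l ^ 2)) / n := by
        field_simp
      rw [e3]
      have e4 : (sigma Φ f l ^ 2 - √(2 * (γ * Real.log n) * supNorm Φ l ^ 2 *
          (n * sigma Φ f l ^ 2)) / n) * n ^ 2 = (n * sigma Φ f l ^ 2 -
          √(2 * (γ * Real.log n) * supNorm Φ l ^ 2 * (n * sigma Φ f l ^ 2))) * n := by
        field_simp
      rw [e4]
      gcongr

/-- Thresholding loses a small coefficient with probability at least one half. -/
theorem sq_coeff_le_lintegral (hn : 2 ≤ n) (hγ : 1 ≤ γ) (J : ℤ) (l : Idx)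
    (hsmall : |Φ.coeff f l| ≤ sigma Φ f l * (Real.sqrt (2 * γ * Real.log n / n) / 2)) :
    ENNReal.ofReal (Φ.coeff f l ^ 2) ≤
      2 * ∫⁻ ω, ENNReal.ofReal ((coeffTilde Φ γ n (N ω) J l - Φ.coeff f l) ^ 2) ∂P := by
  classical
  have hP := h.isProbabilityMeasure
  have hn0 : (0 : ℝ) < n := by positivity
  have hn2 : (2 : ℝ) ≤ n := by exact_mod_cast hn
  have hlog : 0 ≤ Real.log n := Real.log_natCast_nonneg n
  have hγ0 : 0 ≤ γ := zero_le_one.trans hγ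
  set β := Φ.coeff f l
  let G : Set Ω := {ω | sigma Φ f l ^ 2 / n ≤ varTilde Φ γ n (N ω) l}
  have hG : ∀ ω ∈ G, ENNReal.ofReal (β ^ 2) ≤
      ENNReal.ofReal ((coeffTilde Φ γ n (N ω) J l - β) ^ 2) := fun ω hω => by
    refine ENNReal.ofReal_le_ofReal ?_
    -- If kept, the estimate has modulus at least 2|β| and so is at distance at least |β| from β. If
    -- killed, the error is exactly |β|.
    by_cases hk : threshold Φ γ n (N ω) l ≤ |coeffHat Φ n (N ω) l| ∧ l ∈ levels J
    · rw [coeffTilde, if_pos hk]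
      have hη : 2 * |β| ≤ threshold Φ γ n (N ω) l := by
        have h1 : Real.sqrt (2 * γ * Real.log n / n) * sigma Φ f l ≤
            Real.sqrt (2 * γ * varTilde Φ γ n (N ω) l * Real.log n) := by
          rw [← Real.sqrt_sq (sigma_nonneg (Φ := Φ) (f := f) l),
            ← Real.sqrt_mul (by positivity)]
          refine Real.sqrt_le_sqrt ?_
          have : sigma Φ f l ^ 2 / n ≤ varTilde Φ γ n (N ω) l := hω
          calc 2 * γ * Real.log n / n * sigma Φ f l ^ 2 =
                2 * γ * (sigma Φ f l ^ 2 / n) * Real.log n := by ring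
            _ ≤ _ := by gcongr
        have h2 : 0 ≤ γ * Real.log n / (3 * n) * supNorm Φ l := by
          have := supNorm_nonneg (Φ := Φ) l
          positivity
        unfold threshold
        linarith
      have h3 : |coeffHat Φ n (N ω) l| ≤ |coeffHat Φ n (N ω) l - β| + |β| := by
        have := abs_add_le (coeffHat Φ n (N ω) l - β) β; simpa using this
      have h4 : |β| ≤ |coeffHat Φ n (N ω) l - β| := by linarith [hk.1]
      exact sq_le_sq.2 h4
    · rw [coeffTilde, if_neg hk]; simp
  have hGc : P Gᶜ ≤ ENNReal.ofReal (1 / 2) := by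
    have h1 := measure_varTilde_lt_le (γ := γ) hΦ hf h hn hγ0 l
    have h2 : Gᶜ = {ω | varTilde Φ γ n (N ω) l < sigma Φ f l ^ 2 / n} := by
      ext ω; simp [G]
    rw [h2]
    refine h1.trans (ENNReal.ofReal_le_ofReal ?_)
    -- The failure probability is at most n^(-γ) ≤ 1/n ≤ 1/2.
    have h3 : Real.exp (-(γ * Real.log n)) ≤ Real.exp (-Real.log n) :=
      Real.exp_le_exp.2 (by nlinarith)
    rw [Real.exp_neg (Real.log n), Real.exp_log hn0] at h3
    refine h3.trans ?_
    rw [one_div]; gcongr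
  have hG2 : 1 ≤ 2 * P G := by
    have h1 : 1 ≤ P G + P Gᶜ := by
      rw [← measure_univ (μ := P), ← Set.union_compl_self G]; exact measure_union_le _ _
    have h2 : (1 : ℝ≥0∞) ≤ P G + ENNReal.ofReal (1 / 2) := h1.trans (by gcongr)
    have h3 : ENNReal.ofReal (1 / 2) ≤ P G := by
      have h4 : ENNReal.ofReal (1 / 2) + ENNReal.ofReal (1 / 2) ≤
          P G + ENNReal.ofReal (1 / 2) := by
        rw [← ENNReal.ofReal_add (by norm_num) (by norm_num)]; norm_num; simpa using h2
      exact (ENNReal.add_le_add_iff_right ENNReal.ofReal_ne_top).1 h4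
    calc (1 : ℝ≥0∞) = 2 * ENNReal.ofReal (1 / 2) := by
          rw [← ENNReal.ofReal_ofNat, ← ENNReal.ofReal_mul (by norm_num)]; norm_num
      _ ≤ _ := by gcongr
  have hmk := mul_meas_ge_le_lintegral₀
    (aemeasurable_coeffTilde_sub_sq (γ := γ) hΦ hf h J l β) (ENNReal.ofReal (β ^ 2))
  calc ENNReal.ofReal (β ^ 2) ≤ ENNReal.ofReal (β ^ 2) * (2 * P G) := le_mul_of_one_le_right' hG2
    _ = 2 * (ENNReal.ofReal (β ^ 2) * P G) := by ring
    _ ≤ _ := by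
      gcongr
      refine le_trans ?_ hmk
      gcongr
      exact hG

end SingleCoefficient

/-! ### Upper bounds for the risk of a single thresholded coefficient -/

section SingleCoefficientUpper

variable {Φ : Generators} {γ : ℝ} {n : ℕ}

/-- Deterministic bound for the square of the threshold. -/
lemma threshold_sq_le (hn : 2 ≤ n) (hγ : 0 ≤ γ) {N : Set ℝ} {l : Idx} {V θ : ℝ} (hθ : 0 < θ)
    (hV : θ * (supNorm Φ l ^ 2 / (n : ℝ) ^ 2) * Real.log n ≤ V)
    (hW : varHat Φ n N l ≤ 2 * V + γ * Real.log n * (supNorm Φ l ^ 2 / (n : ℝ) ^ 2)) :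
    threshold Φ γ n N l ^ 2 ≤ (12 * γ + 25 * γ ^ 2 / θ) * (V * Real.log n) := by
  have hn0 : (0 : ℝ) < n := by positivity
  have hlog : 0 ≤ Real.log n := Real.log_natCast_nonneg n
  have hW0 := varHat_nonneg (Φ := Φ) (n := n) N l
  have hT0 := varTilde_nonneg (Φ := Φ) (n := n) hγ N l
  set b := supNorm Φ l ^ 2 / (n : ℝ) ^ 2 with hb
  have hb0 : 0 ≤ b := by positivity
  set W := varHat Φ n N l
  set lg := Real.log n
  have hT : varTilde Φ γ n N l ≤ 3 * V + 6 * (γ * lg * b) := by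
    have hs : Real.sqrt (2 * γ * lg * W * b) ≤ γ * lg * b + W / 2 := by
      refine Real.sqrt_le_iff.2 ⟨by positivity, ?_⟩
      nlinarith [sq_nonneg (γ * lg * b - W / 2)]
    unfold varTilde
    change W + Real.sqrt (2 * γ * lg * W * b) + 3 * γ * lg * b ≤ _
    have : 0 ≤ γ * lg * b := by positivity
    linarith
  have hub : (γ * lg) * (γ * lg * b) ≤ γ ^ 2 / θ * (V * lg) := by
    rw [div_mul_eq_mul_div, le_div_iff₀ hθ]
    calc γ * lg * (γ * lg * b) * θ = γ ^ 2 * (θ * b * lg * lg) := by ring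
      _ ≤ γ ^ 2 * (V * lg) := by gcongr
  have h1 : threshold Φ γ n N l ^ 2 ≤
      2 * (2 * γ * varTilde Φ γ n N l * lg) + 2 * (γ * lg / (3 * n) * supNorm Φ l) ^ 2 := by
    unfold threshold
    have hs := Real.sq_sqrt (x := 2 * γ * varTilde Φ γ n N l * lg) (by positivity)
    nlinarith [sq_nonneg (Real.sqrt (2 * γ * varTilde Φ γ n N l * lg) -
      γ * lg / (3 * n) * supNorm Φ l)]
  have h2 : (γ * lg / (3 * n) * supNorm Φ l) ^ 2 = (γ * lg) * (γ * lg * b) / 9 := by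
    rw [hb]; field_simp; ring
  have h3 : 2 * γ * varTilde Φ γ n N l * lg ≤
      2 * γ * (3 * V + 6 * (γ * lg * b)) * lg := by gcongr
  have h4 : 2 * γ * (3 * V + 6 * (γ * lg * b)) * lg =
      6 * γ * (V * lg) + 12 * ((γ * lg) * (γ * lg * b)) := by ring
  have h5 : 0 ≤ (γ * lg) * (γ * lg * b) := by positivity
  have h6 : (12 * γ + 25 * γ ^ 2 / θ) * (V * lg) =
      12 * γ * (V * lg) + 25 * (γ ^ 2 / θ * (V * lg)) := by ring
  rw [h6]
  have h7 : 0 ≤ γ ^ 2 / θ * (V * lg) := h5.trans hub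
  linarith

variable {Ω : Type*} [MeasurableSpace Ω] {P : Measure Ω} {N : Ω → Set ℝ}
  (hΦ : IsAdmissible Φ) {f : ℝ → ℝ} (hf : f ∈ intensities)
  (h : IsPoissonProcess P N (meanMeasure n f))
include hΦ hf h

/-- Second moment of the estimator of a coefficient on an unlikely event, when the expected number
of points in the support is not too small. -/
lemma setLIntegral_coeffHat_sub_sq_le (hn : 2 ≤ n) (hγ : 0 < γ) {θ : ℝ} (hθ : 0 < θ) (l : Idx)
    (hV : θ * (supNorm Φ l ^ 2 / (n : ℝ) ^ 2) * Real.log n ≤ sigma Φ f l ^ 2 / n)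
    {ε : ℝ} (hε : 0 ≤ ε) (hεγ : Real.exp (-(γ * Real.log n)) ≤ ε) (A : Set Ω)
    (hA : P A ≤ ENNReal.ofReal (4 * ε)) {a : ℝ} (ha : 0 < a) (ha1 : a ≤ 1)
    (haθ : a ^ 2 ≤ θ * Real.log 2) :
    ∫⁻ ω in A, ENNReal.ofReal ((coeffHat Φ n (N ω) l - Φ.coeff f l) ^ 2) ∂P ≤
      ENNReal.ofReal ((16 * γ ^ 2 / a ^ 2 + 16 * Real.exp 1 / (a ^ 2 * Real.log 2 ^ 2)) *
        (sigma Φ f l ^ 2 / n * Real.log n ^ 2 * ε)) := by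
  have := isFiniteMeasure_meanMeasure hf n
  have hn2 : (2 : ℝ) ≤ n := by exact_mod_cast hn
  have hn0 : (0 : ℝ) < n := by linarith
  have hlog2 : 0 < Real.log 2 := Real.log_pos one_lt_two
  have hlogn : Real.log 2 ≤ Real.log n := Real.log_le_log two_pos hn2
  have hM := hΦ.supNorm_pos l
  set lg := Real.log n
  have hlg : 0 < lg := hlog2.trans_le hlogn
  set v := ∫ x, Φ.ana l x ^ 2 ∂meanMeasure n f with hvdef
  have hv : v = n * sigma Φ f l ^ 2 := integral_ana_sq_meanMeasure hf n l
  have hvM : θ * supNorm Φ l ^ 2 * lg ≤ v := by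
    have := mul_le_mul_of_nonneg_left hV (sq_nonneg (n : ℝ))
    rw [hv]
    calc _ = (n : ℝ) ^ 2 * (θ * (supNorm Φ l ^ 2 / (n : ℝ) ^ 2) * lg) := by field_simp
      _ ≤ _ := this
      _ = _ := by field_simp
  have hv0 : 0 < v := lt_of_lt_of_le (by positivity) hvM
  have hsv : 0 < Real.sqrt v := Real.sqrt_pos.2 hv0
  -- The natural scale 1/√v is admissible: v is at least a multiple of ‖φ_λ‖∞² log n, so the choice
  -- of `a` gives s‖φ_λ‖∞ ≤ 1 and a bounded exponential moment.
  set s := a / Real.sqrt v with hs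
  have hs0 : 0 < s := by positivity
  have hs2 : s ^ 2 * v = a ^ 2 := by
    rw [hs, div_pow, Real.sq_sqrt hv0.le]; field_simp
  have hsM : s * supNorm Φ l ≤ 1 := by
    rw [← sq_le_one_iff₀ (by positivity)]
    rw [mul_pow]
    have h1 : a ^ 2 * supNorm Φ l ^ 2 ≤ v := by
      calc a ^ 2 * supNorm Φ l ^ 2 ≤ θ * lg * supNorm Φ l ^ 2 := by
            gcongr; exact haθ.trans (by gcongr)
        _ = θ * supNorm Φ l ^ 2 * lg := by ring
        _ ≤ v := hvM
    rw [hs, div_pow, Real.sq_sqrt hv0.le, div_mul_eq_mul_div, div_le_one hv0]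
    exact h1
  have hB : ∫⁻ ω, ENNReal.ofReal (Real.exp (s *
      |sumOver (N ω) (Φ.ana l) - ∫ x, Φ.ana l x ∂meanMeasure n f|)) ∂P ≤
      ENNReal.ofReal (2 * Real.exp 1) := by
    refine (h.lintegral_exp_mul_abs_le (hΦ.measurable_ana l) (hΦ.finite_range_ana l)
      (hΦ.abs_ana_ae_le_meanMeasure n f l) hs0.le (by linarith)).trans ?_
    rw [ENNReal.ofReal_mul two_pos.le, ENNReal.ofReal_ofNat]
    gcongr
    rw [← hvdef, hs2, div_le_one (by linarith)]
    nlinarith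
  -- The truncation point is set so that exp(-sy/2) = n^(-γ).
  have hset := setLIntegral_sq_le (y := Real.sqrt v * (2 * γ / a * lg)) hs0 hB A
  have hsy : s * (Real.sqrt v * (2 * γ / a * lg)) / 2 = γ * lg := by
    rw [hs]; field_simp
  rw [hsy] at hset
  have hZ : ∀ ω, ENNReal.ofReal ((coeffHat Φ n (N ω) l - Φ.coeff f l) ^ 2) =
      ENNReal.ofReal (1 / (n : ℝ) ^ 2) * ENNReal.ofReal
        ((sumOver (N ω) (Φ.ana l) - ∫ x, Φ.ana l x ∂meanMeasure n f) ^ 2) := fun ω => by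
    rw [← ENNReal.ofReal_mul (by positivity), integral_ana_meanMeasure hf, coeffHat]
    congr 1
    field_simp
  simp_rw [hZ]
  rw [lintegral_const_mul' _ _ ENNReal.ofReal_ne_top]
  calc _ ≤ ENNReal.ofReal (1 / (n : ℝ) ^ 2) * (ENNReal.ofReal
        ((Real.sqrt v * (2 * γ / a * lg)) ^ 2) * ENNReal.ofReal (4 * ε) +
        ENNReal.ofReal (8 / s ^ 2 * ε * (2 * Real.exp 1))) := by
        gcongr
        refine hset.trans ?_
        gcongr
    _ = ENNReal.ofReal (1 / (n : ℝ) ^ 2 * ((Real.sqrt v * (2 * γ / a * lg)) ^ 2 * (4 * ε) +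
        8 / s ^ 2 * ε * (2 * Real.exp 1))) := by
        rw [← ENNReal.ofReal_mul (by positivity), ← ENNReal.ofReal_add (by positivity)
          (by positivity), ← ENNReal.ofReal_mul (by positivity)]
    _ ≤ _ := by
        refine ENNReal.ofReal_le_ofReal ?_
        have e1 : 8 / s ^ 2 = 8 * v / a ^ 2 := by
          rw [← hs2]; field_simp
        have e2 : sigma Φ f l ^ 2 / n = v / n ^ 2 := by rw [hv]; field_simp
        rw [e1, mul_pow, Real.sq_sqrt hv0.le, e2]
        have h1 : (1 : ℝ) ≤ lg ^ 2 / Real.log 2 ^ 2 := by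
          rw [one_le_div (by positivity)]; gcongr
        have h2 : 8 * v / a ^ 2 * ε * (2 * Real.exp 1) ≤
            8 * v / a ^ 2 * ε * (2 * Real.exp 1) * (lg ^ 2 / Real.log 2 ^ 2) :=
          le_mul_of_one_le_right (by positivity) h1
        calc _ ≤ 1 / (n : ℝ) ^ 2 * (v * (2 * γ / a * lg) ^ 2 * (4 * ε) +
              8 * v / a ^ 2 * ε * (2 * Real.exp 1) * (lg ^ 2 / Real.log 2 ^ 2)) := by gcongr
          _ = _ := by field_simp; ring

/-- Risk of a coefficient, when the expected number of points in the support is large. -/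
lemma lintegral_coeffTilde_sub_sq_le_of_large (hn : 2 ≤ n) {γ' : ℝ} (hγ' : 0 < γ')
    (hγγ' : γ' < γ) {θ : ℝ} (hθ : 0 < θ) {J : ℤ} {l : Idx} (hl : l ∈ levels J)
    (hV : θ * (supNorm Φ l ^ 2 / (n : ℝ) ^ 2) * Real.log n ≤ sigma Φ f l ^ 2 / n)
    {a κ : ℝ} (ha : 0 < a) (ha1 : a ≤ 1) (haθ : a ^ 2 ≤ θ * Real.log 2)
    (hκ0 : 0 ≤ κ) (hκ1 : κ < 1) (hκ : κ ^ 2 * γ = γ') :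
    ∫⁻ ω, ENNReal.ofReal ((coeffTilde Φ γ n (N ω) J l - Φ.coeff f l) ^ 2) ∂P ≤
      ENNReal.ofReal ((4 + 1 / (1 - κ) ^ 2) * (1 + (12 * γ + 25 * γ ^ 2 / θ)) *
        min (Φ.coeff f l ^ 2) (sigma Φ f l ^ 2 / n * Real.log n) +
        4 * (Φ.coeff f l ^ 2 * Real.exp (-(γ' * Real.log n))) +
        (16 * γ ^ 2 / a ^ 2 + 16 * Real.exp 1 / (a ^ 2 * Real.log 2 ^ 2)) *
        (sigma Φ f l ^ 2 / n * Real.log n ^ 2 * Real.exp (-(γ' * Real.log n)))) := by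
  classical
  have hP := h.isProbabilityMeasure
  have := isFiniteMeasure_meanMeasure hf n
  have hγ : 0 < γ := hγ'.trans hγγ'
  have hn2 : (2 : ℝ) ≤ n := by exact_mod_cast hn
  have hn0 : (0 : ℝ) < n := by linarith
  have hlg : 0 < Real.log n := Real.log_pos (by linarith)
  have hM := hΦ.supNorm_pos l
  set lg := Real.log n with hlgdef
  set β := Φ.coeff f l with hβ
  set V := sigma Φ f l ^ 2 / n with hVdef
  set ε := Real.exp (-(γ' * lg)) with hεdef
  have hε : 0 < ε := Real.exp_pos _
  have hεγ : Real.exp (-(γ * lg)) ≤ ε := Real.exp_le_exp.2 (by nlinarith)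
  set v := ∫ x, Φ.ana l x ^ 2 ∂meanMeasure n f with hvdef
  have hv : v = n * sigma Φ f l ^ 2 := integral_ana_sq_meanMeasure hf n l
  have hvV : v = n ^ 2 * V := by rw [hv, hVdef]; field_simp
  have hV0 : 0 < V := lt_of_lt_of_le (by positivity) hV
  have hv0 : 0 < v := by rw [hvV]; positivity
  set m := ∫ x, Φ.ana l x ∂meanMeasure n f with hmdef
  have hm : m = n * β := integral_ana_meanMeasure hf n l
  -- Three bad events: a large deviation of the coefficient (at level γ'), an underestimated
  -- variance and an overestimated one (both at level γ). Outside them the threshold exceeds the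
  -- noise and has the right order.
  let A₁ : Set Ω := {ω | Real.sqrt (2 * (γ' * lg) * v) + γ' * lg * supNorm Φ l / 3 ≤
    |sumOver (N ω) (Φ.ana l) - m|}
  let A₂ : Set Ω := {ω | varTilde Φ γ n (N ω) l < V}
  let A₃ : Set Ω := {ω | 2 * v + γ * lg * supNorm Φ l ^ 2 ≤
    sumOver (N ω) fun x => Φ.ana l x ^ 2}
  have hA₁ : P A₁ ≤ 2 * ENNReal.ofReal ε :=
    h.measure_abs_sumOver_sub_ge_le (hΦ.measurable_ana l) (hΦ.finite_range_ana l)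
      (hΦ.abs_ana_ae_le_meanMeasure n f l) hM (by positivity) hv0
  have hA₂ : P A₂ ≤ ENNReal.ofReal ε :=
    (measure_varTilde_lt_le hΦ hf h hn hγ.le l).trans (ENNReal.ofReal_le_ofReal hεγ)
  have hA₃ : P A₃ ≤ ENNReal.ofReal ε :=
    (h.measure_sumOver_sq_ge_le (hΦ.measurable_ana l) (hΦ.finite_range_ana l)
      (hΦ.abs_ana_ae_le_meanMeasure n f l) hM).trans (ENNReal.ofReal_le_ofReal hεγ)
  -- The sums over points are only almost everywhere measurable, so a measurable hull replaces the
  -- union.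
  set A : Set Ω := toMeasurable P (A₁ ∪ A₂ ∪ A₃) with hAdef
  have hAm : MeasurableSet A := measurableSet_toMeasurable _ _
  have hPA : P A ≤ ENNReal.ofReal (4 * ε) := by
    rw [hAdef, measure_toMeasurable, ENNReal.ofReal_mul (by norm_num)]
    calc P (A₁ ∪ A₂ ∪ A₃) ≤ P A₁ + P A₂ + P A₃ :=
          (measure_union_le _ _).trans (add_le_add_left (measure_union_le _ _) _)
      _ ≤ 2 * ENNReal.ofReal ε + ENNReal.ofReal ε + ENNReal.ofReal ε := by gcongr
      _ = _ := by rw [ENNReal.ofReal_ofNat]; ring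
  set C₂ := (4 + 1 / (1 - κ) ^ 2) * (1 + (12 * γ + 25 * γ ^ 2 / θ)) with hC₂
  have hC₁ : 0 ≤ 12 * γ + 25 * γ ^ 2 / θ := by positivity
  have hκ' : 0 < 1 - κ := by linarith
  have hC₂0 : 0 ≤ C₂ := by positivity
  have hgood : ∀ ω, ω ∉ A → (coeffTilde Φ γ n (N ω) J l - β) ^ 2 ≤ C₂ * min (β ^ 2) (V * lg) := by
    intro ω hω
    have hω' : ω ∉ A₁ ∪ A₂ ∪ A₃ := fun hc => hω (subset_toMeasurable _ _ hc)
    simp only [Set.mem_union, not_or] at hω'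
    obtain ⟨⟨h1, h2⟩, h3⟩ := hω'
    simp only [A₁, A₂, A₃, Set.mem_ofPred_eq, not_le, not_lt] at h1 h2 h3
    have hη0 := threshold_nonneg (Φ := Φ) (n := n) hγ.le (N ω) l
    have hη : threshold Φ γ n (N ω) l ^ 2 ≤ (12 * γ + 25 * γ ^ 2 / θ) * (V * lg) := by
      refine threshold_sq_le hn hγ.le hθ hV ?_
      rw [varHat, one_div, inv_mul_le_iff₀ (by positivity)]
      refine h3.le.trans (le_of_eq ?_)
      rw [hvV, ← hlgdef]
      have : (n : ℝ) ^ 2 * (γ * lg * (supNorm Φ l ^ 2 / n ^ 2)) = γ * lg * supNorm Φ l ^ 2 := by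
        field_simp
      rw [mul_add, this]; ring
    have hZ : |coeffHat Φ n (N ω) l - β| ≤ κ * threshold Φ γ n (N ω) l := by
      have e1 : coeffHat Φ n (N ω) l - β = (sumOver (N ω) (Φ.ana l) - m) / n := by
        rw [hm, coeffHat]; field_simp
      rw [e1, abs_div, abs_of_pos hn0, div_le_iff₀ hn0]
      refine h1.le.trans ?_
      have e2 : Real.sqrt (2 * (γ' * lg) * v) = κ * n * Real.sqrt (2 * γ * V * lg) := by
        rw [show 2 * (γ' * lg) * v = (κ * n) ^ 2 * (2 * γ * V * lg) by rw [hvV, ← hκ]; ring,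
          Real.sqrt_mul (by positivity), Real.sqrt_sq (by positivity)]
      have e3 : Real.sqrt (2 * γ * V * lg) ≤ Real.sqrt (2 * γ * varTilde Φ γ n (N ω) l * lg) := by
        refine Real.sqrt_le_sqrt ?_
        gcongr
      -- Since γ' = κ²γ, Bernstein's square root term at γ' is exactly κ times that at γ, and the
      -- linear term is at most κ times its counterpart.
      have e4 : γ' ≤ κ * γ := by rw [← hκ]; nlinarith
      rw [e2]
      unfold threshold
      calc κ * n * Real.sqrt (2 * γ * V * lg) + γ' * lg * supNorm Φ l / 3
          ≤ κ * n * Real.sqrt (2 * γ * varTilde Φ γ n (N ω) l * lg) +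
            κ * γ * lg * supNorm Φ l / 3 := by gcongr
        _ = _ := by
          rw [← hlgdef]
          have : γ * lg / (3 * n) * supNorm Φ l * n = γ * lg * supNorm Φ l / 3 := by field_simp
          linear_combination (-κ) * this
    rw [coeffTilde_eq_of_mem hl]
    refine (sq_threshold_sub_le hκ1 hη0 hZ).trans ?_
    rw [hC₂, mul_assoc]
    gcongr
    rw [mul_min_of_nonneg _ _ (by positivity)]
    have hVl : 0 ≤ V * lg := by positivity
    refine min_le_min ?_ ?_
    · exact le_mul_of_one_le_left (sq_nonneg _) (by linarith)
    · refine hη.trans ?_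
      rw [one_add_mul]
      exact le_add_of_nonneg_left hVl
  have hpt : ∀ ω, ENNReal.ofReal ((coeffTilde Φ γ n (N ω) J l - β) ^ 2) ≤
      ENNReal.ofReal (C₂ * min (β ^ 2) (V * lg)) + (A.indicator (fun _ => ENNReal.ofReal (β ^ 2)) ω +
        A.indicator (fun ω => ENNReal.ofReal ((coeffHat Φ n (N ω) l - β) ^ 2)) ω) := fun ω => by
    by_cases hω : ω ∈ A
    · rw [Set.indicator_of_mem hω, Set.indicator_of_mem hω]
      refine le_trans ?_ le_add_self
      rw [coeffTilde_eq_of_mem hl]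
      split_ifs with hk
      · exact le_add_self
      · simp
    · rw [Set.indicator_of_notMem hω, Set.indicator_of_notMem hω, add_zero, add_zero]
      exact ENNReal.ofReal_le_ofReal (hgood ω hω)
  have hmin : 0 ≤ min (β ^ 2) (V * lg) := le_min (sq_nonneg _) (by positivity)
  calc _ ≤ ∫⁻ ω, (ENNReal.ofReal (C₂ * min (β ^ 2) (V * lg)) +
        (A.indicator (fun _ => ENNReal.ofReal (β ^ 2)) ω +
        A.indicator (fun ω => ENNReal.ofReal ((coeffHat Φ n (N ω) l - β) ^ 2)) ω)) ∂P :=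
        lintegral_mono hpt
    _ = ENNReal.ofReal (C₂ * min (β ^ 2) (V * lg)) + (ENNReal.ofReal (β ^ 2) * P A +
        ∫⁻ ω in A, ENNReal.ofReal ((coeffHat Φ n (N ω) l - β) ^ 2) ∂P) := by
        rw [lintegral_add_left measurable_const, lintegral_const, measure_univ, mul_one,
          lintegral_add_left (measurable_const.indicator hAm), lintegral_indicator_const hAm,
          lintegral_indicator hAm]
    _ ≤ ENNReal.ofReal (C₂ * min (β ^ 2) (V * lg)) + (ENNReal.ofReal (β ^ 2) *
        ENNReal.ofReal (4 * ε) + ENNReal.ofReal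
        ((16 * γ ^ 2 / a ^ 2 + 16 * Real.exp 1 / (a ^ 2 * Real.log 2 ^ 2)) * (V * lg ^ 2 * ε))) := by
        gcongr
        exact setLIntegral_coeffHat_sub_sq_le hΦ hf h hn hγ hθ l hV hε.le hεγ A hPA ha ha1 haθ
    _ = _ := by
        rw [← ENNReal.ofReal_mul (sq_nonneg _), ← ENNReal.ofReal_add (by positivity)
          (by positivity), ← ENNReal.ofReal_add (by positivity) (by positivity)]
        congr 1; ring

/-- Risk of a coefficient, when the expected number of points in the support is small. -/
lemma lintegral_coeffTilde_sub_sq_le_of_small (hn : 2 ≤ n) (hγ : 0 < γ) {q θ : ℝ} (hq : 0 < q)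
    (hθ : θ * Real.exp 3 ≤ q ^ 2 * γ) (hθ0 : 0 < θ) {J : ℤ} {l : Idx} (hl : l ∈ levels J)
    (hlow : ∀ x, Φ.ana l x ≠ 0 → q * supNorm Φ l ≤ |Φ.ana l x|)
    (hV : sigma Φ f l ^ 2 / n ≤ θ * (supNorm Φ l ^ 2 / (n : ℝ) ^ 2) * Real.log n) :
    ∫⁻ ω, ENNReal.ofReal ((coeffTilde Φ γ n (N ω) J l - Φ.coeff f l) ^ 2) ∂P ≤
      ENNReal.ofReal (2 * (1 + θ / q ^ 4) *
        min (Φ.coeff f l ^ 2) (sigma Φ f l ^ 2 / n * Real.log n) +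
        2 * Real.exp 3 / (q ^ 2 * Real.log 2 ^ 2) *
        (sigma Φ f l ^ 2 / n * Real.log n ^ 2 * Real.exp (-(γ * Real.log n)))) := by
  classical
  have hP := h.isProbabilityMeasure
  have := isFiniteMeasure_meanMeasure hf n
  have hn2 : (2 : ℝ) ≤ n := by exact_mod_cast hn
  have hn0 : (0 : ℝ) < n := by linarith
  have hlog2 : 0 < Real.log 2 := Real.log_pos one_lt_two
  have hlogn : Real.log 2 ≤ Real.log n := Real.log_le_log two_pos hn2
  have hlg : 0 < Real.log n := hlog2.trans_le hlogn
  have hM := hΦ.supNorm_pos l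
  set lg := Real.log n with hlgdef
  set β := Φ.coeff f l with hβ
  set V := sigma Φ f l ^ 2 / n with hVdef
  have hV0 : 0 ≤ V := by positivity
  set M := supNorm Φ l
  set D : Set ℝ := {x | Φ.ana l x ≠ 0}
  have hD : MeasurableSet D := hΦ.measurableSet_support l
  set μ := (meanMeasure n f).real D with hμdef
  have hμ0 : 0 ≤ μ := measureReal_nonneg
  have hμV : q ^ 2 * (M ^ 2 * μ) ≤ n ^ 2 * V := by
    have := hΦ.measure_support_le hf n l hq hlow
    calc q ^ 2 * (M ^ 2 * μ) = (q * M) ^ 2 * μ := by ring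
      _ ≤ n * sigma Φ f l ^ 2 := this
      _ = _ := by rw [hVdef]; field_simp
  have hμlg : q ^ 2 * μ ≤ θ * lg := by
    have h1 : q ^ 2 * (M ^ 2 * μ) ≤ θ * lg * M ^ 2 := by
      refine hμV.trans ((mul_le_mul_of_nonneg_left hV (sq_nonneg (n : ℝ))).trans (le_of_eq ?_))
      field_simp
    have h2 : q ^ 2 * μ * M ^ 2 ≤ θ * lg * M ^ 2 := by linarith
    exact le_of_mul_le_mul_right h2 (by positivity)
  -- With few expected points the coefficient is itself below the noise level, so β² is already
  -- comparable to the minimum and replacing it by 0 is harmless.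
  have hβV : β ^ 2 ≤ θ / q ^ 4 * (V * lg) := by
    have h1 := hΦ.abs_coeff_le hf n l
    have h2 : n ^ 2 * β ^ 2 ≤ M ^ 2 * μ ^ 2 := by
      rw [← sq_abs β, ← mul_pow, ← mul_pow]; gcongr
    rw [div_mul_eq_mul_div, le_div_iff₀ (by positivity)]
    have h3 : n ^ 2 * (β ^ 2 * q ^ 4) ≤ n ^ 2 * (θ * (V * lg)) := by
      calc n ^ 2 * (β ^ 2 * q ^ 4) = (n ^ 2 * β ^ 2) * q ^ 4 := by ring
        _ ≤ (M ^ 2 * μ ^ 2) * q ^ 4 := by gcongr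
        _ = (q ^ 2 * (M ^ 2 * μ)) * (q ^ 2 * μ) := by ring
        _ ≤ (n ^ 2 * V) * (θ * lg) := by gcongr
        _ = _ := by ring
    exact le_of_mul_le_mul_left h3 (by positivity)
  have hβmin : β ^ 2 ≤ (1 + θ / q ^ 4) * min (β ^ 2) (V * lg) := by
    have hVl : 0 ≤ V * lg := by positivity
    have hθq : 0 ≤ θ / q ^ 4 := by positivity
    rw [mul_min_of_nonneg _ _ (by positivity)]
    exact le_min (le_mul_of_one_le_left (sq_nonneg _) (by linarith)) (by linarith)
  -- The number of observed points in the support of the wavelet; ‖φ_λ‖∞ K / n bounds the empirical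
  -- coefficient.
  let K : Ω → ℝ := fun ω => sumOver (N ω) (D.indicator 1)
  set u := γ * lg with hu
  have hu0 : 0 < u := by positivity
  have hpt : ∀ᵐ ω ∂P, ENNReal.ofReal ((coeffTilde Φ γ n (N ω) J l - β) ^ 2) ≤
      ENNReal.ofReal (2 * β ^ 2) + ENNReal.ofReal (2 * (M ^ 2 / n ^ 2) * Real.exp (-(4 * u))) *
        ENNReal.ofReal (K ω ^ 2 * Real.exp (2 * K ω)) := by
    have hmeas : MeasurableSet {x | |Φ.ana l x| ≤ M} :=
      measurableSet_le (hΦ.measurable_ana l).abs measurable_const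
    filter_upwards [h.ae_finite (measure_ne_top _ _),
      h.ae_forall_mem hmeas (hΦ.abs_ana_ae_le_meanMeasure n f l)] with ω hfin hbd
    have hK0 : 0 ≤ K ω := tsum_nonneg fun x => Set.indicator_nonneg (fun _ _ => zero_le_one) _
    have hSK : |sumOver (N ω) (Φ.ana l)| ≤ M * K ω := by
      simp only [K]
      rw [sumOver_eq_finset_sum hfin, sumOver_eq_finset_sum hfin, Finset.mul_sum]
      refine (Finset.abs_sum_le_sum_abs _ _).trans (Finset.sum_le_sum fun x hx => ?_)
      by_cases h0 : Φ.ana l x = 0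
      · have : x ∉ D := fun hc => hc h0
        simp [h0, this]
      · have : x ∈ D := h0
        rw [Set.indicator_of_mem this, Pi.one_apply, mul_one]
        exact hbd x ((Set.Finite.mem_toFinset hfin).1 hx)
    have hβh : |coeffHat Φ n (N ω) l| ≤ M / n * K ω := by
      rw [coeffHat, abs_mul, abs_of_pos (by positivity), one_div, inv_mul_le_iff₀ hn0]
      refine hSK.trans (le_of_eq ?_)
      field_simp
    rw [← ENNReal.ofReal_mul (by positivity), ← ENNReal.ofReal_add (by positivity) (by positivity),
      coeffTilde_eq_of_mem hl]
    refine ENNReal.ofReal_le_ofReal ?_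
    have hrest : 0 ≤ 2 * (M ^ 2 / n ^ 2) * Real.exp (-(4 * u)) *
      (K ω ^ 2 * Real.exp (2 * K ω)) := by positivity
    split_ifs with hk
    · have hη : 2 * u * (M / n) ≤ threshold Φ γ n (N ω) l := by
        have h1 : 2 * u * (M / n) ≤ Real.sqrt (2 * γ * varTilde Φ γ n (N ω) l * lg) := by
          refine Real.le_sqrt_of_sq_le ?_
          have h2 := three_mul_le_varTilde (Φ := Φ) (γ := γ) (n := n) (N ω) l
          calc (2 * u * (M / n)) ^ 2 = 4 * (u ^ 2 * (M ^ 2 / n ^ 2)) := by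
                rw [mul_pow, div_pow]; ring
            _ ≤ 6 * (u ^ 2 * (M ^ 2 / n ^ 2)) := by gcongr; norm_num
            _ = 2 * γ * (3 * γ * lg * (M ^ 2 / n ^ 2)) * lg := by rw [hu]; ring
            _ ≤ _ := by gcongr
        unfold threshold
        have : 0 ≤ γ * lg / (3 * n) * M := by positivity
        linarith
      -- Keeping the coefficient forces at least 2γ log n points, so inserting the factor exp(2K -
      -- 4u) ≥ 1 is free on this event.
      have hK : 2 * u ≤ K ω := by
        have h1 : 2 * u * (M / n) ≤ K ω * (M / n) := by linarith [hη.trans (hk.trans hβh)]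
        exact le_of_mul_le_mul_right h1 (by positivity)
      have hexp : 1 ≤ Real.exp (-(4 * u)) * Real.exp (2 * K ω) := by
        rw [← Real.exp_add]; exact Real.one_le_exp (by linarith)
      have h1 : coeffHat Φ n (N ω) l ^ 2 ≤ M ^ 2 / n ^ 2 * K ω ^ 2 := by
        rw [← sq_abs, ← div_pow, ← mul_pow]; gcongr
      have h2 : M ^ 2 / n ^ 2 * K ω ^ 2 ≤ M ^ 2 / n ^ 2 * K ω ^ 2 *
          (Real.exp (-(4 * u)) * Real.exp (2 * K ω)) :=
        le_mul_of_one_le_right (by positivity) hexp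
      nlinarith [sq_nonneg (coeffHat Φ n (N ω) l + β)]
    · rw [zero_sub, neg_sq]
      nlinarith [sq_nonneg β]
  -- The smallness of `θ` is used here: the exponential moment costs at most exp(u), against the
  -- gain exp(-4u).
  have hx : (Real.exp 3 - 1) * μ ≤ u := by
    have h1 : (Real.exp 3 - 1) * μ ≤ Real.exp 3 * μ := by gcongr; linarith
    have h2 : q ^ 2 * (Real.exp 3 * μ) ≤ q ^ 2 * u := by
      calc q ^ 2 * (Real.exp 3 * μ) = Real.exp 3 * (q ^ 2 * μ) := by ring
        _ ≤ Real.exp 3 * (θ * lg) := by gcongr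
        _ = (θ * Real.exp 3) * lg := by ring
        _ ≤ (q ^ 2 * γ) * lg := by gcongr
        _ = _ := by rw [hu]; ring
    exact h1.trans (le_of_mul_le_mul_left h2 (by positivity))
  have hexpm : Real.exp ((Real.exp 3 - 1) * μ) - 1 ≤ Real.exp 3 * μ * Real.exp u := by
    set x := (Real.exp 3 - 1) * μ with hxdef
    have h1 : Real.exp x - 1 ≤ x * Real.exp x := by
      have := Real.add_one_le_exp (-x)
      have h3 : Real.exp x * Real.exp (-x) = 1 := by rw [← Real.exp_add]; simp
      nlinarith [Real.exp_pos x]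
    have h2 : x ≤ Real.exp 3 * μ := by rw [hxdef]; gcongr; linarith
    have h3 : 0 ≤ x := mul_nonneg (by linarith [Real.add_one_le_exp (3 : ℝ)]) hμ0
    calc _ ≤ x * Real.exp x := h1
      _ ≤ _ := by gcongr
  have hKint := h.lintegral_sq_mul_exp_sumOver_indicator_le hD
  have hM2 : M ^ 2 / n ^ 2 * μ ≤ V / q ^ 2 := by
    rw [le_div_iff₀ (by positivity), div_mul_eq_mul_div, div_mul_eq_mul_div,
      div_le_iff₀ (by positivity)]
    linarith
  calc _ ≤ ∫⁻ ω, (ENNReal.ofReal (2 * β ^ 2) +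
        ENNReal.ofReal (2 * (M ^ 2 / n ^ 2) * Real.exp (-(4 * u))) *
        ENNReal.ofReal (K ω ^ 2 * Real.exp (2 * K ω))) ∂P := lintegral_mono_ae hpt
    _ = ENNReal.ofReal (2 * β ^ 2) + ENNReal.ofReal (2 * (M ^ 2 / n ^ 2) * Real.exp (-(4 * u))) *
        ∫⁻ ω, ENNReal.ofReal (K ω ^ 2 * Real.exp (2 * K ω)) ∂P := by
        rw [lintegral_add_left measurable_const, lintegral_const, measure_univ, mul_one,
          lintegral_const_mul' _ _ ENNReal.ofReal_ne_top]
    _ ≤ ENNReal.ofReal (2 * β ^ 2) + ENNReal.ofReal (2 * (M ^ 2 / n ^ 2) * Real.exp (-(4 * u))) *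
        ENNReal.ofReal (Real.exp 3 * μ * Real.exp u) := by
        gcongr
        exact hKint.trans (ENNReal.ofReal_le_ofReal hexpm)
    _ ≤ _ := by
        rw [← ENNReal.ofReal_mul (by positivity), ← ENNReal.ofReal_add (by positivity)
          (by positivity)]
        refine ENNReal.ofReal_le_ofReal (add_le_add (by linarith) ?_)
        have h1 : Real.exp (-(4 * u)) * Real.exp u ≤ Real.exp (-u) := by
          rw [← Real.exp_add]; exact Real.exp_le_exp.2 (by linarith)
        have h2 : (1 : ℝ) ≤ lg ^ 2 / Real.log 2 ^ 2 := by
          rw [one_le_div (by positivity)]; gcongr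
        calc 2 * (M ^ 2 / n ^ 2) * Real.exp (-(4 * u)) * (Real.exp 3 * μ * Real.exp u)
            = 2 * Real.exp 3 * (M ^ 2 / n ^ 2 * μ) * (Real.exp (-(4 * u)) * Real.exp u) := by ring
          _ ≤ 2 * Real.exp 3 * (V / q ^ 2) * Real.exp (-u) := by gcongr
          _ ≤ 2 * Real.exp 3 * (V / q ^ 2) * Real.exp (-u) * (lg ^ 2 / Real.log 2 ^ 2) :=
            le_mul_of_one_le_right (by positivity) h2
          _ = _ := by field_simp

omit hΦ hf h in
/-- An oracle inequality for each thresholded coefficient. -/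
theorem exists_lintegral_coeffTilde_sub_sq_le (hΦ : IsAdmissible Φ) {γ γ' : ℝ} (hγ' : 0 < γ')
    (hγ : γ' < γ) :
    ∃ C : ℝ, 0 < C ∧ ∀ (f : ℝ → ℝ), f ∈ intensities → ∀ n : ℕ, 2 ≤ n →
      ∀ {Ω : Type*} [MeasurableSpace Ω] (P : Measure Ω) (N : Ω → Set ℝ),
      IsPoissonProcess P N (meanMeasure n f) → ∀ (J : ℤ), ∀ l ∈ levels J,
      ∫⁻ ω, ENNReal.ofReal ((coeffTilde Φ γ n (N ω) J l - Φ.coeff f l) ^ 2) ∂P ≤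
        ENNReal.ofReal (C * (min (Φ.coeff f l ^ 2) (sigma Φ f l ^ 2 * (Real.log n / n)) +
          Φ.coeff f l ^ 2 * Real.exp (-(γ' * Real.log n)) +
          sigma Φ f l ^ 2 / n * Real.log n ^ 2 * Real.exp (-(γ' * Real.log n)))) := by
  obtain ⟨q, hq, hlow⟩ := hΦ.exists_lower_bound
  have hγ0 : 0 < γ := hγ'.trans hγ
  have hlog2 : 0 < Real.log 2 := Real.log_pos one_lt_two
  -- The largest separation constant allowed in the case of few expected points.
  set θ := q ^ 2 * γ / Real.exp 3 with hθdef
  have hθ : 0 < θ := by positivity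
  -- The proportion of the threshold that the noise may reach; it is below 1 since γ' < γ.
  set κ := Real.sqrt (γ' / γ) with hκdef
  have hκ0 : 0 ≤ κ := Real.sqrt_nonneg _
  have hκ2 : κ ^ 2 * γ = γ' := by
    rw [hκdef, Real.sq_sqrt (by positivity)]; field_simp
  have hκ1 : κ < 1 := by
    rw [hκdef, Real.sqrt_lt' one_pos, one_pow, div_lt_one hγ0]; exact hγ
  set a := min 1 (Real.sqrt (θ * Real.log 2)) with hadef
  have ha : 0 < a := lt_min one_pos (Real.sqrt_pos.2 (by positivity))
  have ha2 : a ^ 2 ≤ θ * Real.log 2 := by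
    rw [← Real.sq_sqrt (show 0 ≤ θ * Real.log 2 by positivity)]
    gcongr
    exact min_le_right _ _
  set C₁ := (4 + 1 / (1 - κ) ^ 2) * (1 + (12 * γ + 25 * γ ^ 2 / θ))
  set C₂ := 16 * γ ^ 2 / a ^ 2 + 16 * Real.exp 1 / (a ^ 2 * Real.log 2 ^ 2)
  set C₃ := 2 * (1 + θ / q ^ 4)
  set C₄ := 2 * Real.exp 3 / (q ^ 2 * Real.log 2 ^ 2)
  have hκ' : 0 < 1 - κ := by linarith
  have hC₁ : 0 ≤ C₁ := by positivity
  have hC₂ : 0 ≤ C₂ := by positivity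
  have hC₃ : 0 ≤ C₃ := by positivity
  have hC₄ : 0 ≤ C₄ := by positivity
  refine ⟨C₁ + C₂ + C₃ + C₄ + 4, by positivity, ?_⟩
  intro f hf n hn Ω _ P N h J l hl
  have hn2 : (2 : ℝ) ≤ n := by exact_mod_cast hn
  have hn0 : (0 : ℝ) < n := by linarith
  have hlg : 0 < Real.log n := Real.log_pos (by linarith)
  have e : sigma Φ f l ^ 2 * (Real.log n / n) = sigma Φ f l ^ 2 / n * Real.log n := by ring
  rw [e]
  set X := min (Φ.coeff f l ^ 2) (sigma Φ f l ^ 2 / n * Real.log n) with hX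
  have hX0 : 0 ≤ X := le_min (sq_nonneg _) (by positivity)
  have hle : Real.exp (-(γ * Real.log n)) ≤ Real.exp (-(γ' * Real.log n)) :=
    Real.exp_le_exp.2 (by nlinarith)
  set Y := Φ.coeff f l ^ 2 * Real.exp (-(γ' * Real.log n)) with hY
  have hY0 : 0 ≤ Y := by positivity
  set Z := sigma Φ f l ^ 2 / n * Real.log n ^ 2 * Real.exp (-(γ' * Real.log n)) with hZ
  have hZ0 : 0 ≤ Z := by positivity
  rcases le_total (θ * (supNorm Φ l ^ 2 / (n : ℝ) ^ 2) * Real.log n) (sigma Φ f l ^ 2 / n) with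
    hV | hV
  · refine (lintegral_coeffTilde_sub_sq_le_of_large hΦ hf h hn hγ' hγ hθ hl hV ha
      (min_le_left _ _) ha2 hκ0 hκ1 hκ2).trans (ENNReal.ofReal_le_ofReal ?_)
    change C₁ * X + 4 * Y + C₂ * Z ≤ _
    have : 0 ≤ (C₂ + C₃ + C₄ + 4) * X + (C₁ + C₂ + C₃ + C₄) * Y + (C₁ + C₃ + C₄ + 4) * Z := by
      positivity
    linarith
  · refine (lintegral_coeffTilde_sub_sq_le_of_small hΦ hf h hn hγ0 hq
      (le_of_eq (by rw [hθdef]; field_simp)) hθ hl (hlow l) hV).trans (ENNReal.ofReal_le_ofReal ?_)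
    change C₃ * X + C₄ * (sigma Φ f l ^ 2 / n * Real.log n ^ 2 *
      Real.exp (-(γ * Real.log n))) ≤ _
    have h1 : sigma Φ f l ^ 2 / n * Real.log n ^ 2 * Real.exp (-(γ * Real.log n)) ≤ Z := by
      rw [hZ]; gcongr
    have h2 : C₄ * (sigma Φ f l ^ 2 / n * Real.log n ^ 2 * Real.exp (-(γ * Real.log n))) ≤
      C₄ * Z := by gcongr
    have : 0 ≤ (C₁ + C₂ + C₄ + 4) * X + (C₁ + C₂ + C₃ + C₄ + 4) * Y + (C₁ + C₂ + C₃ + 4) * Z := by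
      positivity
    linarith

end SingleCoefficientUpper

/-! ### Sums over levels -/

section Levels

/-- Indices as pairs of a shifted level and a position. -/
def idxEquiv : ℕ × ℤ ≃ Idx where
  toFun p := ⟨((p.1 : ℤ) - 1, p.2), by simp only; omega⟩
  invFun l := ((l.1.1 + 1).toNat, l.1.2)
  left_inv p := by ext <;> simp
  right_inv l := by
    have := l.2
    refine Subtype.ext (Prod.ext ?_ rfl)
    simp only
    omega

lemma lev_idxEquiv_le (p : ℕ × ℤ) : lev (idxEquiv p) ≤ p.1 := by
  simp only [lev, idxEquiv, Equiv.coe_fn_mk]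
  omega

lemma tsum_idx_eq (F : Idx → ℝ≥0∞) : ∑' l, F l = ∑' (i : ℕ) (k : ℤ), F (idxEquiv (i, k)) := by
  rw [← idxEquiv.tsum_eq, ENNReal.tsum_prod (f := fun i k => F (idxEquiv (i, k)))]

lemma tsum_translates_le {A : ℝ} (hA : 0 ≤ A) (y : ℝ) :
    ∑' k : ℤ, (if |y - k| ≤ A then (1 : ℝ≥0∞) else 0) ≤ ENNReal.ofReal (2 * A + 1) := by
  classical
  rw [tsum_eq_sum (s := Finset.Icc ⌈y - A⌉ ⌊y + A⌋)]
  · calc _ ≤ ∑ k ∈ Finset.Icc ⌈y - A⌉ ⌊y + A⌋, (1 : ℝ≥0∞) :=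
          Finset.sum_le_sum fun k _ => by split_ifs <;> simp
      _ = ENNReal.ofReal ((Finset.Icc ⌈y - A⌉ ⌊y + A⌋).card : ℝ) := by simp
      _ ≤ _ := by
        refine ENNReal.ofReal_le_ofReal ?_
        rw [Int.card_Icc]
        rcases le_total 0 (⌊y + A⌋ + 1 - ⌈y - A⌉) with h | h
        · have : (((⌊y + A⌋ + 1 - ⌈y - A⌉).toNat : ℤ) : ℝ) =
            ((⌊y + A⌋ + 1 - ⌈y - A⌉ : ℤ) : ℝ) := by rw [Int.toNat_of_nonneg h]
          rw [Int.cast_natCast] at this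
          rw [this]
          push_cast
          linarith [Int.floor_le (y + A), Int.le_ceil (y - A)]
        · rw [Int.toNat_eq_zero.2 h]
          norm_num; positivity
  · intro k hk
    rw [if_neg]
    intro hc
    refine hk (Finset.mem_Icc.2 ?_)
    rw [abs_le] at hc
    exact ⟨Int.ceil_le.2 (by linarith), Int.le_floor.2 (by linarith)⟩

namespace IsAdmissible

variable {Φ : Generators} (hΦ : IsAdmissible Φ)
include hΦ

/-- The sum of the squared analysis functions up to a given level is bounded. -/
lemma exists_tsum_ana_sq_le : ∃ C : ℝ, 0 < C ∧ ∀ (J : ℤ) (x : ℝ),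
    ∑' l : Idx, (levels J).indicator (fun l => ENNReal.ofReal (Φ.ana l x ^ 2)) l ≤
      ENNReal.ofReal (C * 2 ^ J) := by
  classical
  obtain ⟨b, B, hb, hbB, hB⟩ := hΦ.exists_bounds
  obtain ⟨A, hA, hsupp⟩ := hΦ.ana_support
  have hB0 : 0 < B := hb.trans_le hbB
  refine ⟨4 * (B ^ 2 * (2 * A + 1)), by positivity, fun J x => ?_⟩
  rw [tsum_idx_eq]
  -- At one level at most 2A + 1 supports contain x and each square is O(2^i); the sum over levels
  -- is then geometric.
  have hlevel : ∀ i : ℕ, ∑' k : ℤ, ENNReal.ofReal (Φ.ana (idxEquiv (i, k)) x ^ 2) ≤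
      ENNReal.ofReal (B ^ 2 * (2 * A + 1) * 2 ^ i) := fun i => by
    have hlev : ∀ k, lev (idxEquiv (i, k)) = lev (idxEquiv (i, 0)) := fun k => rfl
    set j := lev (idxEquiv (i, 0)) with hj
    have hji : j ≤ i := lev_idxEquiv_le (i, 0)
    calc _ ≤ ∑' k : ℤ, ENNReal.ofReal (2 ^ i * B ^ 2) *
          (if |2 ^ j * x - k| ≤ A then (1 : ℝ≥0∞) else 0) := by
          refine ENNReal.tsum_le_tsum fun k => ?_
          split_ifs with hk
          · rw [mul_one]
            refine ENNReal.ofReal_le_ofReal ?_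
            simp only [Generators.ana]
            rw [wavelet_eq, mul_pow, Real.sq_sqrt (by positivity), hlev k]
            have h1 := (hB (idxEquiv (i, k)) (2 ^ j * x - (idxEquiv (i, k)).1.2)).1
            have h2 : (2 : ℝ) ^ j ≤ 2 ^ i := pow_le_pow_right₀ one_le_two hji
            rw [← sq_abs (gen _ _ _ _)]
            gcongr
          · rw [mul_zero]
            push Not at hk
            have := (hsupp (idxEquiv (i, k)) x (by rw [hlev k]; exact hk)).1
            rw [this]; simp
      _ ≤ ENNReal.ofReal (2 ^ i * B ^ 2) * ENNReal.ofReal (2 * A + 1) := by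
          rw [ENNReal.tsum_mul_left]
          gcongr
          exact tsum_translates_le (by linarith) _
      _ = _ := by
          rw [← ENNReal.ofReal_mul (by positivity)]
          congr 1; ring
  have hmem : ∀ i k, idxEquiv (i, k) ∈ levels J ↔ i < (J + 2).toNat := fun i k => by
    simp only [levels, idxEquiv, Equiv.coe_fn_mk, Set.mem_ofPred_eq]
    omega
  rw [tsum_eq_sum (s := Finset.range (J + 2).toNat)]
  · calc _ ≤ ∑ i ∈ Finset.range (J + 2).toNat, ENNReal.ofReal (B ^ 2 * (2 * A + 1) * 2 ^ i) := by
          refine Finset.sum_le_sum fun i hi => ?_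
          refine le_trans (ENNReal.tsum_le_tsum fun k => ?_) (hlevel i)
          exact Set.indicator_le_self _ _ _
      _ = ENNReal.ofReal (B ^ 2 * (2 * A + 1) * ∑ i ∈ Finset.range (J + 2).toNat, 2 ^ i) := by
          rw [Finset.mul_sum, ENNReal.ofReal_sum_of_nonneg fun i _ => by positivity]
      _ ≤ _ := by
          refine ENNReal.ofReal_le_ofReal ?_
          have h1 : ∑ i ∈ Finset.range (J + 2).toNat, (2 : ℝ) ^ i ≤ 4 * 2 ^ J := by
            rcases le_total 0 (J + 2) with h | h
            · have h2 : (2 : ℝ) ^ (J + 2).toNat = 4 * 2 ^ J := by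
                rw [← zpow_natCast, Int.toNat_of_nonneg h, zpow_add₀ two_ne_zero]; norm_num
                ring
              rw [geom_sum_eq (by norm_num), h2]
              norm_num
            · rw [Int.toNat_eq_zero.2 h]; simp; positivity
          calc _ ≤ B ^ 2 * (2 * A + 1) * (4 * 2 ^ J) := by gcongr
            _ = _ := by ring
  · intro i hi
    rw [Finset.mem_range, not_lt] at hi
    refine ENNReal.tsum_eq_zero.2 fun k => ?_
    rw [Set.indicator_of_notMem]
    rw [hmem]; omega

/-- The sum of the variances up to a given level. -/
lemma exists_tsum_sigma_sq_le : ∃ C : ℝ, 0 < C ∧ ∀ f ∈ intensities, ∀ J : ℤ,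
    ∑' l : Idx, (levels J).indicator (fun l => ENNReal.ofReal (sigma Φ f l ^ 2)) l ≤
      ENNReal.ofReal (C * 2 ^ J) * eLpNorm f 1 volume := by
  obtain ⟨C, hC, h⟩ := hΦ.exists_tsum_ana_sq_le
  refine ⟨C, hC, fun f hf J => ?_⟩
  have hfm : AEMeasurable (fun x => ENNReal.ofReal (f x)) volume :=
    (integrable_of_mem_intensities hf).1.aemeasurable.ennreal_ofReal
  have hσ : ∀ l, ENNReal.ofReal (sigma Φ f l ^ 2) =
      ∫⁻ x, ENNReal.ofReal (Φ.ana l x ^ 2) * ENNReal.ofReal (f x) := fun l => by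
    have hint : Integrable (fun x => Φ.ana l x ^ 2 * f x) volume := by
      refine (integrable_of_mem_intensities hf).bdd_mul (c := supNorm Φ l ^ 2)
        ((hΦ.measurable_ana l).pow_const 2).aestronglyMeasurable ?_
      filter_upwards [hΦ.abs_ana_ae_le l] with x hx
      rw [Real.norm_eq_abs, abs_pow]
      gcongr
    rw [sigma_sq hf, ofReal_integral_eq_lintegral_ofReal hint]
    · exact lintegral_congr fun x => ENNReal.ofReal_mul (sq_nonneg _)
    · filter_upwards [hf.1] with x hx
      exact mul_nonneg (sq_nonneg _) hx
  have hind : ∀ l, (levels J).indicator (fun l => ENNReal.ofReal (sigma Φ f l ^ 2)) l =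
      ∫⁻ x, (levels J).indicator (fun l => ENNReal.ofReal (Φ.ana l x ^ 2)) l *
        ENNReal.ofReal (f x) := fun l => by
    by_cases hl : l ∈ levels J
    · simp_rw [Set.indicator_of_mem hl]; exact hσ l
    · simp_rw [Set.indicator_of_notMem hl]; simp
  simp_rw [hind]
  rw [← lintegral_tsum]
  · calc _ ≤ ∫⁻ x, ENNReal.ofReal (C * 2 ^ J) * ENNReal.ofReal (f x) := by
          refine lintegral_mono fun x => ?_
          rw [ENNReal.tsum_mul_right]
          gcongr
          exact h J x
      _ = ENNReal.ofReal (C * 2 ^ J) * ∫⁻ x, ENNReal.ofReal (f x) :=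
          lintegral_const_mul' _ _ ENNReal.ofReal_ne_top
      _ ≤ _ := by
          gcongr
          rw [eLpNorm_one_eq_lintegral_enorm]
          refine lintegral_mono fun x => ?_
          rw [Real.enorm_eq_ofReal_abs]
          exact ENNReal.ofReal_le_ofReal (le_abs_self _)
  · intro l
    by_cases hl : l ∈ levels J
    · simp_rw [Set.indicator_of_mem hl]
      exact ((hΦ.measurable_ana l).pow_const 2).ennreal_ofReal.aemeasurable.mul hfm
    · simp_rw [Set.indicator_of_notMem hl]
      simp

end IsAdmissible

end Levels

/-! ### The risk as a sum over the coefficients -/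

section Risk

variable {Φ : Generators} (hΦ : IsAdmissible Φ)
include hΦ

/-- A wavelet whose support misses all points has empirical coefficient 0, and each point meets
finitely many supports up to level `J`. The estimator is therefore a finite sum, and its
coefficients can be read off by biorthogonality. -/
lemma finite_support_coeffTilde {N : Set ℝ} (hN : N.Finite) (γ : ℝ) (n : ℕ) (J : ℤ) :
    {l | coeffTilde Φ γ n N J l ≠ 0}.Finite := by
  obtain ⟨A, hA, hsupp⟩ := hΦ.ana_support
  have h1 : {l | coeffTilde Φ γ n N J l ≠ 0} ⊆
      ⋃ T ∈ N, {l : Idx | l ∈ levels J ∧ Φ.ana l T ≠ 0} := by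
    intro l hl
    have hl' : coeffTilde Φ γ n N J l ≠ 0 := hl
    unfold coeffTilde at hl'
    split_ifs at hl' with hk
    · by_contra hc
      simp only [Set.mem_iUnion, not_exists] at hc
      refine hl' ?_
      have : sumOver N (Φ.ana l) = 0 := by
        unfold sumOver
        have h0 : ∀ T : N, Φ.ana l T = 0 := fun T => by
          by_contra hT
          exact hc T T.2 ⟨hk.2, hT⟩
        simp [h0]
      rw [coeffHat, this, mul_zero]
    · exact absurd rfl hl'
  refine (hN.biUnion fun T _ => ?_).subset h1
  have h2 : {l : Idx | l ∈ levels J ∧ Φ.ana l T ≠ 0} ⊆ (fun l : Idx => l.1) ⁻¹'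
      (Set.Icc (-1) J ×ˢ Set.Icc (-⌈2 ^ J.toNat * |T| + A⌉) ⌈2 ^ J.toNat * |T| + A⌉) := by
    rintro l ⟨hl, hT⟩
    have hlJ : l.1.1 ≤ J := hl
    have h3 : |2 ^ lev l * T - l.1.2| ≤ A := by
      by_contra hc
      exact hT (hsupp l T (not_le.1 hc)).1
    have h4 : |(l.1.2 : ℝ)| ≤ 2 ^ J.toNat * |T| + A := by
      have h5 : |(l.1.2 : ℝ)| ≤ |2 ^ lev l * T| + |2 ^ lev l * T - l.1.2| := by
        have := abs_sub (2 ^ lev l * T) (2 ^ lev l * T - l.1.2)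
        simpa using this
      have h6 : |2 ^ lev l * T| ≤ 2 ^ J.toNat * |T| := by
        rw [abs_mul, abs_of_pos (by positivity)]
        have : lev l ≤ J.toNat := by unfold lev; omega
        gcongr
        exact one_le_two
      linarith
    have h7 := abs_le.1 (h4.trans (Int.le_ceil _))
    refine ⟨⟨l.2, hlJ⟩, ?_, ?_⟩
    · have := h7.1; exact_mod_cast this
    · have := h7.2; exact_mod_cast this
  exact ((((Set.finite_Icc _ _).prod (Set.finite_Icc _ _))).preimage
    Subtype.val_injective.injOn).subset h2

lemma estimator_eq_sum {N : Set ℝ} (hN : N.Finite) (γ : ℝ) (n : ℕ) (J : ℤ) :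
    estimator Φ γ n N J = fun x => ∑ l ∈ (finite_support_coeffTilde hΦ hN γ n J).toFinset,
      coeffTilde Φ γ n N J l * Φ.syn l x := by
  funext x
  unfold estimator
  refine tsum_eq_sum fun l hl => ?_
  have : coeffTilde Φ γ n N J l = 0 := by simpa using hl
  rw [this, zero_mul]

lemma memLp_estimator {N : Set ℝ} (hN : N.Finite) (γ : ℝ) (n : ℕ) (J : ℤ) :
    MemLp (estimator Φ γ n N J) 2 volume := by
  rw [estimator_eq_sum hΦ hN]
  exact hΦ.memLp_sum_syn _ _

lemma coeff_estimator {N : Set ℝ} (hN : N.Finite) (γ : ℝ) (n : ℕ) (J : ℤ) (l : Idx) :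
    Φ.coeff (estimator Φ γ n N J) l = coeffTilde Φ γ n N J l := by
  classical
  rw [estimator_eq_sum hΦ hN, hΦ.coeff_sum_syn]
  split_ifs with h
  · rfl
  · exact (by simpa using h : coeffTilde Φ γ n N J l = 0).symm

/-- The risk is equivalent to the sum of the risks of the coefficients. -/
theorem exists_risk_equiv : ∃ C : ℝ, 0 < C ∧ ∀ (f : ℝ → ℝ), f ∈ intensities →
    ∀ {Ω : Type*} [MeasurableSpace Ω] (P : Measure Ω) (N : Ω → Set ℝ) (n : ℕ),
    IsPoissonProcess P N (meanMeasure n f) → ∀ (γ : ℝ) (J : ℤ),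
    ∑' l : Idx, ∫⁻ ω, ENNReal.ofReal ((coeffTilde Φ γ n (N ω) J l - Φ.coeff f l) ^ 2) ∂P ≤
      ENNReal.ofReal C * risk P N Φ γ n J f ∧
    risk P N Φ γ n J f ≤ ENNReal.ofReal C *
      ∑' l : Idx, ∫⁻ ω, ENNReal.ofReal ((coeffTilde Φ γ n (N ω) J l - Φ.coeff f l) ^ 2) ∂P := by
  obtain ⟨C, hC, hequiv⟩ := hΦ.exists_norm_equiv
  refine ⟨C, hC, fun f hf Ω _ P N n h γ J => ?_⟩
  have := isFiniteMeasure_meanMeasure hf n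
  have hfin := h.ae_finite (measure_ne_top _ _)
  have hω : ∀ ω, (N ω).Finite → MemLp (fun x => estimator Φ γ n (N ω) J x - f x) 2 volume ∧
      ∀ l, Φ.coeff (fun x => estimator Φ γ n (N ω) J x - f x) l =
        coeffTilde Φ γ n (N ω) J l - Φ.coeff f l := fun ω hω =>
    ⟨(memLp_estimator hΦ hω γ n J).sub hf.2.2, fun l => by
      rw [hΦ.coeff_sub (memLp_estimator hΦ hω γ n J) hf.2.2, coeff_estimator hΦ hω]⟩
  rw [← lintegral_tsum fun l => aemeasurable_coeffTilde_sub_sq hΦ hf h J l _]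
  unfold risk
  constructor
  · rw [← lintegral_const_mul' _ _ ENNReal.ofReal_ne_top]
    refine lintegral_mono_ae ?_
    filter_upwards [hfin] with ω h1
    have h2 := (hequiv _ (hω ω h1).1).1
    simpa only [(hω ω h1).2] using h2
  · rw [← lintegral_const_mul' _ _ ENNReal.ofReal_ne_top]
    refine lintegral_mono_ae ?_
    filter_upwards [hfin] with ω h1
    have h2 := (hequiv _ (hω ω h1).1).2
    simpa only [(hω ω h1).2] using h2

end Risk

/-! ### The rate -/

section Rate

lemma rate_sq (s : ℝ) (n : ℕ) : rate s n ^ 2 = (Real.log n / n) ^ (2 * s) := by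
  have : 0 ≤ Real.log n / n := div_nonneg (Real.log_natCast_nonneg n) (Nat.cast_nonneg n)
  rw [rate, ← Real.rpow_natCast, ← Real.rpow_mul this]
  congr 1
  push_cast
  ring

lemma log_div_pos {n : ℕ} (hn : 2 ≤ n) : 0 < Real.log n / n := by
  have : (1 : ℝ) < n := by exact_mod_cast hn
  exact div_pos (Real.log_pos this) (by linarith)

lemma log_div_le_one (n : ℕ) : Real.log n / n ≤ 1 :=
  div_le_one_of_le₀ (Real.log_le_self (Nat.cast_nonneg n)) (Nat.cast_nonneg n)

/-- Since 2s < 1, terms of parametric order 1/n are negligible against the squared rate. -/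
lemma inv_le_rate_sq {s : ℝ} (hs' : s < 1 / 2) {n : ℕ} (hn : 2 ≤ n) :
    1 / (n : ℝ) ≤ 1 / Real.log 2 * rate s n ^ 2 := by
  have hlog : 0 < Real.log 2 := Real.log_pos one_lt_two
  have hn2 : (2 : ℝ) ≤ n := by exact_mod_cast hn
  rw [rate_sq s n]
  have h1 : Real.log n / n ≤ (Real.log n / n) ^ (2 * s) := by
    conv_lhs => rw [← Real.rpow_one (Real.log n / n)]
    exact Real.rpow_le_rpow_of_exponent_ge (log_div_pos hn) (log_div_le_one n) (by linarith)
  have h2 : Real.log 2 / n ≤ Real.log n / n := by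
    gcongr
  have h3 : 1 / (n : ℝ) = 1 / Real.log 2 * (Real.log 2 / n) := by field_simp
  rw [h3]
  exact mul_le_mul_of_nonneg_left (h2.trans h1) (by positivity)

/-- Take the integer before the first m ≥ 3 at which log m / m drops below x; one step changes the
quotient by a factor at most 2. Bounds known only along this sequence thereby extend to a continuous
parameter. -/
lemma exists_le_log_div_le {x : ℝ} (hx : 0 < x) (hx' : x < Real.log 3 / 3) :
    ∃ n : ℕ, 2 ≤ n ∧ x ≤ Real.log n / n ∧ Real.log n / n ≤ 2 * x := by
  classical
  have hlim : Tendsto (fun n : ℕ => Real.log n / n) atTop (𝓝 0) :=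
    Real.isLittleO_log_id_atTop.tendsto_div_nhds_zero.comp tendsto_natCast_atTop_atTop
  have hex : ∃ m : ℕ, 3 ≤ m ∧ Real.log m / m < x :=
    ((eventually_ge_atTop 3).and (hlim.eventually_lt_const hx)).exists
  obtain ⟨h3, hlt⟩ := Nat.find_spec hex
  set m := Nat.find hex with hm
  have hne : m ≠ 3 := by
    intro h
    rw [h] at hlt
    exact absurd hx' (not_lt.2 (by exact_mod_cast hlt.le))
  have hmin := Nat.find_min hex (m := m - 1) (by omega)
  have hge : x ≤ Real.log (m - 1 : ℕ) / (m - 1 : ℕ) := by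
    by_contra hc
    exact hmin ⟨by omega, not_le.1 hc⟩
  refine ⟨m - 1, by omega, hge, ?_⟩
  have hm1 : (1 : ℝ) ≤ (m - 1 : ℕ) := by exact_mod_cast (by omega : 1 ≤ m - 1)
  have hcast : (m : ℝ) = (m - 1 : ℕ) + 1 := by exact_mod_cast (by omega : m = m - 1 + 1)
  have h1 : Real.log (m - 1 : ℕ) ≤ Real.log m := Real.log_le_log (by linarith) (by linarith)
  have h2 : Real.log m < x * m := (div_lt_iff₀ (by linarith)).1 hlt
  rw [div_le_iff₀ (by linarith)]
  calc _ ≤ x * m := h1.trans h2.le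
    _ ≤ x * (2 * (m - 1 : ℕ)) := by
        refine mul_le_mul_of_nonneg_left ?_ hx.le
        linarith
    _ = _ := by ring

lemma exists_rpow_neg_mul_log_rpow_le {δ : ℝ} (hδ : 0 < δ) (a : ℝ) :
    ∃ K : ℝ, 0 < K ∧ ∀ n : ℕ, (n : ℝ) ^ (-δ) * Real.log n ^ a ≤ K := by
  have hlim : Tendsto (fun n : ℕ => Real.log n ^ a / (n : ℝ) ^ δ) atTop (𝓝 0) :=
    (isLittleO_log_rpow_rpow_atTop a hδ).tendsto_div_nhds_zero.comp tendsto_natCast_atTop_atTop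
  obtain ⟨K, hK⟩ := hlim.bddAbove_range
  refine ⟨max K 1, by positivity, fun n => ?_⟩
  rw [Real.rpow_neg (Nat.cast_nonneg n), mul_comm, ← div_eq_mul_inv]
  exact (hK ⟨n, rfl⟩).trans (le_max_left _ _)

end Rate

/-! ### Monotonicity of the balls -/

section Mono

variable {Φ : Generators} {f : ℝ → ℝ} {s R R' : ℝ}

lemma ballW_mono (hs' : s < 1 / 2) (hR : 0 ≤ R) (h : R ≤ R') : ballW Φ s R ⊆ ballW Φ s R' := by
  refine fun f hf => ⟨hf.1, fun t ht => (hf.2 t ht).trans (ENNReal.ofReal_le_ofReal ?_)⟩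
  have := Real.rpow_le_rpow hR h (by linarith : 0 ≤ 2 - 4 * s)
  gcongr

lemma ballB_mono {j₀ : ℕ → ℤ} (hR : 0 ≤ R) (h : R ≤ R') : ballB Φ j₀ s R ⊆ ballB Φ j₀ s R' := by
  refine fun f hf => ⟨hf.1, fun n hn => (hf.2 n hn).trans (ENNReal.ofReal_le_ofReal ?_)⟩
  gcongr

end Mono

/-! ### From the maxiset to the function spaces -/

section Necessary

variable {Φ : Generators} (hΦ : IsAdmissible Φ) {γ : ℝ} {j₀ : ℕ → ℤ}
  {Ω : (ℝ → ℝ) → ℕ → Type*} [∀ f n, MeasurableSpace (Ω f n)]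
  {P : ∀ f n, Measure (Ω f n)} {N : ∀ f n, Ω f n → Set ℝ}
  (hN : ∀ f ∈ intensities, ∀ n : ℕ, 1 ≤ n → IsPoissonProcess (P f n) (N f n) (meanMeasure n f))
  {s : ℝ}

lemma coeffTilde_of_notMem (γ : ℝ) (n : ℕ) (N : Set ℝ) {J : ℤ} {l : Idx} (hl : l ∉ levels J) :
    coeffTilde Φ γ n N J l = 0 := by
  unfold coeffTilde
  rw [if_neg fun h => hl h.2]

include hΦ hN in
-- A coefficient above the cutoff is estimated by 0, so its squared error is deterministically β².
lemma exists_ballMS_subset_ballB (γ : ℝ) (j₀ : ℕ → ℤ) (s : ℝ) :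
    ∃ C : ℝ, 0 < C ∧ ∀ R, 0 < R → ballMS P N Φ γ j₀ s R ⊆ ballB Φ j₀ s (C * R) := by
  obtain ⟨C, hC, hrisk⟩ := exists_risk_equiv hΦ
  refine ⟨Real.sqrt C, Real.sqrt_pos.2 hC, fun R hR f hf => ⟨hf.1, fun n hn => ?_⟩⟩
  have h := hN f hf.1 n (by omega)
  have hP := h.isProbabilityMeasure
  rw [tsum_subtype ((levels (j₀ n))ᶜ) fun l => ENNReal.ofReal (Φ.coeff f l ^ 2)]
  calc _ ≤ ∑' l : Idx, ∫⁻ ω,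
        ENNReal.ofReal ((coeffTilde Φ γ n (N f n ω) (j₀ n) l - Φ.coeff f l) ^ 2) ∂P f n := by
        refine ENNReal.tsum_le_tsum fun l => ?_
        by_cases hl : l ∈ levels (j₀ n)
        · rw [Set.indicator_of_notMem (by simpa using hl)]
          exact zero_le
        · rw [Set.indicator_of_mem (by simpa using hl)]
          simp [coeffTilde_of_notMem _ _ _ hl]
    _ ≤ ENNReal.ofReal C * ENNReal.ofReal (R ^ 2 * rate s n ^ 2) :=
        ((hrisk f hf.1 _ _ n h γ (j₀ n)).1).trans (by gcongr; exact hf.2 n hn)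
    _ = _ := by
        rw [← ENNReal.ofReal_mul hC.le, mul_pow, Real.sq_sqrt hC.le, mul_assoc]

include hΦ hN in
-- Every β counted at the parameter t is a small coefficient for a sample size n with log n / n
-- comparable to t², so thresholding pays at least half of β² for it.
lemma exists_ballMS_tsum_le (hγ : 1 ≤ γ) (j₀ : ℕ → ℤ) (hs : 0 < s) (hs' : s < 1 / 2) :
    ∃ K : ℝ, 0 < K ∧ ∀ R, 0 < R → ∀ f ∈ ballMS P N Φ γ j₀ s R ∩ ballL2 R, ∀ t : ℝ, 0 < t →
      ∑' l : Idx, {l | |Φ.coeff f l| ≤ sigma Φ f l * t}.indicator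
        (fun l => ENNReal.ofReal (Φ.coeff f l ^ 2)) l ≤
      ENNReal.ofReal (K * R ^ 2 * t ^ (4 * s)) := by
  classical
  obtain ⟨C₁, hC₁, hnorm⟩ := hΦ.exists_norm_equiv
  obtain ⟨C₂, hC₂, hrisk⟩ := exists_risk_equiv hΦ
  have hlog3 : 0 < Real.log 3 := Real.log_pos (by norm_num)
  set κ : ℝ := (Real.log 3 / 6) ^ (2 * s) with hκ
  have hκ0 : 0 < κ := Real.rpow_pos_of_pos (by positivity) _
  refine ⟨C₁ / κ + 8 * C₂, by positivity, fun R hR f hf t ht => ?_⟩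
  have hγ0 : 0 < γ := by linarith
  have hts : t ^ (4 * s) = (t ^ 2) ^ (2 * s) := by
    rw [← Real.rpow_natCast, ← Real.rpow_mul ht.le]
    congr 1
    push_cast
    ring
  have ht4 : 0 < t ^ (4 * s) := Real.rpow_pos_of_pos ht _
  -- For t bounded below, t^(4s) is too, and the L² bound is enough. Otherwise log n / n ≥ 2t²/γ,
  -- which is exactly t ≤ √(2γ log n / n) / 2.
  rcases le_or_gt (Real.log 3 / 3) (2 * t ^ 2 / γ) with hx | hx
  · have h1 : κ ≤ t ^ (4 * s) := by
      rw [hts]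
      refine Real.rpow_le_rpow (by positivity) ?_ (by linarith)
      rw [le_div_iff₀ hγ0] at hx
      nlinarith
    calc _ ≤ ∑' l : Idx, ENNReal.ofReal (Φ.coeff f l ^ 2) :=
          ENNReal.tsum_le_tsum (Set.indicator_le_self _ _)
      _ ≤ ENNReal.ofReal C₁ * ENNReal.ofReal R ^ 2 :=
          (hnorm f hf.2.1).1.trans (by gcongr; exact hf.2.2)
      _ = ENNReal.ofReal (C₁ * R ^ 2) := by
          rw [← ENNReal.ofReal_pow hR.le, ← ENNReal.ofReal_mul hC₁.le]
      _ ≤ _ := by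
          refine ENNReal.ofReal_le_ofReal ?_
          calc C₁ * R ^ 2 = C₁ / κ * R ^ 2 * κ := by field_simp
            _ ≤ C₁ / κ * R ^ 2 * t ^ (4 * s) := by gcongr
            _ ≤ _ := by
              gcongr
              linarith
  · obtain ⟨n, hn, hn1, hn2⟩ := exists_le_log_div_le (by positivity) hx
    have h := hN f hf.1.1 n (by omega)
    have hsqrt : t ≤ Real.sqrt (2 * γ * Real.log n / n) / 2 := by
      rw [le_div_iff₀ two_pos]
      refine Real.le_sqrt_of_sq_le ?_
      rw [div_le_iff₀ hγ0] at hn1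
      rw [mul_div_assoc]
      nlinarith
    calc _ ≤ ∑' l : Idx, 2 * ∫⁻ ω,
          ENNReal.ofReal ((coeffTilde Φ γ n (N f n ω) (j₀ n) l - Φ.coeff f l) ^ 2) ∂P f n := by
          refine ENNReal.tsum_le_tsum fun l => ?_
          by_cases hl : l ∈ {l | |Φ.coeff f l| ≤ sigma Φ f l * t}
          · rw [Set.indicator_of_mem hl]
            refine sq_coeff_le_lintegral hΦ hf.1.1 h hn hγ _ _ ?_
            exact (show |Φ.coeff f l| ≤ sigma Φ f l * t from hl).trans
              (mul_le_mul_of_nonneg_left hsqrt (sigma_nonneg _))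
          · rw [Set.indicator_of_notMem hl]
            exact zero_le
      _ ≤ 2 * (ENNReal.ofReal C₂ * ENNReal.ofReal (R ^ 2 * rate s n ^ 2)) := by
          rw [ENNReal.tsum_mul_left]
          gcongr
          exact ((hrisk f hf.1.1 _ _ n h γ (j₀ n)).1).trans (by gcongr; exact hf.1.2 n hn)
      _ = ENNReal.ofReal (2 * (C₂ * (R ^ 2 * rate s n ^ 2))) := by
          rw [← ENNReal.ofReal_mul hC₂.le, ENNReal.ofReal_mul zero_le_two]
          simp
      _ ≤ _ := by
          refine ENNReal.ofReal_le_ofReal ?_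
          have h2 : rate s n ^ 2 ≤ 4 * t ^ (4 * s) := by
            rw [rate_sq s n, hts]
            calc (Real.log n / n) ^ (2 * s) ≤ (4 * t ^ 2) ^ (2 * s) := by
                  refine Real.rpow_le_rpow (log_div_pos hn).le (hn2.trans ?_) (by linarith)
                  calc 2 * (2 * t ^ 2 / γ) = 4 * t ^ 2 / γ := by ring
                    _ ≤ _ := div_le_self (by positivity) hγ
              _ = 4 ^ (2 * s) * (t ^ 2) ^ (2 * s) :=
                  Real.mul_rpow (by norm_num) (by positivity)
              _ ≤ 4 ^ (1 : ℝ) * (t ^ 2) ^ (2 * s) := by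
                  gcongr
                  · norm_num
                  · linarith
              _ = _ := by rw [Real.rpow_one]
          calc 2 * (C₂ * (R ^ 2 * rate s n ^ 2)) ≤ 2 * (C₂ * (R ^ 2 * (4 * t ^ (4 * s)))) := by
                gcongr
            _ = 8 * C₂ * R ^ 2 * t ^ (4 * s) := by ring
            _ ≤ _ := by
              gcongr
              have : 0 < C₁ / κ := by positivity
              linarith

include hΦ hN in
lemma exists_ballMS_subset (hγ : 1 ≤ γ) (j₀ : ℕ → ℤ) (hs : 0 < s) (hs' : s < 1 / 2) {R : ℝ}
    (hR : 0 < R) :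
    ∃ R' : ℝ, 0 < R' ∧ ballMS P N Φ γ j₀ s R ∩ ballL2 R ⊆ ballB Φ j₀ s R' ∩ ballW Φ s R' := by
  classical
  obtain ⟨C, hC, hB⟩ := exists_ballMS_subset_ballB hΦ hN γ j₀ s
  obtain ⟨K, hK, hW⟩ := exists_ballMS_tsum_le hΦ hN hγ j₀ hs hs'
  -- Adjusts the radius to the normalisation R^(2 - 4s) of the weak Besov balls.
  set r := (K * R ^ 2) ^ (1 / (2 - 4 * s)) with hr
  have hr0 : 0 < r := Real.rpow_pos_of_pos (by positivity) _
  have hrpow : r ^ (2 - 4 * s) = K * R ^ 2 := by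
    rw [hr, ← Real.rpow_mul (by positivity), one_div_mul_cancel (by linarith), Real.rpow_one]
  refine ⟨max (C * R) r, by positivity, fun f hf => ⟨?_, ?_⟩⟩
  · exact ballB_mono (by positivity) (le_max_left _ _) (hB R hR hf.1)
  · refine ballW_mono hs' hr0.le (le_max_right _ _) ⟨hf.1.1, fun t ht => ?_⟩
    rw [hrpow]
    refine le_trans (ENNReal.tsum_le_tsum fun l => ?_) (hW R hR f hf t ht)
    simp only [Set.indicator_apply, Set.mem_ofPred_eq]
    split_ifs <;> simp

end Necessary

/-! ### From the function spaces to the maxiset -/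

section Sufficient

variable {Φ : Generators} {s : ℝ}

/-- The weak Besov condition controls only the coefficients with |β| ≤ σt. The larger ones are
sorted into layers |β| ≤ σ2^i t, where σ²t² is at most 4^(1-i) β². The layers sum like (2^(4s)/4)^i,
which converges because s < 1/2. -/
lemma tsum_min_le (hs' : s < 1 / 2) {R : ℝ} (hR : 0 < R) {f : ℝ → ℝ} (hf : f ∈ ballW Φ s R)
    {t : ℝ} (ht : 0 < t) :
    ∑' l : Idx, ENNReal.ofReal (min (Φ.coeff f l ^ 2) (sigma Φ f l ^ 2 * t ^ 2)) ≤
      ENNReal.ofReal (4 / (1 - 2 ^ (4 * s) / 4) * R ^ (2 - 4 * s) * t ^ (4 * s)) := by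
  classical
  set q : ℝ := 2 ^ (4 * s) / 4 with hq
  have hq0 : 0 ≤ q := by positivity
  have hq1 : q < 1 := by
    rw [hq, div_lt_one (by norm_num)]
    calc (2 : ℝ) ^ (4 * s) < 2 ^ (2 : ℝ) :=
          Real.rpow_lt_rpow_of_exponent_lt one_lt_two (by linarith)
      _ = 4 := by norm_num
  have hpt : ∀ l : Idx, ENNReal.ofReal (min (Φ.coeff f l ^ 2) (sigma Φ f l ^ 2 * t ^ 2)) ≤
      ∑' i : ℕ, ENNReal.ofReal (4 * (1 / 4) ^ i) *
        (if |Φ.coeff f l| ≤ sigma Φ f l * (2 ^ i * t) then ENNReal.ofReal (Φ.coeff f l ^ 2)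
          else 0) := by
    intro l
    set β := Φ.coeff f l
    set σ := sigma Φ f l with hσ
    rcases (sigma_nonneg (Φ := Φ) (f := f) l).eq_or_lt with h0 | h0
    · have : min (β ^ 2) (σ ^ 2 * t ^ 2) ≤ 0 := by
        rw [hσ, ← h0]; simp
      rw [ENNReal.ofReal_of_nonpos this]
      exact zero_le
    · have hex : ∃ i : ℕ, |β| ≤ σ * (2 ^ i * t) := by
        obtain ⟨i, hi⟩ := pow_unbounded_of_one_lt (|β| / (σ * t)) one_lt_two
        refine ⟨i, ?_⟩
        rw [div_lt_iff₀ (mul_pos h0 ht)] at hi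
        linarith
      have hspec := Nat.find_spec hex
      -- The least layer containing β: for i > 0 the previous layer fails, which bounds σt by |β| /
      -- 2^(i - 1).
      set i := Nat.find hex with hi
      refine le_trans ?_ (ENNReal.le_tsum i)
      rw [if_pos hspec, ← ENNReal.ofReal_mul (by positivity)]
      refine ENNReal.ofReal_le_ofReal ?_
      rcases Nat.eq_zero_or_pos i with hi0 | hi0
      · rw [hi0]
        refine (min_le_left _ _).trans ?_
        nlinarith [sq_nonneg β]
      · have hmin := not_le.1 (Nat.find_min hex (m := i - 1) (by omega))
        refine (min_le_right _ _).trans ?_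
        have h1 : (σ * (2 ^ (i - 1) * t)) ^ 2 ≤ β ^ 2 := by
          rw [← sq_abs β]
          exact pow_le_pow_left₀ (by positivity) hmin.le 2
        have h2 : (2 : ℝ) ^ i = 2 * 2 ^ (i - 1) := by
          rw [← pow_succ']; congr 1; omega
        have h3 : (4 : ℝ) * (1 / 4) ^ i = 1 / (2 ^ (i - 1)) ^ 2 := by
          rw [div_pow, one_pow, show (4 : ℝ) = 2 ^ 2 by norm_num, ← pow_mul, mul_comm 2 i, pow_mul,
            h2]
          field_simp
        rw [h3, one_div_mul_eq_div, le_div_iff₀ (by positivity)]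
        calc _ = (σ * (2 ^ (i - 1) * t)) ^ 2 := by ring
          _ ≤ _ := h1
  calc _ ≤ ∑' (l : Idx) (i : ℕ), ENNReal.ofReal (4 * (1 / 4) ^ i) *
        (if |Φ.coeff f l| ≤ sigma Φ f l * (2 ^ i * t) then ENNReal.ofReal (Φ.coeff f l ^ 2)
          else 0) := ENNReal.tsum_le_tsum hpt
    _ ≤ ∑' i : ℕ, ENNReal.ofReal (4 * (R ^ (2 - 4 * s) * t ^ (4 * s)) * q ^ i) := by
        rw [ENNReal.tsum_comm]
        refine ENNReal.tsum_le_tsum fun i => ?_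
        rw [ENNReal.tsum_mul_left]
        refine (mul_le_mul_right (hf.2 (2 ^ i * t) (by positivity)) _).trans_eq ?_
        rw [← ENNReal.ofReal_mul (by positivity)]
        congr 1
        have : ((2 : ℝ) ^ i * t) ^ (4 * s) = (2 ^ (4 * s)) ^ i * t ^ (4 * s) := by
          rw [Real.mul_rpow (by positivity) ht.le, ← Real.rpow_natCast, ← Real.rpow_natCast,
            ← Real.rpow_mul zero_le_two, ← Real.rpow_mul zero_le_two, mul_comm (i : ℝ)]
        rw [this, hq, div_pow, div_pow, one_pow]
        ring
    _ = _ := by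
        rw [← ENNReal.ofReal_tsum_of_nonneg (fun i => by positivity)
          ((summable_geometric_of_lt_one hq0 hq1).mul_left _), tsum_mul_left,
          tsum_geometric_of_lt_one hq0 hq1]
        congr 1
        ring

variable (hΦ : IsAdmissible Φ) {γ c c' : ℝ} {j₀ : ℕ → ℤ}
  {Ω : (ℝ → ℝ) → ℕ → Type*} [∀ f n, MeasurableSpace (Ω f n)]
  {P : ∀ f n, Measure (Ω f n)} {N : ∀ f n, Ω f n → Set ℝ}
  (hN : ∀ f ∈ intensities, ∀ n : ℕ, 1 ≤ n → IsPoissonProcess (P f n) (N f n) (meanMeasure n f))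

include hΦ hN in
-- Four contributions to the risk: the bias above the cutoff (`ballB`), the oracle minima (`ballW`),
-- the remainder in β² (the L² ball) and the remainder in σ² (the L¹ ball).
lemma exists_subset_ballMS (hc : 1 ≤ c) (hγ : c < γ) (hj₀ : IsCutoff c c' j₀)
    (hs' : s < 1 / 2) {R : ℝ} (hR : 0 < R) :
    ∃ R' : ℝ, 0 < R' ∧ ballB Φ j₀ s R ∩ ballW Φ s R ∩ ballL1 R ∩ ballL2 R ⊆
      ballMS P N Φ γ j₀ s R' := by
  obtain ⟨C₁, hC₁, hnorm⟩ := hΦ.exists_norm_equiv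
  obtain ⟨C₂, hC₂, hrisk⟩ := exists_risk_equiv hΦ
  -- Any exponent strictly between c and γ works: below γ for the oracle inequality, above c to
  -- absorb the 2^j₀ growth.
  set γ' := (c + γ) / 2 with hγ'
  obtain ⟨C₃, hC₃, hmaster⟩ := exists_lintegral_coeffTilde_sub_sq_le hΦ
    (γ := γ) (γ' := γ') (by linarith) (by linarith)
  obtain ⟨C₄, hC₄, hσ⟩ := hΦ.exists_tsum_sigma_sq_le
  obtain ⟨K, hK, hlog⟩ := exists_rpow_neg_mul_log_rpow_le (δ := γ' - c) (by linarith) (c' + 2)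
  have hlog2 : 0 < Real.log 2 := Real.log_pos one_lt_two
  set q : ℝ := 4 / (1 - 2 ^ (4 * s) / 4) with hq
  have hq0 : 0 < q := by
    have : (2 : ℝ) ^ (4 * s) < 4 := by
      calc (2 : ℝ) ^ (4 * s) < 2 ^ (2 : ℝ) :=
          Real.rpow_lt_rpow_of_exponent_lt one_lt_two (by linarith)
      _ = 4 := by norm_num
    exact div_pos (by norm_num) (by linarith)
  have hRs : 0 < R ^ (2 - 4 * s) := Real.rpow_pos_of_pos hR _
  set M : ℝ := C₂ * (R ^ 2 + C₃ * (q * R ^ (2 - 4 * s) + C₁ * R ^ 2 * (1 / Real.log 2) +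
    C₄ * R * K * (1 / Real.log 2))) with hM
  have hM0 : 0 < M := by positivity
  refine ⟨Real.sqrt M, Real.sqrt_pos.2 hM0, fun f hf => ⟨hf.1.1.1.1, fun n hn => ?_⟩⟩
  obtain ⟨⟨⟨hfB, hfW⟩, hf1⟩, hf2⟩ := hf
  have hfi := hfB.1
  have h := hN f hfi n (by omega)
  have hP := h.isProbabilityMeasure
  have hn2 : (2 : ℝ) ≤ n := by exact_mod_cast hn
  have hn0 : (0 : ℝ) < n := by linarith
  have hlogn : 0 < Real.log n := Real.log_pos (by linarith)
  set t := Real.sqrt (Real.log n / n) with ht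
  have ht0 : 0 < t := Real.sqrt_pos.2 (log_div_pos hn)
  have ht2 : t ^ 2 = Real.log n / n := Real.sq_sqrt (log_div_pos hn).le
  have ht4 : t ^ (4 * s) = rate s n ^ 2 := by
    rw [rate_sq s n, ← ht2, ← Real.rpow_natCast, ← Real.rpow_mul ht0.le]
    congr 1
    push_cast
    ring
  set e := Real.exp (-(γ' * Real.log n)) with he
  have he0 : 0 < e := Real.exp_pos _
  have hen : e = (n : ℝ) ^ (-γ') := by
    rw [he, Real.rpow_def_of_pos hn0]; congr 1; ring
  have hinv := inv_le_rate_sq hs' hn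
  have he1 : e ≤ 1 / Real.log 2 * rate s n ^ 2 := by
    refine le_trans ?_ hinv
    rw [hen, one_div, ← Real.rpow_neg_one]
    exact Real.rpow_le_rpow_of_exponent_le (by linarith) (by linarith)
  -- The product (log n)² n^(-γ') 2^j₀ is at most n^(c - γ') (log n)^(c' + 2), which is bounded; the
  -- factor 1/n left over is below the squared rate.
  have he2 : 1 / n * Real.log n ^ 2 * e * (C₄ * 2 ^ (j₀ n)) ≤
      C₄ * K * (1 / Real.log 2) * rate s n ^ 2 := by
    have h1 : Real.log n ^ 2 * e * 2 ^ (j₀ n) ≤ K := by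
      calc Real.log n ^ 2 * e * 2 ^ (j₀ n)
          ≤ Real.log n ^ 2 * e * ((n : ℝ) ^ c * Real.log n ^ c') := by
            gcongr
            exact (hj₀ n hn).1
        _ = (n : ℝ) ^ (-(γ' - c)) * Real.log n ^ (c' + 2) := by
            rw [hen, show -(γ' - c) = -γ' + c by ring, Real.rpow_add hn0, Real.rpow_add hlogn,
              Real.rpow_two]
            ring
        _ ≤ K := hlog n
    calc _ = C₄ * (Real.log n ^ 2 * e * 2 ^ (j₀ n)) * (1 / n) := by ring
      _ ≤ C₄ * K * (1 / Real.log 2 * rate s n ^ 2) := by gcongr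
      _ = _ := by ring
  have hterm : ∀ l : Idx, ∫⁻ ω,
      ENNReal.ofReal ((coeffTilde Φ γ n (N f n ω) (j₀ n) l - Φ.coeff f l) ^ 2) ∂P f n ≤
      ((levels (j₀ n))ᶜ).indicator (fun l => ENNReal.ofReal (Φ.coeff f l ^ 2)) l +
      ENNReal.ofReal C₃ * (ENNReal.ofReal (min (Φ.coeff f l ^ 2) (sigma Φ f l ^ 2 * t ^ 2)) +
        ENNReal.ofReal e * ENNReal.ofReal (Φ.coeff f l ^ 2) +
        ENNReal.ofReal (1 / n * Real.log n ^ 2 * e) *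
          (levels (j₀ n)).indicator (fun l => ENNReal.ofReal (sigma Φ f l ^ 2)) l) := by
    intro l
    by_cases hl : l ∈ levels (j₀ n)
    · refine (hmaster f hfi n hn _ _ h _ l hl).trans (le_add_left (le_of_eq ?_))
      have hmin : 0 ≤ min (Φ.coeff f l ^ 2) (sigma Φ f l ^ 2 * t ^ 2) := by positivity
      rw [Set.indicator_of_mem hl, ← ENNReal.ofReal_mul he0.le, ← ENNReal.ofReal_mul (by positivity),
        ← ENNReal.ofReal_add hmin (by positivity), ← ENNReal.ofReal_add (by positivity)
        (by positivity), ← ENNReal.ofReal_mul hC₃.le, ht2]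
      congr 1
      ring
    · refine le_add_right ?_
      rw [Set.indicator_of_mem (by simpa using hl)]
      simp [coeffTilde_of_notMem _ _ _ hl]
  refine ((hrisk f hfi _ _ n h γ (j₀ n)).2).trans ?_
  have hB := hfB.2 n hn
  rw [tsum_subtype ((levels (j₀ n))ᶜ) fun l => ENNReal.ofReal (Φ.coeff f l ^ 2)] at hB
  have hβ : ∑' l : Idx, ENNReal.ofReal (Φ.coeff f l ^ 2) ≤ ENNReal.ofReal (C₁ * R ^ 2) :=
    (hnorm f hf2.1).1.trans (by
      rw [ENNReal.ofReal_mul hC₁.le, ENNReal.ofReal_pow hR.le]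
      gcongr
      exact hf2.2)
  have hσ' : ∑' l : Idx, (levels (j₀ n)).indicator (fun l => ENNReal.ofReal (sigma Φ f l ^ 2)) l ≤
      ENNReal.ofReal (C₄ * 2 ^ (j₀ n) * R) := by
    refine (hσ f hfi (j₀ n)).trans ?_
    rw [ENNReal.ofReal_mul (p := C₄ * 2 ^ (j₀ n)) (by positivity)]
    exact mul_le_mul_right hf1.2 _
  have hmin := tsum_min_le hs' hR hfW ht0
  calc _ ≤ ENNReal.ofReal C₂ * (ENNReal.ofReal (R ^ 2 * rate s n ^ 2) + ENNReal.ofReal C₃ *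
        (ENNReal.ofReal (q * R ^ (2 - 4 * s) * t ^ (4 * s)) +
          ENNReal.ofReal e * ENNReal.ofReal (C₁ * R ^ 2) +
          ENNReal.ofReal (1 / n * Real.log n ^ 2 * e) * ENNReal.ofReal (C₄ * 2 ^ (j₀ n) * R))) := by
        gcongr
        refine (ENNReal.tsum_le_tsum hterm).trans ?_
        rw [ENNReal.tsum_add, ENNReal.tsum_mul_left, ENNReal.tsum_add, ENNReal.tsum_add,
          ENNReal.tsum_mul_left, ENNReal.tsum_mul_left]
        gcongr
    _ = ENNReal.ofReal (C₂ * (R ^ 2 * rate s n ^ 2 + C₃ * (q * R ^ (2 - 4 * s) * t ^ (4 * s) +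
          e * (C₁ * R ^ 2) + 1 / n * Real.log n ^ 2 * e * (C₄ * 2 ^ (j₀ n) * R)))) := by
        have h1 : 0 ≤ t ^ (4 * s) := Real.rpow_nonneg ht0.le _
        rw [← ENNReal.ofReal_mul he0.le, ← ENNReal.ofReal_mul (by positivity),
          ← ENNReal.ofReal_add (by positivity) (by positivity),
          ← ENNReal.ofReal_add (by positivity) (by positivity),
          ← ENNReal.ofReal_mul hC₃.le, ← ENNReal.ofReal_add (by positivity) (by positivity),
          ← ENNReal.ofReal_mul hC₂.le]
    _ ≤ _ := by
        refine ENNReal.ofReal_le_ofReal ?_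
        rw [Real.sq_sqrt hM0.le, ht4, hM]
        calc _ = C₂ * (R ^ 2 * rate s n ^ 2 + C₃ * (q * R ^ (2 - 4 * s) * rate s n ^ 2 +
          e * (C₁ * R ^ 2) + 1 / n * Real.log n ^ 2 * e * (C₄ * 2 ^ (j₀ n)) * R)) := by ring
          _ ≤ C₂ * (R ^ 2 * rate s n ^ 2 + C₃ * (q * R ^ (2 - 4 * s) * rate s n ^ 2 +
            1 / Real.log 2 * rate s n ^ 2 * (C₁ * R ^ 2) +
            C₄ * K * (1 / Real.log 2) * rate s n ^ 2 * R)) := by gcongr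
          _ = _ := by ring

end Sufficient

/-! ### The energy of a level -/

section Energy

/-- The sum of the squared coefficients at the `i`-th level, where the coarse coefficients form the
level `0`. -/
def levelEnergy (Φ : Generators) (f : ℝ → ℝ) (i : ℕ) : ℝ≥0∞ :=
  ∑' k : ℤ, ENNReal.ofReal (Φ.coeff f (idxEquiv (i, k)) ^ 2)

variable {Φ : Generators} {α : ℝ} {f : ℝ → ℝ}

lemma besovNorm_eq (Φ : Generators) (α : ℝ) (f : ℝ → ℝ) :
    besovNorm Φ α f = levelEnergy Φ f 0 ^ (1 / 2 : ℝ) +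
      ⨆ j : ℕ, ENNReal.ofReal ((2 : ℝ) ^ ((j : ℝ) * α)) *
        levelEnergy Φ f (j + 1) ^ (1 / 2 : ℝ) := by
  unfold besovNorm levelEnergy
  congr 1
  refine iSup_congr fun j => ?_
  have : ∀ k : ℤ, idxEquiv (j + 1, k) = ⟨((j : ℤ), k), by simp only; omega⟩ := fun k =>
    Subtype.ext (Prod.ext (by simp [idxEquiv]) rfl)
  simp only [this]

lemma rpow_half_le_ofReal {S : ℝ≥0∞} {m : ℝ} (hm : 0 ≤ m) (h : S ≤ ENNReal.ofReal (m ^ 2)) :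
    S ^ (1 / 2 : ℝ) ≤ ENNReal.ofReal m := by
  calc S ^ (1 / 2 : ℝ) ≤ ENNReal.ofReal (m ^ 2) ^ (1 / 2 : ℝ) :=
        ENNReal.rpow_le_rpow h (by norm_num)
    _ = ENNReal.ofReal m := by
        rw [ENNReal.ofReal_rpow_of_nonneg (by positivity) (by norm_num), ← Real.sqrt_eq_rpow,
          Real.sqrt_sq hm]

lemma le_ofReal_sq_of_rpow_half {S : ℝ≥0∞} {m : ℝ} (hm : 0 ≤ m)
    (h : S ^ (1 / 2 : ℝ) ≤ ENNReal.ofReal m) : S ≤ ENNReal.ofReal (m ^ 2) := by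
  have h1 := ENNReal.rpow_le_rpow h (zero_le_two (α := ℝ))
  rwa [← ENNReal.rpow_mul, one_div_mul_cancel two_ne_zero, ENNReal.rpow_one, ENNReal.rpow_two,
    ← ENNReal.ofReal_pow hm] at h1

lemma two_rpow_mul_pow (α : ℝ) (j : ℕ) : (2 : ℝ) ^ ((j : ℝ) * α) * (2 ^ (-α)) ^ j = 1 := by
  rw [← Real.rpow_natCast, ← Real.rpow_mul zero_le_two, ← Real.rpow_add two_pos]
  simp [mul_comm]

lemma besovNorm_le (hα : 0 < α) {M : ℝ} (hM : 0 ≤ M)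
    (h : ∀ i, levelEnergy Φ f i ≤ ENNReal.ofReal ((M * (2 ^ (-α)) ^ i) ^ 2)) :
    besovNorm Φ α f ≤ ENNReal.ofReal (2 * M) := by
  have hp : (2 : ℝ) ^ (-α) ≤ 1 := Real.rpow_le_one_of_one_le_of_nonpos one_le_two (by linarith)
  have hp0 : 0 < (2 : ℝ) ^ (-α) := Real.rpow_pos_of_pos two_pos _
  rw [besovNorm_eq, two_mul, ENNReal.ofReal_add hM hM]
  refine add_le_add ?_ (iSup_le fun j => ?_)
  · simpa using rpow_half_le_ofReal (by positivity) (h 0)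
  · calc _ ≤ ENNReal.ofReal ((2 : ℝ) ^ ((j : ℝ) * α)) *
          ENNReal.ofReal (M * (2 ^ (-α)) ^ (j + 1)) := by
          gcongr
          exact rpow_half_le_ofReal (by positivity) (h (j + 1))
      _ = ENNReal.ofReal ((2 : ℝ) ^ ((j : ℝ) * α) * (2 ^ (-α)) ^ j * (M * 2 ^ (-α))) := by
          rw [← ENNReal.ofReal_mul (by positivity)]
          congr 1
          ring
      _ ≤ ENNReal.ofReal M := by
          refine ENNReal.ofReal_le_ofReal ?_
          rw [two_rpow_mul_pow, one_mul]
          exact mul_le_of_le_one_right hM hp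

/-- Level `i` here is level i - 1 of the wavelet norm; the shift costs 2^α ≤ 2, hence the factor 2.
-/
lemma levelEnergy_le (hα1 : α ≤ 1) {R : ℝ} (hR : 0 ≤ R)
    (h : besovNorm Φ α f ≤ ENNReal.ofReal R) (i : ℕ) :
    levelEnergy Φ f i ≤ ENNReal.ofReal ((2 * R * (2 ^ (-α)) ^ i) ^ 2) := by
  rw [besovNorm_eq] at h
  have hp0 : 0 < (2 : ℝ) ^ (-α) := Real.rpow_pos_of_pos two_pos _
  rcases i with _ | j
  · refine (le_ofReal_sq_of_rpow_half hR (le_self_add.trans h)).trans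
      (ENNReal.ofReal_le_ofReal ?_)
    rw [pow_zero, mul_one]
    gcongr
    linarith
  · have h1 : ENNReal.ofReal ((2 : ℝ) ^ ((j : ℝ) * α)) * levelEnergy Φ f (j + 1) ^ (1 / 2 : ℝ) ≤
        ENNReal.ofReal R :=
      (le_iSup (fun j : ℕ => ENNReal.ofReal ((2 : ℝ) ^ ((j : ℝ) * α)) *
        levelEnergy Φ f (j + 1) ^ (1 / 2 : ℝ)) j).trans (le_add_self.trans h)
    refine le_ofReal_sq_of_rpow_half (by positivity) ?_
    have h2 : (1 : ℝ) ≤ 2 * 2 ^ (-α) := by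
      calc (1 : ℝ) = 2 * 2 ^ (-1 : ℝ) := by rw [Real.rpow_neg_one]; norm_num
        _ ≤ _ := by
          gcongr
          exact one_le_two
    calc levelEnergy Φ f (j + 1) ^ (1 / 2 : ℝ) = ENNReal.ofReal ((2 ^ (-α)) ^ j) *
          (ENNReal.ofReal ((2 : ℝ) ^ ((j : ℝ) * α)) * levelEnergy Φ f (j + 1) ^ (1 / 2 : ℝ)) := by
          rw [← mul_assoc, ← ENNReal.ofReal_mul (by positivity), mul_comm (_ ^ j),
            two_rpow_mul_pow, ENNReal.ofReal_one, one_mul]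
      _ ≤ ENNReal.ofReal ((2 ^ (-α)) ^ j) * ENNReal.ofReal R := by gcongr
      _ = ENNReal.ofReal (R * (2 ^ (-α)) ^ j * 1) := by
          rw [← ENNReal.ofReal_mul (by positivity)]
          congr 1
          ring
      _ ≤ ENNReal.ofReal (R * (2 ^ (-α)) ^ j * (2 * 2 ^ (-α))) := by
          refine ENNReal.ofReal_le_ofReal ?_
          gcongr
      _ = _ := by
          congr 1
          ring

lemma tsum_compl_levels_eq (J : ℤ) :
    ∑' l : Idx, ((levels J)ᶜ).indicator (fun l => ENNReal.ofReal (Φ.coeff f l ^ 2)) l =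
      ∑' i : ℕ, if J < (i : ℤ) - 1 then levelEnergy Φ f i else 0 := by
  rw [tsum_idx_eq]
  refine tsum_congr fun i => ?_
  have hmem : ∀ k, idxEquiv (i, k) ∈ (levels J)ᶜ ↔ J < (i : ℤ) - 1 := fun k => by
    simp only [levels, idxEquiv, Equiv.coe_fn_mk, Set.mem_compl_iff, Set.mem_ofPred_eq, not_le]
  split_ifs with h
  · exact tsum_congr fun k => Set.indicator_of_mem ((hmem k).2 h) _
  · exact ENNReal.tsum_eq_zero.2 fun k => Set.indicator_of_notMem (fun h' => h ((hmem k).1 h')) _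

end Energy

/-! ### The spaces of the cutoff for `c' = -c` -/

section Cutoff

variable {Φ : Generators} {c s : ℝ} {j₀ : ℕ → ℤ}

lemma sq_two_rpow_neg_pow (c s : ℝ) (i : ℕ) :
    (((2 : ℝ) ^ (-(s / c))) ^ i) ^ 2 = ((2 : ℝ) ^ (-(i / c))) ^ (2 * s) := by
  rw [← Real.rpow_natCast, ← Real.rpow_natCast, ← Real.rpow_mul zero_le_two,
    ← Real.rpow_mul zero_le_two, ← Real.rpow_mul zero_le_two]
  congr 1
  push_cast
  ring

/-- For c' = -c the cutoff is a power of log n / n alone, the same quantity that defines the rate.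
-/
lemma cutoff_eq (c : ℝ) {n : ℕ} (hn : 2 ≤ n) :
    (n : ℝ) ^ c * Real.log n ^ (-c) = (Real.log n / n) ^ (-c) := by
  have hn1 : (1 : ℝ) < n := by exact_mod_cast hn
  rw [Real.div_rpow (Real.log_nonneg hn1.le) (by linarith), Real.rpow_neg (x := (n : ℝ)) (by linarith)]
  field_simp

/-- The energy of one level is at most the tail beyond a cutoff just below it. The sample size is
chosen with log n / n comparable to 2^(-i/c); the coarse levels for which none exists are covered by
the L² norm. -/
lemma exists_levelEnergy_le (hΦ : IsAdmissible Φ) (hc : 1 ≤ c) (hj₀ : IsCutoff c (-c) j₀)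
    (hs : 0 < s) (hs' : s < 1 / 2) :
    ∃ K : ℝ, 0 < K ∧ ∀ R, 0 < R → ∀ f ∈ ballB Φ j₀ s R ∩ ballL2 R, ∀ i,
      levelEnergy Φ f i ≤ ENNReal.ofReal ((K * R * (2 ^ (-(s / c))) ^ i) ^ 2) := by
  obtain ⟨C₁, hC₁, hnorm⟩ := hΦ.exists_norm_equiv
  have hlog3 : 0 < Real.log 3 := Real.log_pos (by norm_num)
  set κ : ℝ := (Real.log 3 / 12) ^ (2 * s) with hκ
  have hκ0 : 0 < κ := Real.rpow_pos_of_pos (by positivity) _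
  refine ⟨Real.sqrt (C₁ / κ + 8), Real.sqrt_pos.2 (by positivity), fun R hR f hf i => ?_⟩
  have hfB := hf.1.2
  have hc0 : 0 < c := by linarith
  rw [mul_pow, mul_pow, Real.sq_sqrt (by positivity), sq_two_rpow_neg_pow]
  set y : ℝ := 2 ^ (-(i / c)) with hy
  have hy0 : 0 < y := Real.rpow_pos_of_pos two_pos _
  have hy1 : 0 < y ^ (2 * s) := Real.rpow_pos_of_pos hy0 _
  rcases le_or_gt (Real.log 3 / 3) (4 * y) with hx | hx
  · have h1 : κ ≤ y ^ (2 * s) := Real.rpow_le_rpow (by positivity) (by linarith) (by linarith)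
    calc levelEnergy Φ f i ≤ ∑' l : Idx, ENNReal.ofReal (Φ.coeff f l ^ 2) := by
          rw [tsum_idx_eq]
          exact ENNReal.le_tsum (f := levelEnergy Φ f) i
      _ ≤ ENNReal.ofReal C₁ * ENNReal.ofReal R ^ 2 :=
          (hnorm f hf.2.1).1.trans (by gcongr; exact hf.2.2)
      _ = ENNReal.ofReal (C₁ * R ^ 2) := by
          rw [← ENNReal.ofReal_pow hR.le, ← ENNReal.ofReal_mul hC₁.le]
      _ ≤ _ := by
          refine ENNReal.ofReal_le_ofReal ?_
          calc C₁ * R ^ 2 = C₁ / κ * R ^ 2 * κ := by field_simp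
            _ ≤ C₁ / κ * R ^ 2 * y ^ (2 * s) := by gcongr
            _ ≤ _ := by
              gcongr
              linarith
  · obtain ⟨n, hn, hn1, hn2⟩ := exists_le_log_div_le (by positivity) hx
    have hB := hfB n hn
    rw [tsum_subtype ((levels (j₀ n))ᶜ) fun l => ENNReal.ofReal (Φ.coeff f l ^ 2),
      tsum_compl_levels_eq] at hB
    -- The factor 4 in log n / n ≥ 4y makes 2^j₀ at most 2^i / 4, so this level lies strictly above
    -- the cutoff.
    have hlt : j₀ n < (i : ℤ) - 1 := by
      have h1 := (hj₀ n hn).1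
      rw [cutoff_eq c hn] at h1
      have h2 : (2 : ℝ) ^ j₀ n < 2 ^ ((i : ℤ) - 1) := by
        calc (2 : ℝ) ^ j₀ n ≤ (Real.log n / n) ^ (-c) := h1
          _ ≤ (4 * y) ^ (-c) :=
              Real.rpow_le_rpow_of_nonpos (by positivity) hn1 (by linarith)
          _ = 4 ^ (-c) * 2 ^ (i : ℝ) := by
              rw [Real.mul_rpow (by norm_num) hy0.le, hy, ← Real.rpow_mul zero_le_two]
              congr 2
              field_simp
          _ ≤ 4 ^ (-1 : ℝ) * 2 ^ (i : ℝ) := by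
              gcongr
              norm_num
          _ < 2⁻¹ * 2 ^ (i : ℝ) := by
              gcongr
              rw [Real.rpow_neg_one]; norm_num
          _ = 2 ^ ((i : ℤ) - 1) := by
              rw [zpow_sub_one₀ two_ne_zero, Real.rpow_natCast, zpow_natCast, mul_comm]
      exact (zpow_lt_zpow_iff_right₀ one_lt_two).1 h2
    have h3 := (ENNReal.le_tsum i).trans hB
    rw [if_pos hlt] at h3
    refine h3.trans (ENNReal.ofReal_le_ofReal ?_)
    have h4 : rate s n ^ 2 ≤ 8 * y ^ (2 * s) := by
      rw [rate_sq s n]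
      calc (Real.log n / n) ^ (2 * s) ≤ (8 * y) ^ (2 * s) := by
            refine Real.rpow_le_rpow (log_div_pos hn).le (hn2.trans ?_) (by linarith)
            linarith
        _ = 8 ^ (2 * s) * y ^ (2 * s) := Real.mul_rpow (by norm_num) hy0.le
        _ ≤ 8 ^ (1 : ℝ) * y ^ (2 * s) := by
            gcongr
            · norm_num
            · linarith
        _ = _ := by rw [Real.rpow_one]
    calc R ^ 2 * rate s n ^ 2 ≤ R ^ 2 * (8 * y ^ (2 * s)) := by gcongr
      _ = 8 * R ^ 2 * y ^ (2 * s) := by ring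
      _ ≤ _ := by
        gcongr
        have : 0 < C₁ / κ := by positivity
        linarith

/-- The tail beyond j₀ is a geometric series, dominated by its first term 2^(-2 i₀ s/c), and the
upper half of the cutoff condition compares this term with the squared rate. -/
lemma exists_ballBesov_subset_ballB (hc : 1 ≤ c) (hj₀ : IsCutoff c (-c) j₀)
    (hs : 0 < s) (hs' : s < 1 / 2) :
    ∃ K : ℝ, 0 < K ∧ ∀ R, 0 < R → ballBesov Φ (s / c) R ⊆ ballB Φ j₀ s (K * R) := by
  have hc0 : 0 < c := by linarith
  set α := s / c with hα
  have hα0 : 0 < α := by positivity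
  have hα1 : α ≤ 1 := (div_le_self hs.le hc).trans (by linarith)
  set p : ℝ := 2 ^ (-α) with hp
  have hp0 : 0 < p := Real.rpow_pos_of_pos two_pos _
  have hp1 : p < 1 := Real.rpow_lt_one_of_one_lt_of_neg one_lt_two (by linarith)
  have hp2 : p ^ 2 < 1 := pow_lt_one₀ hp0.le hp1 two_ne_zero
  refine ⟨Real.sqrt (4 / (1 - p ^ 2)), Real.sqrt_pos.2 (div_pos (by norm_num) (by linarith)),
    fun R hR f hf => ⟨hf.1, fun n hn => ?_⟩⟩
  have hE := levelEnergy_le hα1 hR.le hf.2.2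
  rw [tsum_subtype ((levels (j₀ n))ᶜ) fun l => ENNReal.ofReal (Φ.coeff f l ^ 2),
    tsum_compl_levels_eq, mul_pow, Real.sq_sqrt (div_nonneg (by norm_num) (by linarith))]
  -- The first shifted level strictly above the cutoff.
  set i₀ := (j₀ n + 2).toNat with hi₀
  have hpow : (p ^ i₀) ^ 2 ≤ rate s n ^ 2 := by
    have h1 := (hj₀ n hn).2
    rw [cutoff_eq c hn] at h1
    have hx := log_div_pos hn
    have h2 : (Real.log n / n) ^ (-c) ≤ 2 ^ (i₀ : ℝ) := by
      refine h1.le.trans ?_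
      rw [Real.rpow_natCast, ← zpow_natCast]
      exact zpow_le_zpow_right₀ one_le_two (by omega)
    have h3 : (2 : ℝ) ^ (-(i₀ / c)) ≤ Real.log n / n := by
      have h4 := Real.rpow_le_rpow_of_nonpos (Real.rpow_pos_of_pos hx _) h2
        (z := -(1 / c)) (by simp; positivity)
      rw [← Real.rpow_mul hx.le, ← Real.rpow_mul zero_le_two] at h4
      have h5 : -c * -(1 / c) = 1 := by field_simp
      rw [h5, Real.rpow_one] at h4
      convert h4 using 2
      ring
    rw [hp, hα, sq_two_rpow_neg_pow, rate_sq]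
    exact Real.rpow_le_rpow (by positivity) h3 (by linarith)
  calc _ ≤ ∑' i : ℕ, if i₀ ≤ i then ENNReal.ofReal ((2 * R * p ^ i) ^ 2) else 0 := by
        refine ENNReal.tsum_le_tsum fun i => ?_
        by_cases h : j₀ n < (i : ℤ) - 1
        · rw [if_pos h, if_pos (by omega)]
          exact hE i
        · rw [if_neg h]
          exact zero_le
    _ = ∑' i : ℕ, ENNReal.ofReal ((2 * R * p ^ (i + i₀)) ^ 2) := by
        rw [← ENNReal.summable.sum_add_tsum_nat_add' (k := i₀), Finset.sum_eq_zero, zero_add]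
        · exact tsum_congr fun i => if_pos (by omega)
        · intro i hi
          rw [if_neg (not_le.2 (Finset.mem_range.1 hi))]
    _ = ENNReal.ofReal (4 / (1 - p ^ 2) * R ^ 2 * (p ^ i₀) ^ 2) := by
        have e : ∀ i, (2 * R * p ^ (i + i₀)) ^ 2 = 4 * R ^ 2 * (p ^ i₀) ^ 2 * (p ^ 2) ^ i :=
          fun i => by ring
        simp_rw [e]
        rw [← ENNReal.ofReal_tsum_of_nonneg (fun i => by positivity)
          ((summable_geometric_of_lt_one (by positivity) hp2).mul_left _), tsum_mul_left,
          tsum_geometric_of_lt_one (by positivity) hp2]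
        congr 1
        ring
    _ ≤ _ := by
        refine ENNReal.ofReal_le_ofReal ?_
        have : 0 ≤ 4 / (1 - p ^ 2) := div_nonneg (by norm_num) (by linarith)
        gcongr

end Cutoff

/-! ### The modulus of continuity of a wavelet expansion -/

section Modulus

lemma memLp_comp_add {g : ℝ → ℝ} (hg : MemLp g 2 volume) (h : ℝ) :
    MemLp (fun x => g (x + h)) 2 volume :=
  hg.comp_measurePreserving (measurePreserving_add_right volume h)

lemma eLpNorm_shift_sub_le {g : ℝ → ℝ} (hg : MemLp g 2 volume) (h : ℝ) :
    eLpNorm (fun x => g (x + h) - g x) 2 volume ≤ 2 * eLpNorm g 2 volume := by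
  have h1 : eLpNorm (fun x => g (x + h)) 2 volume = eLpNorm g 2 volume :=
    eLpNorm_comp_measurePreserving hg.1 (measurePreserving_add_right volume h)
  calc _ ≤ eLpNorm (fun x => g (x + h)) 2 volume + eLpNorm g 2 volume :=
        eLpNorm_sub_le (memLp_comp_add hg h).1 hg.1 one_le_two
    _ = _ := by rw [h1, two_mul]

/-- Large shifts cost at most (2‖g‖₂)². Saturation at 1 is needed for the fine levels, where the
rescaled shift is large. -/
lemma exists_modulus_min {g : ℝ → ℝ} (hg : MemLp g 2 volume)
    (hmod : ∃ C : ℝ, 0 ≤ C ∧ ∀ u : ℝ,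
      ∫⁻ x, ENNReal.ofReal ((g (x + u) - g x) ^ 2) ≤ ENNReal.ofReal (C * |u|)) :
    ∃ C : ℝ, 0 ≤ C ∧ ∀ u : ℝ,
      ∫⁻ x, ENNReal.ofReal ((g (x + u) - g x) ^ 2) ≤ ENNReal.ofReal (C * min 1 |u|) := by
  obtain ⟨C, hC, h⟩ := hmod
  have hfin : (2 * eLpNorm g 2 volume) ^ 2 ≠ ∞ :=
    ENNReal.pow_ne_top (ENNReal.mul_ne_top (by simp) hg.2.ne)
  set D : ℝ := ((2 * eLpNorm g 2 volume) ^ 2).toReal with hD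
  refine ⟨max C D, le_max_of_le_left hC, fun u => ?_⟩
  rcases le_total 1 |u| with hu | hu
  · rw [min_eq_left hu, mul_one]
    calc _ ≤ (2 * eLpNorm g 2 volume) ^ 2 := by
          rw [← eLpNorm_two_sq (fun x => g (x + u) - g x)]
          gcongr
          exact eLpNorm_shift_sub_le hg u
      _ = ENNReal.ofReal D := (ENNReal.ofReal_toReal hfin).symm
      _ ≤ ENNReal.ofReal (max C D) := ENNReal.ofReal_le_ofReal (le_max_right _ _)
  · rw [min_eq_right hu]
    refine (h u).trans (ENNReal.ofReal_le_ofReal ?_)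
    gcongr
    exact le_max_left _ _

/-- A geometric sum governing the smoothness of wavelet expansions. -/
lemma exists_sum_sqrt_min_le {α : ℝ} (hα : 0 < α) (hα' : α < 1 / 2) :
    ∃ K : ℝ, 0 < K ∧ ∀ v : ℝ, 0 < v → ∀ m : ℕ,
      ∑ i ∈ Finset.range m, Real.sqrt (min 1 (2 ^ i * v)) * (2 ^ (-α)) ^ i ≤ K * v ^ α := by
  set p : ℝ := 2 ^ (-α) with hp
  have hp0 : 0 < p := Real.rpow_pos_of_pos two_pos _
  have hp1 : p < 1 := Real.rpow_lt_one_of_one_lt_of_neg one_lt_two (by linarith)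
  set r : ℝ := Real.sqrt 2 * p with hr
  have hr1 : 1 < r := by
    rw [hr, hp, Real.sqrt_eq_rpow, ← Real.rpow_add two_pos]
    exact Real.one_lt_rpow one_lt_two (by linarith)
  have hgeom : ∀ m, ∑ i ∈ Finset.range m, p ^ i ≤ 1 / (1 - p) := fun m => by
    rw [geom_sum_eq hp1.ne, ← neg_div_neg_eq, neg_sub, neg_sub]
    have : 0 < 1 - p := by linarith
    gcongr
    linarith [pow_pos hp0 m]
  have hp1' : 0 < 1 / (1 - p) := div_pos one_pos (by linarith)
  have hr1' : 0 < Real.sqrt 2 / (r - 1) := div_pos (by positivity) (by linarith)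
  refine ⟨Real.sqrt 2 / (r - 1) + 1 / (1 - p), by positivity, fun v hv m => ?_⟩
  have hterm : ∀ i : ℕ, Real.sqrt (min 1 (2 ^ i * v)) * p ^ i ≤ p ^ i := fun i =>
    mul_le_of_le_one_left (by positivity) (Real.sqrt_le_one.2 (min_le_left _ _))
  have hvα : 0 < v ^ α := Real.rpow_pos_of_pos hv _
  rcases le_or_gt 1 v with h1 | h1
  · calc _ ≤ ∑ i ∈ Finset.range m, p ^ i := Finset.sum_le_sum fun i _ => hterm i
      _ ≤ 1 / (1 - p) * 1 := by rw [mul_one]; exact hgeom m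
      _ ≤ _ := by
        gcongr
        · linarith
        · exact Real.one_le_rpow h1 hα.le
  -- Split where 2^j is about 1/v. Below, the terms grow with ratio √2 · 2^(-α) > 1, thanks to α <
  -- 1/2; above, they decay with ratio 2^(-α). Both sums are of the order of the term at the split.
  · obtain ⟨j, hj1, hj2⟩ := exists_nat_pow_near ((one_le_inv₀ hv).2 h1.le)
      (one_lt_two (α := ℝ))
    have hpJ : p ^ (j + 1) ≤ v ^ α := by
      have e : p ^ (j + 1) = ((2 : ℝ) ^ (j + 1)) ^ (-α) := by
        rw [hp, ← Real.rpow_natCast, ← Real.rpow_natCast, ← Real.rpow_mul zero_le_two,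
          ← Real.rpow_mul zero_le_two, mul_comm]
      rw [e]
      refine (Real.rpow_le_rpow_of_nonpos (inv_pos.2 hv) hj2.le (by linarith)).trans_eq ?_
      rw [Real.rpow_neg (by positivity), Real.inv_rpow hv.le, inv_inv]
    have h2J : 2 ^ (j + 1) * v ≤ 2 := by
      rw [pow_succ]
      have : 2 ^ j * v ≤ 1 := by
        calc (2 : ℝ) ^ j * v ≤ v⁻¹ * v := by gcongr
          _ = 1 := inv_mul_cancel₀ hv.ne'
      linarith
    calc _ ≤ ∑ i ∈ Finset.range (j + 1 + m), Real.sqrt (min 1 (2 ^ i * v)) * p ^ i :=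
          Finset.sum_le_sum_of_subset_of_nonneg (Finset.range_mono (by omega))
            fun i _ _ => by positivity
      _ = ∑ i ∈ Finset.range (j + 1), Real.sqrt (min 1 (2 ^ i * v)) * p ^ i +
          ∑ i ∈ Finset.range m, Real.sqrt (min 1 (2 ^ (j + 1 + i) * v)) * p ^ (j + 1 + i) :=
          Finset.sum_range_add _ _ _
      _ ≤ ∑ i ∈ Finset.range (j + 1), Real.sqrt v * r ^ i +
          ∑ i ∈ Finset.range m, p ^ (j + 1) * p ^ i := by
          refine add_le_add (Finset.sum_le_sum fun i _ => ?_) (Finset.sum_le_sum fun i _ => ?_)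
          · calc Real.sqrt (min 1 (2 ^ i * v)) * p ^ i ≤ Real.sqrt (2 ^ i * v) * p ^ i := by
                  gcongr
                  exact min_le_right _ _
              _ = Real.sqrt v * r ^ i := by
                  have : Real.sqrt (2 ^ i) = Real.sqrt 2 ^ i := by
                    rw [Real.sqrt_eq_iff_mul_self_eq (by positivity) (by positivity), ← mul_pow,
                      Real.mul_self_sqrt zero_le_two]
                  rw [Real.sqrt_mul (by positivity), this, hr, mul_pow]
                  ring
          · rw [← pow_add]
            exact hterm _
      _ ≤ Real.sqrt 2 / (r - 1) * p ^ (j + 1) + 1 / (1 - p) * p ^ (j + 1) := by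
          rw [← Finset.mul_sum, ← Finset.mul_sum, mul_comm (p ^ (j + 1))]
          refine add_le_add ?_ (by gcongr; exact hgeom m)
          have hr0 : 0 < r - 1 := by linarith
          calc Real.sqrt v * ∑ i ∈ Finset.range (j + 1), r ^ i
              ≤ Real.sqrt v * (r ^ (j + 1) / (r - 1)) := by
                rw [geom_sum_eq hr1.ne']
                gcongr
                linarith
            _ = Real.sqrt (2 ^ (j + 1) * v) * p ^ (j + 1) / (r - 1) := by
                have : Real.sqrt (2 ^ (j + 1)) = Real.sqrt 2 ^ (j + 1) := by
                  rw [Real.sqrt_eq_iff_mul_self_eq (by positivity) (by positivity), ← mul_pow,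
                    Real.mul_self_sqrt zero_le_two]
                rw [Real.sqrt_mul (by positivity), this, hr, mul_pow]
                ring
            _ ≤ Real.sqrt 2 * p ^ (j + 1) / (r - 1) := by gcongr
            _ = _ := by ring
      _ = (Real.sqrt 2 / (r - 1) + 1 / (1 - p)) * p ^ (j + 1) := by ring
      _ ≤ _ := by gcongr

namespace IsAdmissible

variable {Φ : Generators} (hΦ : IsAdmissible Φ)
include hΦ

lemma exists_lintegral_syn_shift_le : ∃ C : ℝ, 0 ≤ C ∧ ∀ (l : Idx) (h : ℝ),
    ∫⁻ x, ENNReal.ofReal ((Φ.syn l (x + h) - Φ.syn l x) ^ 2) ≤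
      ENNReal.ofReal (C * min 1 (2 ^ lev l * |h|)) := by
  obtain ⟨C₁, hC₁, h1⟩ := exists_modulus_min hΦ.memLp_φd hΦ.modulus_φd
  obtain ⟨C₂, hC₂, h2⟩ := exists_modulus_min hΦ.memLp_ψd hΦ.modulus_ψd
  refine ⟨max C₁ C₂, le_max_of_le_left hC₁, fun l h => ?_⟩
  have hp : (0 : ℝ) < 2 ^ lev l := by positivity
  have hgen : ∀ u : ℝ, ∫⁻ x, ENNReal.ofReal ((gen Φ.φd Φ.ψd l (x + u) - gen Φ.φd Φ.ψd l x) ^ 2) ≤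
      ENNReal.ofReal (max C₁ C₂ * min 1 |u|) := fun u => by
    have hmin : 0 ≤ min 1 |u| := by positivity
    unfold gen
    split_ifs
    · exact (h1 u).trans (ENNReal.ofReal_le_ofReal (by gcongr; exact le_max_left _ _))
    · exact (h2 u).trans (ENNReal.ofReal_le_ofReal (by gcongr; exact le_max_right _ _))
  set g := gen Φ.φd Φ.ψd l with hg
  have e : ∀ x, ENNReal.ofReal ((Φ.syn l (x + h) - Φ.syn l x) ^ 2) = ENNReal.ofReal (2 ^ lev l) *
      ENNReal.ofReal ((g (2 ^ lev l * x - l.1.2 + 2 ^ lev l * h) -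
        g (2 ^ lev l * x - l.1.2)) ^ 2) := fun x => by
    simp only [Generators.syn]
    rw [wavelet_eq, wavelet_eq, ← mul_sub, mul_pow, Real.sq_sqrt hp.le, ENNReal.ofReal_mul hp.le]
    congr 5
    ring
  simp_rw [e]
  rw [lintegral_const_mul' _ _ ENNReal.ofReal_ne_top,
    lintegral_comp_mul_left_real hp fun y =>
      ENNReal.ofReal ((g (y - l.1.2 + 2 ^ lev l * h) - g (y - l.1.2)) ^ 2),
    ← mul_assoc, ← ENNReal.ofReal_mul hp.le, mul_inv_cancel₀ hp.ne', ENNReal.ofReal_one, one_mul,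
    lintegral_sub_right_eq_self
      (fun z => ENNReal.ofReal ((g (z + 2 ^ lev l * h) - g z) ^ 2)) (l.1.2 : ℝ)]
  refine (hgen _).trans_eq ?_
  rw [abs_mul, abs_of_pos hp]

/-- The increments of the part of an expansion at one level. -/
lemma exists_eLpNorm_level_shift_le : ∃ C : ℝ, 0 ≤ C ∧ ∀ (i : ℕ) (K : Finset ℤ) (b : ℤ → ℝ) (h : ℝ),
    eLpNorm (fun x => ∑ k ∈ K, b k * (Φ.syn (idxEquiv (i, k)) (x + h) -
      Φ.syn (idxEquiv (i, k)) x)) 2 volume ^ 2 ≤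
      ENNReal.ofReal (C * min 1 (2 ^ i * |h|)) * ∑ k ∈ K, ENNReal.ofReal (b k ^ 2) := by
  classical
  obtain ⟨C, hC, hshift⟩ := hΦ.exists_lintegral_syn_shift_le
  obtain ⟨A, hA, hsupp⟩ := hΦ.ana_support
  set D : ℝ := 2 * (2 * A + 1) with hD
  have hD0 : 0 ≤ D := by positivity
  refine ⟨D * C, by positivity, fun i K b h => ?_⟩
  set j := lev (idxEquiv (i, 0)) with hj
  have hji : j ≤ i := lev_idxEquiv_le (i, 0)
  have hlev : ∀ k, lev (idxEquiv (i, k)) = j := fun k => rfl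
  let d : ℤ → ℝ → ℝ := fun k x => Φ.syn (idxEquiv (i, k)) (x + h) - Φ.syn (idxEquiv (i, k)) x
  have hdm : ∀ k, AEMeasurable (fun x => ENNReal.ofReal (d k x ^ 2)) volume := fun k =>
    ((((memLp_comp_add (hΦ.memLp_syn _) h).sub
      (hΦ.memLp_syn _)).1.aemeasurable).pow_const 2).ennreal_ofReal
  -- At each point only boundedly many increments are nonzero, so Cauchy-Schwarz makes the functions
  -- of one level almost orthogonal.
  have hcount : ∀ x, ∑ k ∈ K, (if d k x ≠ 0 then (1 : ℝ) else 0) ≤ D := fun x => by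
    have h1 : ENNReal.ofReal (∑ k ∈ K, (if d k x ≠ 0 then (1 : ℝ) else 0)) ≤
        ENNReal.ofReal D := by
      calc _ = ∑ k ∈ K, (if d k x ≠ 0 then (1 : ℝ≥0∞) else 0) := by
            rw [ENNReal.ofReal_sum_of_nonneg fun k _ => by split_ifs <;> norm_num]
            refine Finset.sum_congr rfl fun k _ => ?_
            split_ifs <;> simp
        _ ≤ ∑ k ∈ K, ((if |2 ^ j * (x + h) - k| ≤ A then (1 : ℝ≥0∞) else 0) +
            (if |2 ^ j * x - k| ≤ A then (1 : ℝ≥0∞) else 0)) := by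
            refine Finset.sum_le_sum fun k _ => ?_
            by_cases h1 : |2 ^ j * (x + h) - k| ≤ A
            · rw [if_pos h1]
              split_ifs <;> simp
            · by_cases h2 : |2 ^ j * x - k| ≤ A
              · rw [if_pos h2]
                split_ifs <;> simp
              · rw [if_neg]
                · exact zero_le
                · rw [not_not]
                  have e1 := (hsupp (idxEquiv (i, k)) (x + h) (by
                    rw [hlev k]; exact not_le.1 h1)).2
                  have e2 := (hsupp (idxEquiv (i, k)) x (by rw [hlev k]; exact not_le.1 h2)).2
                  simp only [d]
                  rw [e1, e2, sub_zero]
        _ ≤ ∑' k : ℤ, ((if |2 ^ j * (x + h) - k| ≤ A then (1 : ℝ≥0∞) else 0) +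
            (if |2 ^ j * x - k| ≤ A then (1 : ℝ≥0∞) else 0)) := ENNReal.sum_le_tsum _
        _ ≤ ENNReal.ofReal (2 * A + 1) + ENNReal.ofReal (2 * A + 1) := by
            rw [ENNReal.tsum_add]
            exact add_le_add (tsum_translates_le (by linarith) _)
              (tsum_translates_le (by linarith) _)
        _ = ENNReal.ofReal D := by
            rw [← ENNReal.ofReal_add (by positivity) (by positivity), ← two_mul]
    exact (ENNReal.ofReal_le_ofReal_iff hD0).1 h1
  have hpt : ∀ x, (∑ k ∈ K, b k * d k x) ^ 2 ≤ D * ∑ k ∈ K, b k ^ 2 * d k x ^ 2 := fun x => by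
    calc (∑ k ∈ K, b k * d k x) ^ 2
        = (∑ k ∈ K, (if d k x ≠ 0 then (1 : ℝ) else 0) * (b k * d k x)) ^ 2 := by
          congr 1
          refine Finset.sum_congr rfl fun k _ => ?_
          split_ifs with hk
          · rw [one_mul]
          · rw [not_not] at hk
            rw [hk]; simp
      _ ≤ (∑ k ∈ K, (if d k x ≠ 0 then (1 : ℝ) else 0) ^ 2) * ∑ k ∈ K, (b k * d k x) ^ 2 :=
          Finset.sum_mul_sq_le_sq_mul_sq _ _ _
      _ ≤ D * ∑ k ∈ K, (b k * d k x) ^ 2 := by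
          gcongr
          refine le_trans (le_of_eq ?_) (hcount x)
          refine Finset.sum_congr rfl fun k _ => ?_
          split_ifs <;> norm_num
      _ = _ := by simp_rw [mul_pow]
  rw [eLpNorm_two_sq]
  calc _ ≤ ∫⁻ x, ENNReal.ofReal D * ∑ k ∈ K, ENNReal.ofReal (b k ^ 2) *
        ENNReal.ofReal (d k x ^ 2) := by
        refine lintegral_mono fun x => (ENNReal.ofReal_le_ofReal (hpt x)).trans_eq ?_
        rw [ENNReal.ofReal_mul hD0, ENNReal.ofReal_sum_of_nonneg fun k _ => by positivity]
        congr 1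
        exact Finset.sum_congr rfl fun k _ => ENNReal.ofReal_mul (sq_nonneg _)
    _ = ENNReal.ofReal D * ∑ k ∈ K, ENNReal.ofReal (b k ^ 2) *
        ∫⁻ x, ENNReal.ofReal (d k x ^ 2) := by
        rw [lintegral_const_mul' _ _ ENNReal.ofReal_ne_top,
          lintegral_finsetSum' _ fun k _ => (hdm k).const_mul _]
        congr 1
        exact Finset.sum_congr rfl fun k _ => lintegral_const_mul' _ _ ENNReal.ofReal_ne_top
    _ ≤ ENNReal.ofReal D * ∑ k ∈ K, ENNReal.ofReal (b k ^ 2) *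
        ENNReal.ofReal (C * min 1 (2 ^ i * |h|)) := by
        gcongr with k _
        refine (hshift (idxEquiv (i, k)) h).trans (ENNReal.ofReal_le_ofReal ?_)
        rw [hlev k]
        gcongr
        exact one_le_two
    _ = _ := by
        rw [← Finset.sum_mul, mul_comm (Finset.sum _ _), ← mul_assoc, ← ENNReal.ofReal_mul hD0,
          ← mul_assoc]

/-- Minkowski's inequality over the levels: level `i` contributes √min(1, 2^i|h|) times its energy
2^(-iα), and these sum to order |h|^α. -/
lemma eLpNorm_shift_sub_le_of_levelEnergy_le {α : ℝ} (hα : 0 < α) (hα' : α < 1 / 2) :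
    ∃ K : ℝ, 0 < K ∧ ∀ (f : ℝ → ℝ), MemLp f 2 volume → ∀ M : ℝ, 0 ≤ M →
      (∀ i, levelEnergy Φ f i ≤ ENNReal.ofReal ((M * (2 ^ (-α)) ^ i) ^ 2)) → ∀ h : ℝ, h ≠ 0 →
      eLpNorm (fun x => f (x + h) - f x) 2 volume ≤ ENNReal.ofReal (K * M * |h| ^ α) := by
  classical
  obtain ⟨C, hC, hlevel⟩ := hΦ.exists_eLpNorm_level_shift_le
  obtain ⟨K, hK, hsum⟩ := exists_sum_sqrt_min_le hα hα'
  refine ⟨(Real.sqrt C + 1) * K, by positivity, fun f hf M hM hE h hh => ?_⟩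
  set p : ℝ := 2 ^ (-α) with hp
  have hp0 : 0 < p := Real.rpow_pos_of_pos two_pos _
  -- Rectangles exhaust the index set and group into levels; unconditional convergence permits
  -- summation along them.
  let T : ℕ → Finset (ℕ × ℤ) := fun m => Finset.range m ×ˢ Finset.Icc (-(m : ℤ)) m
  let S : ℕ → Finset Idx := fun m => (T m).map idxEquiv.toEmbedding
  have hS : Tendsto S atTop atTop := by
    refine tendsto_atTop_finset_of_monotone (fun m m' hm => ?_) fun l => ?_
    · refine Finset.map_subset_map.2 (Finset.product_subset_product
        (Finset.range_mono hm) (Finset.Icc_subset_Icc ?_ ?_))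
      · simpa using hm
      · exact_mod_cast hm
    · obtain ⟨⟨i, k⟩, rfl⟩ := idxEquiv.surjective l
      refine ⟨i + 1 + k.natAbs, Finset.mem_map.2 ⟨(i, k), ?_, rfl⟩⟩
      simp only [T, Finset.mem_product, Finset.mem_range, Finset.mem_Icc]
      omega
  let F : ℕ → ℝ → ℝ := fun m x => ∑ l ∈ S m, Φ.coeff f l * Φ.syn l x
  have hF : ∀ m, MemLp (F m) 2 volume := fun m => hΦ.memLp_sum_syn _ _
  have hlim : Tendsto (fun m => eLpNorm (fun x => f x - F m x) 2 volume) atTop (𝓝 0) :=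
    (hΦ.expansion f hf).comp hS
  let G : ℕ → ℕ → ℝ → ℝ := fun m i x => ∑ k ∈ Finset.Icc (-(m : ℤ)) m,
    Φ.coeff f (idxEquiv (i, k)) * (Φ.syn (idxEquiv (i, k)) (x + h) - Φ.syn (idxEquiv (i, k)) x)
  have hG : ∀ m i, MemLp (G m i) 2 volume := fun m i => memLp_finsetSum _ fun k _ =>
    ((memLp_comp_add (hΦ.memLp_syn _) h).sub (hΦ.memLp_syn _)).const_mul _
  have hFG : ∀ m x, F m (x + h) - F m x = ∑ i ∈ Finset.range m, G m i x := fun m x => by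
    simp only [F, G, S, T, Finset.sum_map, Finset.sum_product, Equiv.coe_toEmbedding]
    rw [← Finset.sum_sub_distrib]
    refine Finset.sum_congr rfl fun i _ => ?_
    rw [← Finset.sum_sub_distrib]
    exact Finset.sum_congr rfl fun k _ => by ring
  have hGle : ∀ m i, eLpNorm (G m i) 2 volume ≤
      ENNReal.ofReal (Real.sqrt C * M * (Real.sqrt (min 1 (2 ^ i * |h|)) * p ^ i)) := fun m i => by
    have hmin : 0 ≤ min 1 (2 ^ i * |h|) := by positivity
    refine (ENNReal.pow_right_strictMono two_ne_zero).le_iff_le.1 ?_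
    rw [← ENNReal.ofReal_pow (by positivity)]
    calc _ ≤ ENNReal.ofReal (C * min 1 (2 ^ i * |h|)) * levelEnergy Φ f i :=
          (hlevel i _ (fun k => Φ.coeff f (idxEquiv (i, k))) h).trans
            (by gcongr; exact ENNReal.sum_le_tsum _)
      _ ≤ ENNReal.ofReal (C * min 1 (2 ^ i * |h|)) * ENNReal.ofReal ((M * p ^ i) ^ 2) := by
          gcongr
          exact hE i
      _ = _ := by
          rw [← ENNReal.ofReal_mul (by positivity)]
          congr 1
          simp only [mul_pow]
          rw [Real.sq_sqrt hC, Real.sq_sqrt hmin]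
          ring
  -- The truncation error enters twice, through f and its translate, and disappears as m grows.
  have hbound : ∀ m, eLpNorm (fun x => f (x + h) - f x) 2 volume ≤
      2 * eLpNorm (fun x => f x - F m x) 2 volume +
        ENNReal.ofReal ((Real.sqrt C + 1) * K * M * |h| ^ α) := fun m => by
    have hfF : MemLp (fun x => f x - F m x) 2 volume := hf.sub (hF m)
    have e : (fun x => f (x + h) - f x) =
        (fun x => (f (x + h) - F m (x + h)) - (f x - F m x)) + ∑ i ∈ Finset.range m, G m i := by
      funext x
      rw [Pi.add_apply, Finset.sum_apply, ← hFG]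
      ring
    rw [e]
    refine (eLpNorm_add_le ((memLp_comp_add hfF h).sub hfF).1
      (Finset.aestronglyMeasurable_sum _ fun i _ => (hG m i).1) one_le_two).trans ?_
    refine add_le_add (eLpNorm_shift_sub_le hfF h) ?_
    calc _ ≤ ∑ i ∈ Finset.range m, eLpNorm (G m i) 2 volume :=
          eLpNorm_sum_le (fun i _ => (hG m i).1) one_le_two
      _ ≤ ∑ i ∈ Finset.range m,
          ENNReal.ofReal (Real.sqrt C * M * (Real.sqrt (min 1 (2 ^ i * |h|)) * p ^ i)) :=
          Finset.sum_le_sum fun i _ => hGle m i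
      _ = ENNReal.ofReal (Real.sqrt C * M *
          ∑ i ∈ Finset.range m, Real.sqrt (min 1 (2 ^ i * |h|)) * p ^ i) := by
          rw [Finset.mul_sum, ENNReal.ofReal_sum_of_nonneg fun i _ => by positivity]
      _ ≤ _ := by
          refine ENNReal.ofReal_le_ofReal ?_
          calc _ ≤ (Real.sqrt C + 1) * M * (K * |h| ^ α) := by
                gcongr
                · linarith
                · exact hsum _ (abs_pos.2 hh) m
            _ = _ := by ring
  have hlim' := (ENNReal.Tendsto.const_mul (a := 2) hlim (Or.inr (by simp))).add_const
    (ENNReal.ofReal ((Real.sqrt C + 1) * K * M * |h| ^ α))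
  simpa using ge_of_tendsto' hlim' hbound

/-- The direct theorem: decay of the coefficients implies Besov regularity. -/
lemma mem_besov_of_levelEnergy_le {α : ℝ} (hα : 0 < α) (hα' : α < 1 / 2) {f : ℝ → ℝ}
    (hf : MemLp f 2 volume) {M : ℝ} (hM : 0 ≤ M)
    (hE : ∀ i, levelEnergy Φ f i ≤ ENNReal.ofReal ((M * (2 ^ (-α)) ^ i) ^ 2)) : f ∈ besov α := by
  obtain ⟨K, hK, h⟩ := hΦ.eLpNorm_shift_sub_le_of_levelEnergy_le hα hα'
  refine ⟨hf, lt_of_le_of_lt (b := ENNReal.ofReal (K * M)) ?_ ENNReal.ofReal_lt_top⟩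
  refine iSup₂_le fun t ht => ?_
  -- Since α < 1, the modulus in the Besov definition is of first order.
  have hfloor : ⌊α⌋₊ = 0 := Nat.floor_eq_zero.2 (by linarith)
  have hmod : modulus (⌊α⌋₊ + 1) f t ≤ ENNReal.ofReal (K * M * t ^ α) := by
    rw [hfloor]
    refine iSup₂_le fun u hu => ?_
    change eLpNorm (fun x => f (x + u) - f x) 2 volume ≤ _
    rcases eq_or_ne u 0 with rfl | hu0
    · simp
    · refine (h f hf M hM hE u hu0).trans (ENNReal.ofReal_le_ofReal ?_)
      gcongr
  calc _ ≤ ENNReal.ofReal (t ^ (-α)) * ENNReal.ofReal (K * M * t ^ α) := by gcongr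
    _ = ENNReal.ofReal (K * M) := by
        rw [← ENNReal.ofReal_mul (by positivity), Real.rpow_neg ht.le]
        congr 1
        have := Real.rpow_pos_of_pos ht α
        field_simp

end IsAdmissible

/-- For `c' = -c`, the balls of the approximation space are contained in Besov balls. -/
lemma exists_ballB_subset_ballBesov {Φ : Generators} (hΦ : IsAdmissible Φ) {c s : ℝ} {j₀ : ℕ → ℤ}
    (hc : 1 ≤ c) (hj₀ : IsCutoff c (-c) j₀) (hs : 0 < s) (hs' : s < 1 / 2) :
    ∃ K : ℝ, 0 < K ∧ ∀ R, 0 < R → ballB Φ j₀ s R ∩ ballL2 R ⊆ ballBesov Φ (s / c) (K * R) := by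
  obtain ⟨K, hK, hE⟩ := exists_levelEnergy_le hΦ hc hj₀ hs hs'
  have hα : 0 < s / c := by positivity
  have hα' : s / c < 1 / 2 := (div_le_self hs.le hc).trans_lt hs'
  refine ⟨2 * K, by positivity, fun R hR f hf => ⟨hf.1.1, ?_, ?_⟩⟩
  · exact hΦ.mem_besov_of_levelEnergy_le hα hα' hf.2.1 (by positivity) (hE R hR f hf)
  · rw [mul_assoc]
    exact besovNorm_le hα (by positivity) (hE R hR f hf)

end Modulus

end PoissonMaxiset

end

open PoissonMaxiset in
theorem theorem2
    (Φ : Generators) (hΦ : IsWaveletBasis Φ)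
    (c c' γ : ℝ) (hc : 1 ≤ c) (hγ : c < γ)
    (j₀ : ℕ → ℤ) (hj₀ : IsCutoff c c' j₀)
    {Ω : (ℝ → ℝ) → ℕ → Type*} [∀ f n, MeasurableSpace (Ω f n)]
    (P : ∀ f n, MeasureTheory.Measure (Ω f n)) (N : ∀ f n, Ω f n → Set ℝ)
    (hN : ∀ f ∈ intensities, ∀ n : ℕ, 1 ≤ n →
      IsPoissonProcess (P f n) (N f n) (meanMeasure n f))
    (s : ℝ) (hs : 0 < s) (hs' : s < 1 / 2) :
    EqUpToRadii (fun R => ballMS P N Φ γ j₀ s R)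
      (fun R => ballB Φ j₀ s R ∩ ballW Φ s R) ∧
    (c' = -c → s / c < Φ.r + 1 →
      EqUpToRadii (fun R => ballMS P N Φ γ j₀ s R)
        (fun R => ballBesov Φ (s / c) R ∩ ballW Φ s R)) := by
  have hA := hΦ.isAdmissible
  have hγ1 : 1 ≤ γ := hc.trans hγ.le
  refine ⟨⟨fun R hR => ?_, fun R hR => ?_⟩, ?_⟩
  · obtain ⟨R', hR', h⟩ := exists_ballMS_subset hA hN hγ1 j₀ hs hs' hR
    exact ⟨R', hR', fun f hf => ⟨⟨h ⟨hf.1.1, hf.2⟩, hf.1.2⟩, hf.2⟩⟩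
  · obtain ⟨R', hR', h⟩ := exists_subset_ballMS hA hN hc hγ hj₀ hs' hR
    exact ⟨R', hR', fun f hf => ⟨⟨h hf, hf.1.2⟩, hf.2⟩⟩
  · rintro rfl -
    refine ⟨fun R hR => ?_, fun R hR => ?_⟩
    · obtain ⟨R₁, hR₁, h₁⟩ := exists_ballMS_subset hA hN hγ1 j₀ hs hs' hR
      obtain ⟨K, hK, h₂⟩ := exists_ballB_subset_ballBesov hA hc hj₀ hs hs'
      -- One radius must serve both the approximation ball and the L² ball.
      set R₂ := max R₁ R
      have hR₂ : 0 < R₂ := lt_max_of_lt_left hR₁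
      refine ⟨max R₁ (K * R₂), lt_max_of_lt_left hR₁, fun f hf => ⟨⟨⟨?_, ?_⟩, hf.1.2⟩, hf.2⟩⟩
      · have h₃ := h₂ R₂ hR₂ ⟨ballB_mono hR₁.le (le_max_left _ _) (h₁ ⟨hf.1.1, hf.2⟩).1, hf.2.1,
          hf.2.2.trans (ENNReal.ofReal_le_ofReal (le_max_right _ _))⟩
        exact ⟨h₃.1, h₃.2.1, h₃.2.2.trans (ENNReal.ofReal_le_ofReal (le_max_right _ _))⟩
      · exact ballW_mono hs' hR₁.le (le_max_left _ _) (h₁ ⟨hf.1.1, hf.2⟩).2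
    · obtain ⟨K, hK, h₁⟩ := exists_ballBesov_subset_ballB (Φ := Φ) hc hj₀ hs hs'
      -- Again a common radius, now for the approximation, weak Besov, L¹ and L² balls together.
      set R₁ := max (K * R) R
      have hR₁ : 0 < R₁ := lt_max_of_lt_right hR
      have hRle : ENNReal.ofReal R ≤ ENNReal.ofReal R₁ :=
        ENNReal.ofReal_le_ofReal (le_max_right _ _)
      obtain ⟨R', hR', h₂⟩ := exists_subset_ballMS hA hN hc hγ hj₀ hs' hR₁
      refine ⟨R', hR', fun f hf => ⟨⟨h₂ ⟨⟨⟨?_, ?_⟩, ?_⟩, ?_⟩, hf.1.2⟩, hf.2⟩⟩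
      · exact ballB_mono (by positivity) (le_max_left _ _) (h₁ R hR hf.1.1.1)
      · exact ballW_mono hs' hR.le (le_max_right _ _) hf.1.1.2
      · exact ⟨hf.1.2.1, hf.1.2.2.trans hRle⟩
      · exact ⟨hf.2.1, hf.2.2.trans hRle⟩
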